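/- Let $M$ be a smooth $n$-manifold and $p\colon Z\to M$ a smooth bundle of $n$-dimensional real tori with structure group $\mathrm{Aut}(\mathbb R^n/\mathbb Z^n)=GL(n,\mathbb Z)$ and zero section $s$. Put $V=s^*T_{Z/M}$, let $\Lambda\subset V$ be the lattice with $Z\cong \mathrm{tot}(V)/\Lambda$, let $\nabla$ be the flat (Gauss–Manin) connection on $V$ for which the local sections of $\Lambda$ are flat, and let $\nabla^\vee$ be the dual connection on $V^\vee$. The connection $\nabla$ splits the tangent sequence $0\to p^*V\to T_Z\to p^*T_M\to 0$ and so gives an orthogonal isomorphism $F\colon T_Z\oplus T_Z^\vee\to p^*(V\oplus T_M\oplus V^\vee\oplus T_M^\vee)$. A generalized almost complex structure on a vector bundle $W$ is a smooth bundle endomorphism of $W\oplus W^\vee$ with square $-1$ that is orthogonal for $\langle v+f,w+g\rangle=-\tfrac12(f(w)+g(v))$. Let $\mathcal J=F^{-1}(p^*\underline{\mathcal J})F$ be a semi-flat generalized almost complex structure on $Z$: here $\underline{\mathcal J}$ is a generalized almost complex structure on $V\oplus T_M$ with $\underline{\mathcal J}(V\oplus V^\vee)=T_M\oplus T_M^\vee$.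 Let $\widehat Z=\mathrm{tot}(V^\vee)/\Lambda^\vee\to M$ be the dual torus bundle, where $\Lambda^\vee$ is the lattice of linear forms that are integral on $\Lambda$, let $\widehat{\underline{\mathcal J}}$ be the endomorphism of $V^\vee\oplus T_M\oplus V\oplus T_M^\vee$ obtained from $\underline{\mathcal J}$ by exchanging the summands $V$ and $V^\vee$, and let $\widehat{\mathcal J}$ be the mirror structure on $\widehat Z$, constructed from $\widehat{\underline{\mathcal J}}$ and $\nabla^\vee$ as $\mathcal J$ is from $\underline{\mathcal J}$ and $\nabla$. Then: 1. $\Delta=\underline{\mathcal J}(V)$ and $\widehat\Delta=\underline{\mathcal J}(V^\vee)$ are almost Dirac structures on $M$, that is, maximally isotropic smooth subbundles of $T_M\oplus T_M^\vee$. 2. The connections on $\Delta$ and $\widehat\Delta$ that correspond to $\nabla$ and $\nabla^\vee$ under the isomorphisms $\underline{\mathcal J}\colon V\to\Delta$ and $\underline{\mathcal J}\colon V^\vee\to\widehat\Delta$ are flat connections. 3. $\widehat{\mathcal J}$ is semi-flat, and mirror symmetry exchanges $\Delta$ and $\widehat\Delta$ together with their connections: $\widehat{\underline{\mathcal J}}(V^\vee)=\widehat\Delta$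 and $\widehat{\underline{\mathcal J}}(V)=\Delta$, and the connections induced from $\nabla^\vee$ and $\nabla$ by $\widehat{\underline{\mathcal J}}$ are those of item 2. 4. If $\mathcal J$ is integrable (the sections of its $+i$-eigenbundle in $(T_Z\oplus T_Z^\vee)\otimes\mathbb C$ are closed under the Courant bracket), then $\Delta$ and $\widehat\Delta$ are integrable (their sections are closed under the Courant bracket). -/

import Mathlib

open Set Filter Topology
open scoped Manifold ContDiff

noncomputable section

namespace TorusMirror

/-! ### Generalized linear algebra on `W ⊕ W^∨` -/

/-- `W ⊕ W^∨`. -/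
abbrev Dbl (W : Type*) [AddCommGroup W] [Module ℝ W] [TopologicalSpace W] : Type _ :=
  W × (W →L[ℝ] ℝ)

/-- The canonical pairing `⟨v + f, w + g⟩ = -(f(w) + g(v)) / 2` on `W ⊕ W^∨`. -/
def pairing {W : Type*} [AddCommGroup W] [Module ℝ W] [TopologicalSpace W] (a b : Dbl W) : ℝ :=
  -(1 / 2) * (a.2 b.1 + b.2 a.1)

section Inclusions

variable (A B : Type*) [AddCommGroup A] [Module ℝ A] [TopologicalSpace A]
  [AddCommGroup B] [Module ℝ B] [TopologicalSpace B]

/-- The inclusion of `A ⊕ A^∨` into `(A ⊕ B) ⊕ (A ⊕ B)^∨`. -/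
def inclFst : Dbl A →ₗ[ℝ] Dbl (A × B) where
  toFun a := ((a.1, 0), a.2.comp (ContinuousLinearMap.fst ℝ A B))
  map_add' _ _ := by ext <;> simp
  map_smul' _ _ := by ext <;> simp

/-- The inclusion of `B ⊕ B^∨` into `(A ⊕ B) ⊕ (A ⊕ B)^∨`. -/
def inclSnd : Dbl B →ₗ[ℝ] Dbl (A × B) where
  toFun b := ((0, b.1), b.2.comp (ContinuousLinearMap.snd ℝ A B))
  map_add' _ _ := by ext <;> simp
  map_smul' _ _ := by ext <;> simp

/-- The projection of `(A ⊕ B) ⊕ (A ⊕ B)^∨` to `A ⊕ A^∨`. -/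
def projFst : Dbl (A × B) →ₗ[ℝ] Dbl A where
  toFun c := (c.1.1, c.2.comp (ContinuousLinearMap.inl ℝ A B))
  map_add' _ _ := by ext <;> simp
  map_smul' _ _ := by ext <;> simp

/-- The projection of `(A ⊕ B) ⊕ (A ⊕ B)^∨` to `B ⊕ B^∨`. -/
def projSnd : Dbl (A × B) →ₗ[ℝ] Dbl B where
  toFun c := (c.1.2, c.2.comp (ContinuousLinearMap.inr ℝ A B))
  map_add' _ _ := by ext <;> simp
  map_smul' _ _ := by ext <;> simp

end Inclusions

/-! ### Local sections

A vector bundle over `N` enters through its fibres `W x` and the predicate `S U w`, saying that the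
family `w` is smooth as a section over the open set `U` (its values outside `U` are irrelevant). -/

/-- Smooth local sections of the dual bundle: the evaluation on every smooth local section of the
bundle is a smooth function. -/
def SmoothDual (E : Type*) [NormedAddCommGroup E] [NormedSpace ℝ E]
    {N : Type*} [TopologicalSpace N] [ChartedSpace E N]
    {W : N → Type*} [∀ x, AddCommGroup (W x)] [∀ x, Module ℝ (W x)] [∀ x, TopologicalSpace (W x)]
    (S : Set N → (∀ x, W x) → Prop) (U : Set N) (γ : ∀ x, W x →L[ℝ] ℝ) : Prop :=
  ∀ U' : Set N, IsOpen U' → U' ⊆ U → ∀ w : ∀ x, W x, S U' w →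
    ContMDiffOn 𝓘(ℝ, E) 𝓘(ℝ, ℝ) ∞ (fun x => γ x (w x)) U'

/-- Smooth local sections of `W ⊕ W^∨`. -/
def SmoothDbl (E : Type*) [NormedAddCommGroup E] [NormedSpace ℝ E]
    {N : Type*} [TopologicalSpace N] [ChartedSpace E N]
    {W : N → Type*} [∀ x, AddCommGroup (W x)] [∀ x, Module ℝ (W x)] [∀ x, TopologicalSpace (W x)]
    (S : Set N → (∀ x, W x) → Prop) (U : Set N) (a : ∀ x, Dbl (W x)) : Prop :=
  S U (fun x => (a x).1) ∧ SmoothDual E S U (fun x => (a x).2)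

/-- A generalized almost complex structure on the vector bundle `W`: a smooth orthogonal bundle
endomorphism of `W ⊕ W^∨` with square `-1`. Smoothness of an endomorphism means that it maps
smooth local sections to smooth local sections. -/
structure IsGenAlmostComplex (E : Type*) [NormedAddCommGroup E] [NormedSpace ℝ E]
    {N : Type*} [TopologicalSpace N] [ChartedSpace E N]
    {W : N → Type*} [∀ x, AddCommGroup (W x)] [∀ x, Module ℝ (W x)] [∀ x, TopologicalSpace (W x)]
    (S : Set N → (∀ x, W x) → Prop) (J : ∀ x, Dbl (W x) →ₗ[ℝ] Dbl (W x)) : Prop where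
  sq : ∀ x a, J x (J x a) = -a
  orth : ∀ x a b, pairing (J x a) (J x b) = pairing a b
  smooth : ∀ U : Set N, IsOpen U → ∀ a : ∀ x, Dbl (W x), SmoothDbl E S U a →
    SmoothDbl E S U (fun x => J x (a x))

/-! ### The Courant bracket on a manifold -/

section Courant

variable {E : Type*} [NormedAddCommGroup E] [NormedSpace ℝ E]
  {N : Type*} [TopologicalSpace N] [ChartedSpace E N]

/-- The fibre `T_x ⊕ T_x^∨`. -/
abbrev TT (E : Type*) [NormedAddCommGroup E] [NormedSpace ℝ E]
    {N : Type*} [TopologicalSpace N] [ChartedSpace E N] (x : N) : Type _ :=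
  Dbl (TangentSpace 𝓘(ℝ, E) x)

/-- Smooth local vector fields. -/
def SmoothVF [IsManifold 𝓘(ℝ, E) ∞ N] (U : Set N) (X : ∀ x : N, TangentSpace 𝓘(ℝ, E) x) : Prop :=
  ContMDiffOn 𝓘(ℝ, E) 𝓘(ℝ, E).tangent ∞ (fun x => (⟨x, X x⟩ : TangentBundle 𝓘(ℝ, E) N)) U

/-- Smooth local sections of `T_N ⊕ T_N^∨`. -/
def SmoothTT [IsManifold 𝓘(ℝ, E) ∞ N] (U : Set N) (a : ∀ x : N, TT E x) : Prop :=
  SmoothDbl E (SmoothVF (E := E) (N := N)) U a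

/-- Lie derivative of a one-form along a vector field, on a vector space:
`(L_X η)(w) = (Dη · X)(w) + η(DX · w)`. -/
def lieForm (X : E → E) (η : E → E →L[ℝ] ℝ) (y : E) : E →L[ℝ] ℝ :=
  fderiv ℝ η y (X y) + (η y).comp (fderiv ℝ X y)

/-- The one-form part `L_X η - L_Y ξ + (1/2) d(ι_Y ξ - ι_X η)` of the Courant bracket
`[X + ξ, Y + η]` on a vector space. -/
def courantForm (X : E → E) (ξ : E → E →L[ℝ] ℝ) (Y : E → E) (η : E → E →L[ℝ] ℝ) (y : E) :
    E →L[ℝ] ℝ :=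
  lieForm X η y - lieForm Y ξ y + (1 / 2 : ℝ) • fderiv ℝ (fun z => ξ z (Y z) - η z (X z)) y

/-- A vector field in the preferred chart at `x₀`. -/
def vfInChart (x₀ : N) (X : ∀ x : N, TangentSpace 𝓘(ℝ, E) x) (y : E) : E :=
  VectorField.mpullback 𝓘(ℝ, E) 𝓘(ℝ, E) (extChartAt 𝓘(ℝ, E) x₀).symm X y

/-- A one-form in the preferred chart at `x₀`. -/
def formInChart (x₀ : N) (ξ : ∀ x : N, TangentSpace 𝓘(ℝ, E) x →L[ℝ] ℝ) (y : E) : E →L[ℝ] ℝ :=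
  (ξ ((extChartAt 𝓘(ℝ, E) x₀).symm y)).comp
    (mfderiv 𝓘(ℝ, E) 𝓘(ℝ, E) (extChartAt 𝓘(ℝ, E) x₀).symm y)

/-- The Courant bracket `[X + ξ, Y + η] = [X, Y] + L_X η - L_Y ξ + (1/2) d(ι_Y ξ - ι_X η)`
on a manifold without boundary; the one-form part is computed in the preferred chart. -/
def courant (a b : ∀ x : N, TT E x) (x : N) : TT E x :=
  (VectorField.mlieBracket 𝓘(ℝ, E) (fun y => (a y).1) (fun y => (b y).1) x,
    (courantForm (vfInChart x fun y => (a y).1) (formInChart x fun y => (a y).2)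
      (vfInChart x fun y => (b y).1) (formInChart x fun y => (b y).2)
      (extChartAt 𝓘(ℝ, E) x x)).comp
    (mfderiv 𝓘(ℝ, E) 𝓘(ℝ, E) (extChartAt 𝓘(ℝ, E) x) x))

variable [IsManifold 𝓘(ℝ, E) ∞ N]

/-- `a + i b` is a smooth section over `U` of the `+i`-eigenbundle of `J` in
`(T_N ⊕ T_N^∨) ⊗ ℂ`. -/
def IsEigenSection (J : ∀ x : N, TT E x →ₗ[ℝ] TT E x) (U : Set N) (a b : ∀ x : N, TT E x) : Prop :=
  SmoothTT U a ∧ SmoothTT U b ∧ ∀ x ∈ U, J x (a x) = -b x ∧ J x (b x) = a x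

/-- Integrability of `J`: the sheaf of sections of the `+i`-eigenbundle is closed under the
complex bilinear extension
`[a + i b, c + i d] = ([a, c] - [b, d]) + i ([a, d] + [b, c])` of the Courant bracket (which is
smooth, so that only the pointwise membership has to be required). -/
def Integrable (J : ∀ x : N, TT E x →ₗ[ℝ] TT E x) : Prop :=
  ∀ U : Set N, IsOpen U → ∀ a b c d : ∀ x : N, TT E x,
    IsEigenSection J U a b → IsEigenSection J U c d →
    ∀ x ∈ U,
      J x (courant a c x - courant b d x) = -(courant a d x + courant b c x) ∧
      J x (courant a d x + courant b c x) = courant a c x - courant b d x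

/-! ### Almost Dirac structures and flat connections on them -/

/-- `a` is a smooth section over `U` of the family of subspaces `L` of `T_N ⊕ T_N^∨`. -/
def IsSection (L : ∀ x : N, Submodule ℝ (TT E x)) (U : Set N) (a : ∀ x : N, TT E x) : Prop :=
  SmoothTT U a ∧ ∀ x ∈ U, a x ∈ L x

/-- Almost Dirac structures: maximally isotropic smooth subbundles of `T_N ⊕ T_N^∨`. -/
structure IsAlmostDirac (L : ∀ x : N, Submodule ℝ (TT E x)) : Prop where
  isotropic : ∀ x, ∀ a ∈ L x, ∀ b ∈ L x, pairing a b = 0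
  maximal : ∀ x, ∀ K : Submodule ℝ (TT E x), (∀ a ∈ K, ∀ b ∈ K, pairing a b = 0) →
    L x ≤ K → K = L x
  subbundle : ∀ x : N, ∃ U : Set N, IsOpen U ∧ x ∈ U ∧ ∃ (r : ℕ) (e : Fin r → ∀ y : N, TT E y),
    (∀ k, SmoothTT U (e k)) ∧
    ∀ y ∈ U, LinearIndependent ℝ (fun k => e k y) ∧ Submodule.span ℝ (range fun k => e k y) = L y

/-- Integrability of an almost Dirac structure: its sheaf of sections is closed under the Courant
bracket (which is smooth, so that only the pointwise membership has to be required). -/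
def DiracIntegrable (L : ∀ x : N, Submodule ℝ (TT E x)) : Prop :=
  ∀ U : Set N, IsOpen U → ∀ a b : ∀ x : N, TT E x, IsSection L U a → IsSection L U b →
    ∀ x ∈ U, courant a b x ∈ L x

/-- `D` is a flat connection on the subbundle `L` of `T_N ⊕ T_N^∨`; here `D a x u` is the covariant
derivative at `x` of the local section `a` in the direction `u`. -/
structure IsFlatConnection (L : ∀ x : N, Submodule ℝ (TT E x))
    (D : (∀ x : N, TT E x) → ∀ x : N, TangentSpace 𝓘(ℝ, E) x → TT E x) : Prop where
  congr : ∀ U : Set N, IsOpen U → ∀ a b, IsSection L U a → IsSection L U b →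
    (∀ x ∈ U, a x = b x) → ∀ x ∈ U, ∀ u, D a x u = D b x u
  isSection : ∀ U : Set N, IsOpen U → ∀ a X, IsSection L U a → SmoothVF U X →
    IsSection L U (fun x => D a x (X x))
  linear : ∀ U : Set N, IsOpen U → ∀ a, IsSection L U a → ∀ x ∈ U, ∀ (s t : ℝ) u v,
    D a x (s • u + t • v) = s • D a x u + t • D a x v
  add : ∀ U : Set N, IsOpen U → ∀ a b, IsSection L U a → IsSection L U b → ∀ x ∈ U, ∀ u,
    D (fun y => a y + b y) x u = D a x u + D b x u
  leibniz : ∀ U : Set N, IsOpen U → ∀ (f : N → ℝ) a, ContMDiffOn 𝓘(ℝ, E) 𝓘(ℝ, ℝ) ∞ f U →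
    IsSection L U a → ∀ x ∈ U, ∀ u,
    D (fun y => f y • a y) x u =
      (show ℝ from mfderiv 𝓘(ℝ, E) 𝓘(ℝ, ℝ) f x u) • a x + f x • D a x u
  flat : ∀ U : Set N, IsOpen U → ∀ a X Y, IsSection L U a → SmoothVF U X → SmoothVF U Y →
    ∀ x ∈ U, D (fun y => D a y (Y y)) x (X x) - D (fun y => D a y (X y)) x (Y x) -
      D a x (VectorField.mlieBracket 𝓘(ℝ, E) X Y x) = 0

end Courant

/-! ### Torus bundles -/

/-- Coordinates on the fibres. -/
abbrev Rn (n : ℕ) : Type := Fin n → ℝ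

/-- The linear form `ξ ↦ ∑ η_k ξ_k`. -/
def dotL {n : ℕ} (η : Rn n) : Rn n →L[ℝ] ℝ := ∑ k, η k • ContinuousLinearMap.proj k

/-- The action of an integral matrix on `ℝ^n`. -/
def intAct {n : ℕ} (A : Matrix (Fin n) (Fin n) ℤ) (ξ : Rn n) : Rn n :=
  (A.map (Int.cast : ℤ → ℝ)).mulVec ξ

/-- A bundle of `n`-dimensional tori `ℝ^n / ℤ^n` over the `n`-manifold `M`, with structure group
`Aut(ℝ^n / ℤ^n) = GL(n, ℤ)`, zero section `zero`, and total space the manifold `Z`.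
The local trivialization `U c × ℝ^n / ℤ^n ≅ proj⁻¹(U c)` around the point `c` is given as the map
`φ c` on `U c × ℝ^n`: a local diffeomorphism onto `proj⁻¹(U c)`, over `U c`, two points of the same
fibre `ℝ^n` having the same image exactly if they differ by an element of `ℤ^n`. -/
structure TorusBundle (n : ℕ) (M : Type*) [TopologicalSpace M]
    [ChartedSpace (EuclideanSpace ℝ (Fin n)) M]
    (EZ : Type*) [NormedAddCommGroup EZ] [NormedSpace ℝ EZ]
    (Z : Type*) [TopologicalSpace Z] [ChartedSpace EZ Z] where
  proj : Z → M
  zero : M → Z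
  U : M → Set M
  φ : M → M × Rn n → Z
  isOpen_U : ∀ c, IsOpen (U c)
  mem_U : ∀ c, c ∈ U c
  proj_φ : ∀ c, ∀ m ∈ U c, ∀ ξ, proj (φ c (m, ξ)) = m
  surj : ∀ c z, proj z ∈ U c → ∃ ξ, φ c (proj z, ξ) = z
  period : ∀ c, ∀ m ∈ U c, ∀ ξ ξ',
    φ c (m, ξ) = φ c (m, ξ') ↔ ∃ k : Fin n → ℤ, ∀ i, ξ' i = ξ i + k i
  localDiffeo : ∀ c, IsLocalDiffeomorphOn ((𝓡 n).prod 𝓘(ℝ, Rn n)) 𝓘(ℝ, EZ) ∞ (φ c) (U c ×ˢ univ)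
  φ_zero : ∀ c, ∀ m ∈ U c, φ c (m, 0) = zero m
  /-- the transition functions are locally constant with values in `GL(n, ℤ)` -/
  trans : ∀ c c', ∀ m ∈ U c ∩ U c', ∃ A : Matrix.GeneralLinearGroup (Fin n) ℤ,
    ∀ᶠ m' in 𝓝 m, ∀ ξ, φ c' (m', ξ) = φ c (m', intAct A.1 ξ)

namespace TorusBundle

variable {n : ℕ} {M : Type*} [TopologicalSpace M] [ChartedSpace (EuclideanSpace ℝ (Fin n)) M]
  {EZ : Type*} [NormedAddCommGroup EZ] [NormedSpace ℝ EZ]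
  {Z : Type*} [TopologicalSpace Z] [ChartedSpace EZ Z]
  (T : TorusBundle n M EZ Z)

/-- The differential of the projection. -/
def dproj (z : Z) : TangentSpace 𝓘(ℝ, EZ) z →L[ℝ] TangentSpace (𝓡 n) (T.proj z) :=
  mfderiv 𝓘(ℝ, EZ) (𝓡 n) T.proj z

/-- The differential of the local trivialization around `c` at `(m, ξ)`. -/
def dφ (c m : M) (ξ : Rn n) : EuclideanSpace ℝ (Fin n) × Rn n →L[ℝ] EZ :=
  mfderiv ((𝓡 n).prod 𝓘(ℝ, Rn n)) 𝓘(ℝ, EZ) (T.φ c) (m, ξ)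

/-- The fibre at `m` of `V = s^* T_{Z/M}`, for `s` the zero section: the vertical tangent space of
`Z` at `s(m)`. -/
abbrev V (m : M) : Submodule ℝ (TangentSpace 𝓘(ℝ, EZ) (T.zero m)) :=
  LinearMap.ker (T.dproj (T.zero m)).toLinearMap

/-- The linear coordinates on `V` (over `U c`) given by the local trivialization around `c`. -/
def coord (c m : M) : T.V m →L[ℝ] Rn n :=
  (ContinuousLinearMap.snd ℝ (EuclideanSpace ℝ (Fin n)) (Rn n)).comp
    ((T.dφ c m 0).inverse.comp (T.V m).subtypeL)

theorem dφ_equiv (c m : M) (hm : m ∈ T.U c) (ξ : Rn n) :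
    ∃ e : (EuclideanSpace ℝ (Fin n) × Rn n) ≃L[ℝ] EZ, T.dφ c m ξ = e := by
  have h := T.localDiffeo c ⟨(m, ξ), hm, mem_univ _⟩
  exact ⟨h.mfderivToContinuousLinearEquiv (by simp), rfl⟩

theorem mdifferentiableAt_φ (c m : M) (hm : m ∈ T.U c) (ξ : Rn n) :
    MDifferentiableAt ((𝓡 n).prod 𝓘(ℝ, Rn n)) 𝓘(ℝ, EZ) (T.φ c) (m, ξ) :=
  IsLocalDiffeomorphAt.mdifferentiableAt (T.localDiffeo c ⟨(m, ξ), hm, mem_univ _⟩) (by simp)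

theorem mdifferentiableAt_proj (c m : M) (hm : m ∈ T.U c) (ξ : Rn n) :
    MDifferentiableAt 𝓘(ℝ, EZ) (𝓡 n) T.proj (T.φ c (m, ξ)) := by
  have h := T.localDiffeo c ⟨(m, ξ), hm, mem_univ _⟩
  have h1 : MDifferentiableAt 𝓘(ℝ, EZ) ((𝓡 n).prod 𝓘(ℝ, Rn n)) h.localInverse
      (T.φ c (m, ξ)) := h.localInverse_mdifferentiableAt (by simp)
  have h0 : h.localInverse (T.φ c (m, ξ)) = (m, ξ) :=
    h.localInverse_left_inv h.localInverse_mem_target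
  have h2 : MDifferentiableAt 𝓘(ℝ, EZ) (𝓡 n) (fun z => (h.localInverse z).1)
      (T.φ c (m, ξ)) := mdifferentiableAt_fst.comp _ h1
  refine h2.congr_of_eventuallyEq ?_
  have hc : ∀ᶠ z in 𝓝 (T.φ c (m, ξ)), (h.localInverse z).1 ∈ T.U c := by
    have : ContinuousAt (fun z => (h.localInverse z).1) (T.φ c (m, ξ)) := h2.continuousAt
    refine this.eventually ((T.isOpen_U c).mem_nhds ?_)
    simpa only [h0] using hm
  filter_upwards [hc, h.localInverse_eventuallyEq_right] with z hz hz'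
  have : T.φ c (h.localInverse z) = z := hz'
  conv_lhs => rw [← this]
  exact T.proj_φ c _ hz _

theorem dproj_dφ (c m : M) (hm : m ∈ T.U c) (ξ : Rn n) (w : EuclideanSpace ℝ (Fin n) × Rn n) :
    T.dproj (T.φ c (m, ξ)) (T.dφ c m ξ w) = w.1 := by
  have h1 := (T.mdifferentiableAt_proj c m hm ξ).hasMFDerivAt.comp (m, ξ)
    (T.mdifferentiableAt_φ c m hm ξ).hasMFDerivAt
  have h2 := hasMFDerivAt_fst (I := 𝓡 n) (I' := 𝓘(ℝ, Rn n)) (x := ((m, ξ) : M × Rn n))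
  have h3 : T.proj ∘ T.φ c =ᶠ[𝓝 (m, ξ)] Prod.fst := by
    have : ∀ᶠ q : M × Rn n in 𝓝 (m, ξ), q.1 ∈ T.U c :=
      continuousAt_fst.eventually ((T.isOpen_U c).mem_nhds hm)
    filter_upwards [this] with q hq using T.proj_φ c q.1 hq q.2
  have h4 := hasMFDerivAt_unique h1 (h2.congr_of_eventuallyEq h3)
  exact DFunLike.congr_fun h4 w

theorem dproj_zero_dφ (c m : M) (hm : m ∈ T.U c) (w : EuclideanSpace ℝ (Fin n) × Rn n) :
    T.dproj (T.zero m) (T.dφ c m 0 w) = w.1 := by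
  have h := T.dproj_dφ c m hm 0 w
  rw [T.φ_zero c m hm] at h
  exact h

/-- `coord c m` is an isomorphism for `m ∈ U c`; its inverse maps `η` to the derivative of the
local trivialization at `(m, 0)` in the direction `(0, η)`. -/
def coordEquiv (c m : M) (hm : m ∈ T.U c) : T.V m ≃L[ℝ] Rn n :=
  ContinuousLinearEquiv.equivOfInverse (T.coord c m)
    (((T.dφ c m 0).comp (ContinuousLinearMap.inr ℝ (EuclideanSpace ℝ (Fin n)) (Rn n))).codRestrict
      (T.V m) (fun η => T.dproj_zero_dφ c m hm (0, η)))
    (by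
      obtain ⟨e, he⟩ := T.dφ_equiv c m hm 0
      intro v
      apply Subtype.ext
      let w : EZ := v.1
      have hw : T.dproj (T.zero m) w = 0 := v.2
      have h0 : (e.symm w).1 = 0 := by
        have h := T.dproj_zero_dφ c m hm (e.symm w)
        have h2 : T.dφ c m 0 (e.symm w) = w := by
          rw [he]
          exact e.apply_symm_apply w
        rw [h2] at h
        exact h.symm.trans hw
      have h1 : ((0 : EuclideanSpace ℝ (Fin n)), (e.symm w).2) = e.symm w :=
        Prod.ext h0.symm rfl
      change T.dφ c m 0 (0, ((T.dφ c m 0).inverse w).2) = w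
      rw [he, ContinuousLinearMap.inverse_equiv]
      change e (0, (e.symm w).2) = w
      rw [h1, ContinuousLinearEquiv.apply_symm_apply])
    (by
      obtain ⟨e, he⟩ := T.dφ_equiv c m hm 0
      intro η
      change ((T.dφ c m 0).inverse (T.dφ c m 0 (0, η))).2 = η
      rw [he, ContinuousLinearMap.inverse_equiv]
      change (e.symm (e (0, η))).2 = η
      rw [ContinuousLinearEquiv.symm_apply_apply])

/-! ### The lattice and the dual torus bundle -/

theorem coord_change {c c' m : M} (hm : m ∈ T.U c) (hm' : m ∈ T.U c')
    (A : Matrix (Fin n) (Fin n) ℤ)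
    (h : ∀ ξ, T.φ c' (m, ξ) = T.φ c (m, intAct A ξ)) (v : T.V m) :
    T.coord c m v = intAct A (T.coord c' m v) := by
  have key : ∀ η, T.dφ c' m 0 (0, η) = T.dφ c m 0 (0, intAct A η) := by
    intro η
    let L : Rn n →L[ℝ] Rn n :=
      LinearMap.toContinuousLinearMap (Matrix.toLin' (A.map (Int.cast : ℤ → ℝ)))
    have hL : ∀ ξ, L ξ = intAct A ξ := fun ξ => rfl
    have hp : ∀ (b : M) (hb : m ∈ T.U b),
        HasMFDerivAt 𝓘(ℝ, Rn n) 𝓘(ℝ, EZ) (fun ξ => T.φ b (m, ξ)) (0 : Rn n)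
          ((T.dφ b m 0).comp
            (ContinuousLinearMap.inr ℝ (EuclideanSpace ℝ (Fin n)) (Rn n))) := by
      intro b hb
      have h1 := (T.mdifferentiableAt_φ b m hb 0).hasMFDerivAt
      have h2 := (hasMFDerivAt_const (I := 𝓘(ℝ, Rn n)) (I' := 𝓡 n) m (0 : Rn n)).prodMk
        (hasMFDerivAt_id (I := 𝓘(ℝ, Rn n)) (0 : Rn n))
      have h3 := HasMFDerivAt.comp (0 : Rn n) h1 h2
      exact h3
    have h1 := hp c' hm'
    have h2 : HasMFDerivAt 𝓘(ℝ, Rn n) 𝓘(ℝ, Rn n) L (0 : Rn n) L :=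
      L.hasFDerivAt.hasMFDerivAt
    have h3 := hp c hm
    have h3' : HasMFDerivAt 𝓘(ℝ, Rn n) 𝓘(ℝ, EZ) (fun ξ => T.φ c (m, ξ)) (L 0)
          ((T.dφ c m 0).comp
            (ContinuousLinearMap.inr ℝ (EuclideanSpace ℝ (Fin n)) (Rn n))) := by
      have h0 : L 0 = 0 := map_zero L
      rw [h0]; exact h3
    have h4 := HasMFDerivAt.comp (0 : Rn n) h3' h2
    have h5 : ((fun ξ => T.φ c (m, ξ)) ∘ L) = fun ξ => T.φ c' (m, ξ) := by
      funext ξ; exact (h ξ).symm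
    rw [h5] at h4
    exact DFunLike.congr_fun (hasMFDerivAt_unique h1 h4) η
  have h1 : ((T.coordEquiv c' m hm').symm (T.coord c' m v)) = v :=
    (T.coordEquiv c' m hm').symm_apply_apply v
  have h2 : ((T.coordEquiv c m hm).symm (intAct A (T.coord c' m v))) = v := by
    refine Eq.trans (Subtype.ext ?_) h1
    exact (key (T.coord c' m v)).symm
  have h3 := congrArg (T.coordEquiv c m hm) h2
  rw [ContinuousLinearEquiv.apply_symm_apply] at h3
  exact h3.symm

/-- The exponential map of the fibre torus at `m`, i.e. the restriction to `V_m` of the quotient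
map `tot(V) → Z`. -/
def fibExp (m : M) (v : T.V m) : Z := T.φ m (m, T.coord m m v)

theorem fibExp_eq (c m : M) (hm : m ∈ T.U c) (v : T.V m) :
    T.fibExp m v = T.φ c (m, T.coord c m v) := by
  obtain ⟨A, hA⟩ := T.trans c m m ⟨hm, T.mem_U m⟩
  have h := hA.self_of_nhds
  rw [fibExp, h, T.coord_change hm (T.mem_U m) A.1 h]

theorem fibExp_eq_zero_iff (c m : M) (hm : m ∈ T.U c) (v : T.V m) :
    T.fibExp m v = T.zero m ↔ ∃ k : Fin n → ℤ, ∀ i, T.coord c m v i = k i := by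
  rw [T.fibExp_eq c m hm, ← T.φ_zero c m hm, eq_comm, T.period c m hm]
  simp

/-- The period lattice `Λ_m = ker (V_m → Z_m)`. -/
def lattice (m : M) : AddSubgroup (T.V m) where
  carrier := {v | T.fibExp m v = T.zero m}
  zero_mem' := by
    rw [mem_ofPred_eq, T.fibExp_eq_zero_iff m m (T.mem_U m)]
    exact ⟨0, fun i => by simp⟩
  add_mem' := by
    intro v w hv hw
    rw [mem_ofPred_eq, T.fibExp_eq_zero_iff m m (T.mem_U m)] at *
    obtain ⟨k, hk⟩ := hv
    obtain ⟨l, hl⟩ := hw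
    exact ⟨k + l, fun i => by simp [hk, hl]⟩
  neg_mem' := by
    intro v hv
    rw [mem_ofPred_eq, T.fibExp_eq_zero_iff m m (T.mem_U m)] at *
    obtain ⟨k, hk⟩ := hv
    exact ⟨-k, fun i => by simp [hk]⟩

theorem mem_lattice_iff (c m : M) (hm : m ∈ T.U c) (v : T.V m) :
    v ∈ T.lattice m ↔ ∃ k : Fin n → ℤ, ∀ i, T.coord c m v i = k i :=
  T.fibExp_eq_zero_iff c m hm v

/-- The dual lattice `Λ_m^∨`: the linear forms on `V_m` that are integral on `Λ_m`. -/
def dualLattice (m : M) : AddSubgroup (T.V m →L[ℝ] ℝ) where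
  carrier := {α | ∀ v ∈ T.lattice m, ∃ k : ℤ, α v = k}
  zero_mem' := fun v _ => ⟨0, by simp⟩
  add_mem' := by
    intro α β hα hβ v hv
    obtain ⟨k, hk⟩ := hα v hv
    obtain ⟨l, hl⟩ := hβ v hv
    exact ⟨k + l, by simp [hk, hl]⟩
  neg_mem' := by
    intro α hα v hv
    obtain ⟨k, hk⟩ := hα v hv
    exact ⟨-k, by simp [hk]⟩

/-- The total space `tot(V^∨) / Λ^∨` of the dual torus bundle. -/
def DualTotal : Type _ := Σ m : M, (T.V m →L[ℝ] ℝ) ⧸ T.dualLattice m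

/-- The class of a linear form on `V_m`. -/
def dualMk (m : M) (α : T.V m →L[ℝ] ℝ) : T.DualTotal := ⟨m, QuotientAddGroup.mk α⟩

/-- Local trivializations of the dual torus bundle, by the coordinates on `V^∨` dual to the
coordinates on `V`. -/
def dualφ (c : M) (q : M × Rn n) : T.DualTotal :=
  T.dualMk q.1 ((dotL q.2).comp (T.coord c q.1))

theorem dotL_apply (η ξ : Rn n) : dotL η ξ = η ⬝ᵥ ξ := by
  simp [dotL, dotProduct]

theorem dualφ_eq_iff (c m : M) (hm : m ∈ T.U c) (η η' : Rn n) :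
    T.dualφ c (m, η) = T.dualφ c (m, η') ↔ ∃ k : Fin n → ℤ, ∀ i, η' i = η i + k i := by
  have h1 : T.dualφ c (m, η) = T.dualφ c (m, η') ↔
      -((dotL η).comp (T.coord c m)) + (dotL η').comp (T.coord c m) ∈ T.dualLattice m := by
    rw [← QuotientAddGroup.eq]
    constructor
    · intro h
      have h' := (Sigma.mk.inj_iff.1 h).2
      exact eq_of_heq h'
    · intro h
      exact Sigma.ext rfl (heq_of_eq h)
  rw [h1]
  have h2 : ∀ v, (-((dotL η).comp (T.coord c m)) + (dotL η').comp (T.coord c m)) v =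
      (η' - η) ⬝ᵥ T.coord c m v := by
    intro v
    simp [dotL_apply, sub_dotProduct]
    ring
  constructor
  · intro h
    have h3 : ∀ i, ∃ k : ℤ, η' i = η i + k := by
      intro i
      obtain ⟨k, hk⟩ := h ((T.coordEquiv c m hm).symm (Pi.single i 1))
        ((T.mem_lattice_iff c m hm _).2 ⟨Pi.single i 1, fun j => by
          have : T.coord c m ((T.coordEquiv c m hm).symm (Pi.single i 1)) = Pi.single i 1 :=
            (T.coordEquiv c m hm).apply_symm_apply _
          rw [this]
          by_cases hj : j = i
          · subst hj; simp
          · simp [hj]⟩)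
      rw [h2] at hk
      have : T.coord c m ((T.coordEquiv c m hm).symm (Pi.single i 1)) = Pi.single i 1 :=
        (T.coordEquiv c m hm).apply_symm_apply _
      rw [this] at hk
      simp at hk
      exact ⟨k, by linarith⟩
    choose k hk using h3
    exact ⟨k, hk⟩
  · rintro ⟨k, hk⟩ v hv
    obtain ⟨l, hl⟩ := (T.mem_lattice_iff c m hm v).1 hv
    refine ⟨∑ i, k i * l i, ?_⟩
    rw [h2]
    simp [dotProduct, hk, hl]

theorem dualφ_surj (c : M) (m : M) (hm : m ∈ T.U c) (z : T.DualTotal) (hz : z.1 = m) :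
    ∃ η, T.dualφ c (m, η) = z := by
  subst hz
  obtain ⟨m, a⟩ := z
  obtain ⟨α, rfl⟩ := QuotientAddGroup.mk_surjective a
  refine ⟨fun k => α ((T.coordEquiv c m hm).symm (Pi.single k 1)), ?_⟩
  have : (dotL fun k => α ((T.coordEquiv c m hm).symm (Pi.single k 1))).comp (T.coord c m) = α := by
    ext v
    have h1 : v = (T.coordEquiv c m hm).symm (T.coord c m v) :=
      ((T.coordEquiv c m hm).symm_apply_apply v).symm
    have h2 : T.coord c m v = ∑ k, T.coord c m v k • (Pi.single k 1 : Rn n) := by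
      ext i
      simp [Finset.sum_apply, Pi.single_apply]
    conv_rhs => rw [h1, h2]
    simp [dotL_apply, dotProduct, mul_comm]
  simp only [dualφ, dualMk]
  rw [this]

theorem dualφ_trans (c c' : M) (m : M) (hm : m ∈ T.U c ∩ T.U c') :
    ∃ B : Matrix.GeneralLinearGroup (Fin n) ℤ,
      ∀ᶠ m' in 𝓝 m, ∀ ξ, T.dualφ c' (m', ξ) = T.dualφ c (m', intAct B.1 ξ) := by
  obtain ⟨A, hA⟩ := T.trans c c' m hm
  refine ⟨⟨(A⁻¹).1.transpose, A.1.transpose, ?_, ?_⟩, ?_⟩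
  · rw [← Matrix.transpose_mul, Units.mul_inv, Matrix.transpose_one]
  · rw [← Matrix.transpose_mul, Units.inv_mul, Matrix.transpose_one]
  filter_upwards [hA, (T.isOpen_U c).mem_nhds hm.1, (T.isOpen_U c').mem_nhds hm.2]
    with m' h h1 h2 ξ
  have : (dotL ξ).comp (T.coord c' m') =
      (dotL (intAct (A⁻¹).1.transpose ξ)).comp (T.coord c m') := by
    ext v
    simp only [ContinuousLinearMap.comp_apply, dotL_apply, T.coord_change h1 h2 A.1 h v]
    have h3 : ((A⁻¹).1.map (Int.cast : ℤ → ℝ)) * (A.1.map (Int.cast : ℤ → ℝ)) = 1 := by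
      have h4 : ((A⁻¹).1 * A.1).map (Int.castRingHom ℝ) = 1 := by
        rw [Units.inv_mul]
        exact Matrix.map_one _ (map_zero _) (map_one _)
      rw [Matrix.map_mul] at h4
      exact h4
    rw [intAct, intAct, Matrix.transpose_map, Matrix.mulVec_transpose, Matrix.dotProduct_mulVec,
      Matrix.vecMul_vecMul, h3, Matrix.vecMul_one]
  simp only [dualφ]
  rw [this]

/-! ### The smooth structure of the dual torus bundle

The charts are the local trivializations over charts of `M`, restricted to boxes in `ℝ^n` on which
the projection to `ℝ^n / ℤ^n` is injective. -/

/-- The model space of the total space of the dual torus bundle. -/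
abbrev DualModel (n : ℕ) : Type := EuclideanSpace ℝ (Fin n) × Rn n

/-- Domain of the parametrization belonging to the trivialization around `c`, the preferred chart
of `M` at `m₀`, and the box around `η₀`. -/
def parDomain (c m₀ : M) (η₀ : Rn n) : Set (DualModel n) :=
  {q | q.1 ∈ (chartAt (EuclideanSpace ℝ (Fin n)) m₀).target ∧
    (chartAt (EuclideanSpace ℝ (Fin n)) m₀).symm q.1 ∈ T.U c ∧ q.2 ∈ Metric.ball η₀ (1 / 2)}

/-- The parametrization. -/
def par (c m₀ : M) (q : DualModel n) : T.DualTotal :=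
  T.dualφ c ((chartAt (EuclideanSpace ℝ (Fin n)) m₀).symm q.1, q.2)

theorem isOpen_parDomain (c m₀ : M) (η₀ : Rn n) : IsOpen (T.parDomain c m₀ η₀) := by
  have h1 : IsOpen ((chartAt (EuclideanSpace ℝ (Fin n)) m₀).target ∩
      (chartAt (EuclideanSpace ℝ (Fin n)) m₀).symm ⁻¹' T.U c) :=
    (chartAt (EuclideanSpace ℝ (Fin n)) m₀).isOpen_inter_preimage_symm (T.isOpen_U c)
  have h2 := h1.prod (Metric.isOpen_ball (x := η₀) (ε := 1 / 2))
  convert h2 using 1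
  ext q
  simp [parDomain, and_assoc]

theorem injOn_par (c m₀ : M) (η₀ : Rn n) : InjOn (T.par c m₀) (T.parDomain c m₀ η₀) := by
  rintro ⟨x, η⟩ ⟨hx, hU, hη⟩ ⟨x', η'⟩ ⟨hx', hU', hη'⟩ h
  simp only at hx hU hη hx' hU' hη'
  have h1 : x = x' := by
    have : (chartAt (EuclideanSpace ℝ (Fin n)) m₀).symm x =
        (chartAt (EuclideanSpace ℝ (Fin n)) m₀).symm x' := congrArg Sigma.fst h
    exact (chartAt (EuclideanSpace ℝ (Fin n)) m₀).symm.injOn hx hx' this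
  subst h1
  obtain ⟨k, hk⟩ := (T.dualφ_eq_iff c _ hU η η').1 h
  have h2 : η = η' := by
    ext i
    have h3 : dist (η i) (η₀ i) < 1 / 2 := (dist_le_pi_dist η η₀ i).trans_lt hη
    have h4 : dist (η' i) (η₀ i) < 1 / 2 := (dist_le_pi_dist η' η₀ i).trans_lt hη'
    have h5 : |((k i : ℤ) : ℝ)| < 1 := by
      have h6 : ((k i : ℤ) : ℝ) = η' i - η i := by rw [hk i]; ring
      rw [h6, ← Real.dist_eq]
      calc dist (η' i) (η i) ≤ dist (η' i) (η₀ i) + dist (η i) (η₀ i) :=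
            dist_triangle_right _ _ _
        _ < 1 := by linarith
    have h7 : k i = 0 := by
      rw [← Int.cast_abs] at h5
      exact Int.abs_lt_one_iff.1 (by exact_mod_cast h5)
    rw [hk i, h7]; simp
  rw [h2]

/-- The charts of the dual torus bundle. -/
def dualChart (c m₀ : M) (η₀ : Rn n) : PartialEquiv T.DualTotal (DualModel n) :=
  ((T.injOn_par c m₀ η₀).toPartialEquiv).symm

theorem par_transition [IsManifold (𝓡 n) ∞ M] (c m₀ : M) (η₀ : Rn n) (c' m₀' : M) (η₀' : Rn n)
    (q : DualModel n) (hq : q ∈ T.parDomain c m₀ η₀)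
    (hq' : T.par c m₀ q ∈ T.par c' m₀' '' T.parDomain c' m₀' η₀') :
    ∃ g : DualModel n → DualModel n, ContDiffAt ℝ ∞ g q ∧
      ∀ᶠ p in 𝓝 q, g p ∈ T.parDomain c' m₀' η₀' ∧ T.par c m₀ p = T.par c' m₀' (g p) := by
  obtain ⟨q₁, hq₁, hqq⟩ := hq'
  have hfst : (chartAt (EuclideanSpace ℝ (Fin n)) m₀').symm q₁.1 =
      (chartAt (EuclideanSpace ℝ (Fin n)) m₀).symm q.1 := congrArg Sigma.fst hqq
  set m := (chartAt (EuclideanSpace ℝ (Fin n)) m₀).symm q.1 with hm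
  have hmc : m ∈ T.U c := hq.2.1
  have hmc' : m ∈ T.U c' := by rw [← hfst]; exact hq₁.2.1
  have hms' : m ∈ (chartAt (EuclideanSpace ℝ (Fin n)) m₀').source := by
    rw [← hfst]; exact (chartAt (EuclideanSpace ℝ (Fin n)) m₀').map_target hq₁.1
  have hq₁1 : q₁.1 = chartAt (EuclideanSpace ℝ (Fin n)) m₀' m := by
    rw [← hfst, (chartAt (EuclideanSpace ℝ (Fin n)) m₀').right_inv hq₁.1]
  obtain ⟨B, hB⟩ := T.dualφ_trans c' c m ⟨hmc', hmc⟩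
  have h1 : T.dualφ c' (m, intAct B.1 q.2) = T.dualφ c' (m, q₁.2) := by
    rw [← hB.self_of_nhds q.2]
    have : T.dualφ c' ((chartAt (EuclideanSpace ℝ (Fin n)) m₀').symm q₁.1, q₁.2) =
      T.dualφ c (m, q.2) := hqq
    rw [hfst] at this
    exact this.symm
  obtain ⟨k, hk⟩ := (T.dualφ_eq_iff c' m hmc' _ _).1 h1
  let g : DualModel n → DualModel n := fun p =>
    (chartAt (EuclideanSpace ℝ (Fin n)) m₀' ((chartAt (EuclideanSpace ℝ (Fin n)) m₀).symm p.1),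
      intAct B.1 p.2 + fun i => (k i : ℝ))
  have hgq : g q = q₁ := by
    refine Prod.ext hq₁1.symm ?_
    ext i
    exact (hk i).symm
  have hsymm : ContMDiffAt (𝓡 n) (𝓡 n) ∞ (chartAt (EuclideanSpace ℝ (Fin n)) m₀).symm q.1 :=
    contMDiffOn_chart_symm.contMDiffAt
      ((chartAt (EuclideanSpace ℝ (Fin n)) m₀).open_target.mem_nhds hq.1)
  have hg : ContDiffAt ℝ ∞ g q := by
    refine ContDiffAt.prodMk ?_ ?_
    · have h3 : ContMDiffAt (𝓡 n) (𝓡 n) ∞ (chartAt (EuclideanSpace ℝ (Fin n)) m₀') m :=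
        contMDiffOn_chart.contMDiffAt
          ((chartAt (EuclideanSpace ℝ (Fin n)) m₀').open_source.mem_nhds hms')
      have h4 := ContMDiffAt.comp q.1 h3 hsymm
      exact h4.contDiffAt.comp q contDiffAt_fst
    · refine ContDiffAt.add ?_ contDiffAt_const
      let L : Rn n →L[ℝ] Rn n :=
        LinearMap.toContinuousLinearMap (Matrix.toLin' (B.1.map (Int.cast : ℤ → ℝ)))
      exact L.contDiff.contDiffAt.comp q contDiffAt_snd
  refine ⟨g, hg, ?_⟩
  have hc1 : ContinuousAt (fun p : DualModel n =>
      (chartAt (EuclideanSpace ℝ (Fin n)) m₀).symm p.1) q :=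
    ContinuousAt.comp (f := Prod.fst) hsymm.continuousAt continuousAt_fst
  have e1 := hc1.eventually
    ((chartAt (EuclideanSpace ℝ (Fin n)) m₀').open_source.mem_nhds hms')
  have e2 := hc1.eventually hB
  have e3 : ∀ᶠ p in 𝓝 q, g p ∈ T.parDomain c' m₀' η₀' := by
    refine hg.continuousAt.eventually ((T.isOpen_parDomain c' m₀' η₀').mem_nhds ?_)
    rw [hgq]; exact hq₁
  filter_upwards [e1, e2, e3] with p p1 p2 p3
  refine ⟨p3, ?_⟩
  have p4 : T.par c m₀ p = T.dualφ c' ((chartAt (EuclideanSpace ℝ (Fin n)) m₀).symm p.1,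
    intAct B.1 p.2) := p2 p.2
  have p5 : T.par c' m₀' (g p) = T.dualφ c' ((chartAt (EuclideanSpace ℝ (Fin n)) m₀).symm p.1,
      intAct B.1 p.2 + fun i => (k i : ℝ)) := by
    simp only [par, g]
    rw [(chartAt (EuclideanSpace ℝ (Fin n)) m₀').left_inv p1]
  rw [p4, p5, T.dualφ_eq_iff c' _ (by
    have := p3.2.1
    simp only [g] at this
    rwa [(chartAt (EuclideanSpace ℝ (Fin n)) m₀').left_inv p1] at this)]
  exact ⟨k, fun i => rfl⟩

theorem dualChart_transition [IsManifold (𝓡 n) ∞ M] (c m₀ : M) (η₀ : Rn n)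
    (c' m₀' : M) (η₀' : Rn n) (q : DualModel n)
    (hq : q ∈ ((T.dualChart c m₀ η₀).symm.trans (T.dualChart c' m₀' η₀')).source) :
    ((T.dualChart c m₀ η₀).symm.trans (T.dualChart c' m₀' η₀')).source ∈ 𝓝 q ∧
    ContDiffAt ℝ ∞ ((T.dualChart c m₀ η₀).symm.trans (T.dualChart c' m₀' η₀')) q := by
  have hs : ∀ p, p ∈ ((T.dualChart c m₀ η₀).symm.trans (T.dualChart c' m₀' η₀')).source ↔
      p ∈ T.parDomain c m₀ η₀ ∧ T.par c m₀ p ∈ T.par c' m₀' '' T.parDomain c' m₀' η₀' :=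
    fun p => Iff.rfl
  obtain ⟨h1, h2⟩ := (hs q).1 hq
  obtain ⟨g, hg, hev⟩ := T.par_transition c m₀ η₀ c' m₀' η₀' q h1 h2
  constructor
  · filter_upwards [hev, (T.isOpen_parDomain c m₀ η₀).mem_nhds h1] with p hp hp'
    exact (hs p).2 ⟨hp', hp.2 ▸ mem_image_of_mem _ hp.1⟩
  · refine hg.congr_of_eventuallyEq ?_
    filter_upwards [hev] with p hp
    have : ((T.dualChart c m₀ η₀).symm.trans (T.dualChart c' m₀' η₀')) p =
        (T.dualChart c' m₀' η₀') (T.par c m₀ p) := rfl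
    rw [this, hp.2]
    exact (T.dualChart c' m₀' η₀').right_inv (x := g p) hp.1

/-- The atlas of the dual torus bundle. -/
def dualCore [IsManifold (𝓡 n) ∞ M] : ChartedSpaceCore (DualModel n) T.DualTotal where
  atlas := {e | ∃ c m₀ η₀, e = T.dualChart c m₀ η₀}
  chartAt z := T.dualChart z.1 z.1 (T.dualφ_surj z.1 z.1 (T.mem_U _) z rfl).choose
  mem_chart_source z := by
    have h := (T.dualφ_surj z.1 z.1 (T.mem_U _) z rfl).choose_spec
    set η := (T.dualφ_surj z.1 z.1 (T.mem_U _) z rfl).choose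
    have hl : (chartAt (EuclideanSpace ℝ (Fin n)) z.1).symm
        (chartAt (EuclideanSpace ℝ (Fin n)) z.1 z.1) = z.1 :=
      (chartAt (EuclideanSpace ℝ (Fin n)) z.1).left_inv (mem_chart_source _ _)
    refine (mem_image _ _ _).2 ⟨(chartAt (EuclideanSpace ℝ (Fin n)) z.1 z.1, η), ⟨?_, ?_, ?_⟩, ?_⟩
    · exact mem_chart_target _ _
    · simpa only [hl] using T.mem_U z.1
    · exact Metric.mem_ball_self (by norm_num)
    · simpa only [par, hl] using h
  chart_mem_atlas z := ⟨_, _, _, rfl⟩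
  open_source := by
    rintro _ _ ⟨c, m₀, η₀, rfl⟩ ⟨c', m₀', η₀', rfl⟩
    exact isOpen_iff_mem_nhds.2 fun q hq =>
      (T.dualChart_transition c m₀ η₀ c' m₀' η₀' q hq).1
  continuousOn_toFun := by
    rintro _ _ ⟨c, m₀, η₀, rfl⟩ ⟨c', m₀', η₀', rfl⟩
    exact fun q hq =>
      (T.dualChart_transition c m₀ η₀ c' m₀' η₀' q hq).2.continuousAt.continuousWithinAt

instance [IsManifold (𝓡 n) ∞ M] : TopologicalSpace T.DualTotal := T.dualCore.toTopologicalSpace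

instance [IsManifold (𝓡 n) ∞ M] : ChartedSpace (DualModel n) T.DualTotal :=
  T.dualCore.toChartedSpace

instance [IsManifold (𝓡 n) ∞ M] : IsManifold 𝓘(ℝ, DualModel n) ∞ T.DualTotal := by
  refine isManifold_of_contDiffOn _ _ _ ?_
  intro e e' he he'
  have h : ∀ f : OpenPartialHomeomorph T.DualTotal (DualModel n),
      f ∈ atlas (DualModel n) T.DualTotal →
      ∃ c m₀ η₀, f.toPartialEquiv = T.dualChart c m₀ η₀ := by
    intro f hf
    obtain ⟨g, hg⟩ := mem_iUnion.1 hf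
    obtain ⟨⟨c, m₀, η₀, rfl⟩, hg⟩ := mem_iUnion.1 hg
    exact ⟨c, m₀, η₀, by rw [mem_singleton_iff.1 hg]; rfl⟩
  obtain ⟨c, m₀, η₀, hf⟩ := h e he
  obtain ⟨c', m₀', η₀', hf'⟩ := h e' he'
  have key : (e.symm ≫ₕ e').toPartialEquiv =
      (T.dualChart c m₀ η₀).symm.trans (T.dualChart c' m₀' η₀') := by
    rw [← hf, ← hf']; rfl
  intro q hq
  have hq1 : q ∈ (e.symm ≫ₕ e').toPartialEquiv.source := hq.1
  rw [key] at hq1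
  have hd := (T.dualChart_transition c m₀ η₀ c' m₀' η₀' q hq1).2
  rw [← key] at hd
  exact hd.contDiffWithinAt

theorem dualChart_mem_atlas [IsManifold (𝓡 n) ∞ M] (c m₀ : M) (η₀ : Rn n) :
    ∃ e ∈ atlas (DualModel n) T.DualTotal, e.toPartialEquiv = T.dualChart c m₀ η₀ :=
  ⟨T.dualCore.openPartialHomeomorph _ ⟨c, m₀, η₀, rfl⟩,
    mem_iUnion.2 ⟨_, mem_iUnion.2 ⟨⟨c, m₀, η₀, rfl⟩, mem_singleton _⟩⟩, rfl⟩

theorem localDiffeo_dualφ [IsManifold (𝓡 n) ∞ M] (c : M) :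
    IsLocalDiffeomorphOn ((𝓡 n).prod 𝓘(ℝ, Rn n)) 𝓘(ℝ, DualModel n) ∞ (T.dualφ c)
      (T.U c ×ˢ univ) := by
  rintro ⟨⟨m, η⟩, hm, -⟩
  obtain ⟨e, he, hee⟩ := T.dualChart_mem_atlas c m η
  let κ := chartAt (EuclideanSpace ℝ (Fin n)) m
  let W : Set (M × Rn n) := (κ.source ∩ T.U c) ×ˢ Metric.ball η (1 / 2)
  have hW : IsOpen W := (κ.open_source.inter (T.isOpen_U c)).prod Metric.isOpen_ball
  have htgt : e.target = T.parDomain c m η := by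
    rw [hee]; rfl
  have hsymm : ∀ q, e.symm q = T.par c m q := by
    intro q
    change e.toPartialEquiv.symm q = _
    rw [hee]; rfl
  have hmaps : ∀ p ∈ W, (κ p.1, p.2) ∈ e.target := by
    rintro ⟨x, ξ⟩ ⟨⟨hx, hU⟩, hξ⟩
    rw [htgt]
    refine ⟨κ.map_source hx, ?_, hξ⟩
    change κ.symm (κ x) ∈ T.U c
    rw [κ.left_inv hx]; exact hU
  have heq : ∀ p ∈ W, T.dualφ c p = e.symm (κ p.1, p.2) := by
    rintro ⟨x, ξ⟩ ⟨⟨hx, hU⟩, hξ⟩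
    rw [hsymm]
    change _ = T.dualφ c (κ.symm (κ x), ξ)
    rw [κ.left_inv hx]
  have hmaps' : ∀ z ∈ e.source, (κ.symm (e z).1, (e z).2) ∈ W := by
    intro z hz
    have h1 := e.map_source hz
    rw [htgt] at h1
    exact ⟨⟨κ.map_target h1.1, h1.2.1⟩, h1.2.2⟩
  let Φ : PartialDiffeomorph ((𝓡 n).prod 𝓘(ℝ, Rn n)) 𝓘(ℝ, DualModel n) (M × Rn n)
      T.DualTotal ∞ :=
    { toFun := T.dualφ c
      invFun := fun z => (κ.symm (e z).1, (e z).2)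
      source := W
      target := e.source
      map_source' := fun p hp => by rw [heq p hp]; exact e.map_target (hmaps p hp)
      map_target' := hmaps'
      left_inv' := fun p hp => by
        rw [heq p hp, e.right_inv (hmaps p hp)]
        exact Prod.ext (κ.left_inv hp.1.1) rfl
      right_inv' := fun z hz => by
        rw [heq _ (hmaps' z hz)]
        have h1 := e.map_source hz
        rw [htgt] at h1
        have h2 : (κ (κ.symm (e z).1), (e z).2) = e z := Prod.ext (κ.right_inv h1.1) rfl
        simp only [h2]
        exact e.left_inv hz
      open_source := hW
      open_target := e.open_source
      contMDiffOn_toFun := by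
        have h1 : ContMDiffOn 𝓘(ℝ, DualModel n) 𝓘(ℝ, DualModel n) ∞ e.symm e.target :=
          contMDiffOn_symm_of_mem_maximalAtlas (StructureGroupoid.subset_maximalAtlas _ he)
        have h2 : ContMDiffOn ((𝓡 n).prod 𝓘(ℝ, Rn n)) 𝓘(ℝ, DualModel n) ∞
            (fun p : M × Rn n => (κ p.1, p.2)) W := by
          have h3 : ContMDiffOn (𝓡 n) (𝓡 n) ∞ κ κ.source := contMDiffOn_chart
          exact (h3.comp contMDiffOn_fst fun p hp => hp.1.1).prodMk_space contMDiffOn_snd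
        exact (h1.comp h2 hmaps).congr heq
      contMDiffOn_invFun := by
        have h1 : ContMDiffOn 𝓘(ℝ, DualModel n) 𝓘(ℝ, DualModel n) ∞ e e.source :=
          contMDiffOn_of_mem_maximalAtlas (StructureGroupoid.subset_maximalAtlas _ he)
        have h3 : ContMDiffOn (𝓡 n) (𝓡 n) ∞ κ.symm κ.target := contMDiffOn_chart_symm
        have h4 : ContMDiffOn 𝓘(ℝ, DualModel n) (𝓡 n) ∞ (fun z => (e z).1) e.source :=
          (contDiff_fst.contMDiff.contMDiffOn (s := univ)).comp h1 fun _ _ => mem_univ _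
        have h5 : ContMDiffOn 𝓘(ℝ, DualModel n) 𝓘(ℝ, Rn n) ∞ (fun z => (e z).2) e.source :=
          (contDiff_snd.contMDiff.contMDiffOn (s := univ)).comp h1 fun _ _ => mem_univ _
        refine (h3.comp h4 fun z hz => ?_).prodMk h5
        have h6 := e.map_source hz
        rw [htgt] at h6
        exact h6.1 }
  exact Φ.isLocalDiffeomorphAt _ _ _
    ⟨⟨mem_chart_source _ _, hm⟩, Metric.mem_ball_self (by norm_num)⟩

/-- The dual torus bundle `tot(V^∨) / Λ^∨ → M`. -/
def dual [IsManifold (𝓡 n) ∞ M] : TorusBundle n M (DualModel n) T.DualTotal where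
  proj z := z.1
  zero m := T.dualMk m 0
  U := T.U
  φ := T.dualφ
  isOpen_U := T.isOpen_U
  mem_U := T.mem_U
  proj_φ _ _ _ _ := rfl
  surj c z hz := T.dualφ_surj c z.1 hz z rfl
  period := T.dualφ_eq_iff
  localDiffeo := T.localDiffeo_dualφ
  φ_zero c m hm := by
    have : (dotL (0 : Rn n)).comp (T.coord c m) = 0 := by
      ext v; simp [dotL_apply]
    simp only [dualφ]
    rw [this]
  trans := T.dualφ_trans

/-! ### The flat connection on `V` and the splitting of the tangent sequence of `Z` -/

/-- The flat (Gauss–Manin) connection `∇` on `V`, the one for which the local sections of the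
period lattice are flat: covariant derivative of the section `σ` at `m` in the direction `u`,
computed in the coordinates on `V` given by the local trivialization around `m`. -/
def nabla (σ : ∀ m, T.V m) (m : M) (u : TangentSpace (𝓡 n) m) : T.V m :=
  (T.coordEquiv m m (T.mem_U m)).symm
    (mfderiv (𝓡 n) 𝓘(ℝ, Rn n) (fun m' => T.coord m m' (σ m')) m u)

/-- The coordinates on `V^∨` dual to the coordinates `coord c` on `V`. -/
def coordDual (c m : M) (α : T.V m →L[ℝ] ℝ) : Rn n :=
  fun k => α ((T.coord c m).inverse (Pi.single k 1))

/-- The dual connection `∇^∨` on `V^∨`. -/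
def nablaDual (α : ∀ m, T.V m →L[ℝ] ℝ) (m : M) (u : TangentSpace (𝓡 n) m) : T.V m →L[ℝ] ℝ :=
  (dotL (mfderiv (𝓡 n) 𝓘(ℝ, Rn n) (fun m' => T.coordDual m m' (α m')) m u)).comp (T.coord m m)

/-- A coordinate vector of `z` in the local trivialization around `proj z`. -/
def fib (z : Z) : Rn n := (T.surj (T.proj z) z (T.mem_U _)).choose

theorem φ_fib (z : Z) : T.φ (T.proj z) (T.proj z, T.fib z) = z :=
  (T.surj (T.proj z) z (T.mem_U _)).choose_spec

/-- The differential at a preimage of `z` of the local trivialization around `proj z`. -/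
def dTriv (z : Z) : EuclideanSpace ℝ (Fin n) × Rn n →L[ℝ] EZ :=
  T.dφ (T.proj z) (T.proj z) (T.fib z)

/-- The map `j : p^* V → T_Z` given by the translations of the fibres. -/
def j (z : Z) : T.V (T.proj z) →L[ℝ] TangentSpace 𝓘(ℝ, EZ) z :=
  ((T.dTriv z).comp (ContinuousLinearMap.inr ℝ (EuclideanSpace ℝ (Fin n)) (Rn n))).comp
    (T.coord (T.proj z) (T.proj z))

/-- The horizontal lift `α : p^* T_M → T_Z`: the derivative of the local section of `Z` through `z`
that is constant in the local trivialization. -/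
def horLift (z : Z) : TangentSpace (𝓡 n) (T.proj z) →L[ℝ] TangentSpace 𝓘(ℝ, EZ) z :=
  (T.dTriv z).comp (ContinuousLinearMap.inl ℝ (EuclideanSpace ℝ (Fin n)) (Rn n))

/-- The vertical projection `D : T_Z → p^* V` defined by the connection. -/
def D (z : Z) : TangentSpace 𝓘(ℝ, EZ) z →L[ℝ] T.V (T.proj z) :=
  (T.coordEquiv (T.proj z) (T.proj z) (T.mem_U _)).symm.toContinuousLinearMap.comp
    ((ContinuousLinearMap.snd ℝ (EuclideanSpace ℝ (Fin n)) (Rn n)).comp (T.dTriv z).inverse)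

/-- The fibre of `V ⊕ T_M` at `m`. -/
abbrev VT (m : M) : Type _ := T.V m × TangentSpace (𝓡 n) m

/-- The isomorphism `F : T_Z ⊕ T_Z^∨ → p^*(V ⊕ T_M ⊕ V^∨ ⊕ T_M^∨)`, with components `D`, `dp`, `j^∨`
and `α^∨`. -/
def F (z : Z) : TT EZ z →ₗ[ℝ] Dbl (T.VT (T.proj z)) where
  toFun a := ((T.D z a.1, T.dproj z a.1), a.2.comp ((T.j z).coprod (T.horLift z)))
  map_add' _ _ := by ext <;> simp
  map_smul' _ _ := by ext <;> simp

/-- The inverse of `F`, with components `j + α` and `D^∨ + dp^∨`. -/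
def Finv (z : Z) : Dbl (T.VT (T.proj z)) →ₗ[ℝ] TT EZ z where
  toFun a := (T.j z a.1.1 + T.horLift z a.1.2, a.2.comp ((T.D z).prod (T.dproj z)))
  map_add' _ _ := by
    ext
    · simp; abel
    · simp
  map_smul' _ _ := by ext <;> simp

/-! ### Semi-flat generalized almost complex structures and their mirrors -/

/-- The endomorphism `F⁻¹ (p^* J̲) F` of `T_Z ⊕ T_Z^∨`. -/
def lift (Jb : ∀ m, Dbl (T.VT m) →ₗ[ℝ] Dbl (T.VT m)) (z : Z) : TT EZ z →ₗ[ℝ] TT EZ z :=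
  (T.Finv z).comp ((Jb (T.proj z)).comp (T.F z))

/-- Smooth local sections of `V ⊕ T_M`. A section of `V = s^* T_{Z/M}` is smooth if it is smooth as
a map to the tangent bundle of `Z`. -/
def SmoothVT [IsManifold (𝓡 n) ∞ M] [IsManifold 𝓘(ℝ, EZ) ∞ Z] (U : Set M)
    (σ : ∀ m, T.VT m) : Prop :=
  ContMDiffOn (𝓡 n) 𝓘(ℝ, EZ).tangent ∞
    (fun m => (⟨T.zero m, ((σ m).1 : TangentSpace 𝓘(ℝ, EZ) (T.zero m))⟩ :
      TangentBundle 𝓘(ℝ, EZ) Z)) U ∧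
  SmoothVF U (fun m => (σ m).2)

/-- `J` is the semi-flat generalized almost complex structure on `Z` coming from the generalized
almost complex structure `J̲` on `V ⊕ T_M`, where `J̲ (V ⊕ V^∨) = T_M ⊕ T_M^∨`. -/
structure IsSemiFlat [IsManifold (𝓡 n) ∞ M] [IsManifold 𝓘(ℝ, EZ) ∞ Z]
    (J : ∀ z : Z, TT EZ z →ₗ[ℝ] TT EZ z)
    (Jb : ∀ m, Dbl (T.VT m) →ₗ[ℝ] Dbl (T.VT m)) : Prop where
  genAlmostComplex : IsGenAlmostComplex (EuclideanSpace ℝ (Fin n)) T.SmoothVT Jb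
  adapted : ∀ m, (LinearMap.range (inclFst (T.V m) (TangentSpace (𝓡 n) m))).map (Jb m) =
    LinearMap.range (inclSnd (T.V m) (TangentSpace (𝓡 n) m))
  eq_lift : ∀ z, J z = T.lift Jb z

/-- The almost Dirac structure `Δ = J̲ (V) ⊆ J̲ (V ⊕ V^∨) = T_M ⊕ T_M^∨`, as a family of subspaces
of `T_M ⊕ T_M^∨`. -/
def Delta (Jb : ∀ m, Dbl (T.VT m) →ₗ[ℝ] Dbl (T.VT m)) (m : M) :
    Submodule ℝ (TT (EuclideanSpace ℝ (Fin n)) m) :=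
  ((LinearMap.range ((inclFst (T.V m) (TangentSpace (𝓡 n) m)).comp
    (LinearMap.inl ℝ (T.V m) (T.V m →L[ℝ] ℝ)))).map (Jb m)).comap
      (inclSnd (T.V m) (TangentSpace (𝓡 n) m))

/-- The almost Dirac structure `Δ^ = J̲ (V^∨) ⊆ J̲ (V ⊕ V^∨) = T_M ⊕ T_M^∨`, as a family of
subspaces of `T_M ⊕ T_M^∨`. -/
def DeltaHat (Jb : ∀ m, Dbl (T.VT m) →ₗ[ℝ] Dbl (T.VT m)) (m : M) :
    Submodule ℝ (TT (EuclideanSpace ℝ (Fin n)) m) :=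
  ((LinearMap.range ((inclFst (T.V m) (TangentSpace (𝓡 n) m)).comp
    (LinearMap.inr ℝ (T.V m) (T.V m →L[ℝ] ℝ)))).map (Jb m)).comap
      (inclSnd (T.V m) (TangentSpace (𝓡 n) m))

/-- The connection on `Δ` which corresponds to `∇` under `J̲ : V ≅ Δ` (recall `J̲⁻¹ = -J̲`). -/
def connDelta (Jb : ∀ m, Dbl (T.VT m) →ₗ[ℝ] Dbl (T.VT m))
    (a : ∀ m : M, TT (EuclideanSpace ℝ (Fin n)) m) (m : M) (u : TangentSpace (𝓡 n) m) :
    TT (EuclideanSpace ℝ (Fin n)) m :=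
  projSnd _ _ (Jb m (inclFst _ _
    (T.nabla (fun m' => (projFst _ _ (-(Jb m' (inclSnd _ _ (a m'))))).1) m u, 0)))

/-- The connection on `Δ^` which corresponds to `∇^∨` under `J̲ : V^∨ ≅ Δ^`. -/
def connDeltaHat (Jb : ∀ m, Dbl (T.VT m) →ₗ[ℝ] Dbl (T.VT m))
    (a : ∀ m : M, TT (EuclideanSpace ℝ (Fin n)) m) (m : M) (u : TangentSpace (𝓡 n) m) :
    TT (EuclideanSpace ℝ (Fin n)) m :=
  projSnd _ _ (Jb m (inclFst _ _
    (0, T.nablaDual (fun m' => (projFst _ _ (-(Jb m' (inclSnd _ _ (a m'))))).2) m u)))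

end TorusBundle

/-- Let `A` and `B` be in duality via coordinates: `⟨b, a⟩ = f(b) · e(a)`. Then this is the
duality transformation `A ⊕ P ⊕ A^∨ ⊕ P^∨ → B ⊕ P ⊕ B^∨ ⊕ P^∨` with `B = A^∨`, `B^∨ = A`, that
exchanges the components in `A` and `A^∨`. The inverse is `shuffle f e`. -/
def shuffle {n : ℕ} {A B P : Type*} [AddCommGroup A] [Module ℝ A] [TopologicalSpace A]
    [AddCommGroup B] [Module ℝ B] [TopologicalSpace B]
    [AddCommGroup P] [Module ℝ P] [TopologicalSpace P]
    (e : A ≃L[ℝ] Rn n) (f : B ≃L[ℝ] Rn n) : Dbl (A × P) →ₗ[ℝ] Dbl (B × P) where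
  toFun a := ((f.symm fun k => a.2 (e.symm (Pi.single k 1), 0), a.1.2),
    ((dotL (e a.1.1)).comp f.toContinuousLinearMap).coprod
      (a.2.comp (ContinuousLinearMap.inr ℝ A P)))
  map_add' a b := by
    refine Prod.ext (Prod.ext ?_ rfl) ?_
    · exact (map_add f.symm _ _)
    · ext x
      · simp [TorusBundle.dotL_apply, add_dotProduct]
      · simp
  map_smul' r a := by
    refine Prod.ext (Prod.ext ?_ rfl) ?_
    · exact (map_smul f.symm _ _)
    · ext x
      · simp [TorusBundle.dotL_apply, smul_dotProduct]
      · simp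

namespace TorusBundle

variable {n : ℕ} {M : Type*} [TopologicalSpace M] [ChartedSpace (EuclideanSpace ℝ (Fin n)) M]
  [IsManifold (𝓡 n) ∞ M]
  {EZ : Type*} [NormedAddCommGroup EZ] [NormedSpace ℝ EZ]
  {Z : Type*} [TopologicalSpace Z] [ChartedSpace EZ Z]
  (T : TorusBundle n M EZ Z)

/-- The generalized almost complex structure on `V^∨ ⊕ T_M` obtained from `J̲` by the duality
transformation along the fibres. Here `V^∨` is the bundle of vertical tangent spaces of the dual
torus bundle along its zero section; it is identified with the dual of `V` through the quotient map
`V^∨ → V^∨ / Λ^∨`, that is, by the coordinates of the corresponding local trivializations, which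
are dual to each other. -/
def mirrorBase (Jb : ∀ m, Dbl (T.VT m) →ₗ[ℝ] Dbl (T.VT m)) (m : M) :
    Dbl (T.dual.VT m) →ₗ[ℝ] Dbl (T.dual.VT m) :=
  (shuffle (T.coordEquiv m m (T.mem_U m)) (T.dual.coordEquiv m m (T.dual.mem_U m))).comp
    ((Jb m).comp
      (shuffle (T.dual.coordEquiv m m (T.dual.mem_U m)) (T.coordEquiv m m (T.mem_U m))))

/-- The mirror structure on the dual torus bundle. -/
def mirror (Jb : ∀ m, Dbl (T.VT m) →ₗ[ℝ] Dbl (T.VT m)) (z : T.DualTotal) :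
    TT (DualModel n) z →ₗ[ℝ] TT (DualModel n) z :=
  T.dual.lift (T.mirrorBase Jb) z

end TorusBundle

end TorusMirror

end

/-!
Since `J̲` is orthogonal and exchanges `V ⊕ V^∨` with `T_M ⊕ T_M^∨`, it restricts to an isometry
`V ⊕ V^∨ ≅ T_M ⊕ T_M^∨` with inverse `-J̲`, which carries the maximally isotropic subbundles `V` and
`V^∨`, together with their flat connections, to `Δ` and `Δ^`. In local trivializations that are dual
to each other, exchanging `V` and `V^∨` only renames coordinates, so `Δ^` with its connection is the
`Δ` of the mirror.

For integrability, let `a` and `b` be sections of `T_M ⊕ T_M^∨`. The lifts of `a` and `-J̲ a` to `Z`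
are the real and imaginary part of a `+i`-eigensection, and likewise for `b`. If `a` and `b` are
sections of `Δ`, then `-J̲ a` and `-J̲ b` are sections of `V`, whose lifts are related to `0` by
`p : Z → M`, whereas the lifts of `a` and `b` are related to `a` and `b`. The Courant bracket
respects related sections, so the bracket of the two eigensections has real part related to `[a, b]`
and imaginary part related to `0`. As `J` maps the imaginary part to the real part, `-J̲ [a, b]` is
the `V ⊕ V^∨`-component of the imaginary part, and this has no `V^∨`-component: `[a, b]` lies in
`Δ`. For `Δ^` the same argument works with the flat local sections `m ↦ φ (m, ξ)` of `Z` in place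
of `p`.
-/

noncomputable section

namespace TorusMirror

/-! ### Vector fields and one-forms in charts -/

section Along

variable {𝕜 : Type*} [NontriviallyNormedField 𝕜]
  {E : Type*} [NormedAddCommGroup E] [NormedSpace 𝕜 E] {H : Type*} [TopologicalSpace H]
  {I : ModelWithCorners 𝕜 E H} {N : Type*} [TopologicalSpace N] [ChartedSpace H N]
  [IsManifold I 1 N]
  {E' : Type*} [NormedAddCommGroup E'] [NormedSpace 𝕜 E'] {H' : Type*} [TopologicalSpace H']
  {I' : ModelWithCorners 𝕜 E' H'} {N' : Type*} [TopologicalSpace N'] [ChartedSpace H' N']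
  [IsManifold I' 1 N']
  {EP : Type*} [NormedAddCommGroup EP] [NormedSpace 𝕜 EP] {HP : Type*} [TopologicalSpace HP]
  {IP : ModelWithCorners 𝕜 EP HP} {P : Type*} [TopologicalSpace P] [ChartedSpace HP P]
  {F : Type*} [NormedAddCommGroup F] [NormedSpace 𝕜 F]
  {k l : ℕ∞ω} {g : P → N} {v : ∀ p, TangentSpace I (g p)} {p₀ : P}

theorem contMDiffAt_mfderiv_along {f : N → N'} (hf : CMDiffAt l f (g p₀))
    (hv : CMDiffAt k (fun p => (⟨g p, v p⟩ : TangentBundle I N)) p₀) (hkl : k + 1 ≤ l) :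
    CMDiffAt k (fun p => (⟨f (g p), mfderiv% f (g p) (v p)⟩ : TangentBundle I' N')) p₀ := by
  have hg : CMDiffAt k g p₀ := (Bundle.contMDiffAt_totalSpace.1 hv).1
  exact ContMDiffAt.clm_apply_of_inCoordinates (ϕ := fun p => mfderiv% f (g p))
    ((hf.mfderiv_const hkl).comp p₀ hg) hv ((hf.of_le (le_self_add.trans hkl)).comp p₀ hg)

theorem contMDiffAt_vectorSpace_along {g v : P → F} :
    CMDiffAt k (fun p => (⟨g p, v p⟩ : TangentBundle 𝓘(𝕜, F) F)) p₀ ↔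
      CMDiffAt k g p₀ ∧ CMDiffAt k v p₀ := by
  rw [Bundle.contMDiffAt_totalSpace]
  simp

theorem contMDiffAt_mvfderiv_along {f : N → F} (hf : CMDiffAt l f (g p₀))
    (hv : CMDiffAt k (fun p => (⟨g p, v p⟩ : TangentBundle I N)) p₀) (hkl : k + 1 ≤ l) :
    CMDiffAt k (fun p => d% f (g p) (v p)) p₀ :=
  (contMDiffAt_vectorSpace_along.1 (contMDiffAt_mfderiv_along hf hv hkl)).2

theorem eventually_mdifferentiableAt {f : N → N'} {x : N} (hf : CMDiffAt 1 f x) :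
    ∀ᶠ y in 𝓝 x, MDiffAt f y :=
  ((contMDiffAt_iff_contMDiffAt_nhds (by simp)).1 hf).mono fun _ hy =>
    hy.mdifferentiableAt one_ne_zero

theorem contDiffAt_clm_of_apply [CompleteSpace 𝕜] [FiniteDimensional 𝕜 E] {f : F → E →L[𝕜] E'}
    {x : F} (h : ∀ w, ContDiffAt 𝕜 k (fun y => f y w) x) : ContDiffAt 𝕜 k f x := by
  let e₁ : E ≃L[𝕜] (Fin (Module.finrank 𝕜 E) → 𝕜) := ContinuousLinearEquiv.ofFinrankEq (by simp)
  let e₂ := (e₁.arrowCongr (1 : E' ≃L[𝕜] E')).trans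
    (ContinuousLinearEquiv.piRing (Fin (Module.finrank 𝕜 E)))
  rw [← e₂.comp_contDiffAt_iff, contDiffAt_pi]
  exact fun i => h _

end Along

section Charts

variable {E : Type*} [NormedAddCommGroup E] [NormedSpace ℝ E]
  {N : Type*} [TopologicalSpace N] [ChartedSpace E N]
  {X : ∀ x : N, TangentSpace 𝓘(ℝ, E) x} {x₀ x : N} {y : E}

theorem tendsto_extChartAt_symm (x : N) :
    Tendsto (extChartAt 𝓘(ℝ, E) x).symm (𝓝 (extChartAt 𝓘(ℝ, E) x x)) (𝓝 x) := by
  simpa only [ContinuousAt, extChartAt_to_inv] using continuousAt_extChartAt_symm (I := 𝓘(ℝ, E)) x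

variable [IsManifold 𝓘(ℝ, E) ∞ N]

theorem smoothVF_iff_contMDiffAt {U : Set N} (hU : IsOpen U) :
    SmoothVF U X ↔ ∀ x ∈ U, CMDiffAt ∞ (T% X) x :=
  ⟨fun h x hx => (h x hx).contMDiffAt (hU.mem_nhds hx), fun h x hx => (h x hx).contMDiffWithinAt⟩

theorem mfderiv_extChartAt_mfderiv_symm (hy : y ∈ (extChartAt 𝓘(ℝ, E) x₀).target) (w : E) :
    mfderiv% (extChartAt 𝓘(ℝ, E) x₀) ((extChartAt 𝓘(ℝ, E) x₀).symm y)
      (mfderiv% (extChartAt 𝓘(ℝ, E) x₀).symm y w) = w := by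
  have h := mfderiv_extChartAt_comp_mfderivWithin_extChartAt_symm (I := 𝓘(ℝ, E)) hy
  rw [ModelWithCorners.range_eq_univ, mfderivWithin_univ] at h
  exact DFunLike.congr_fun h w

theorem mfderiv_symm_mfderiv_extChartAt (hx : x ∈ (extChartAt 𝓘(ℝ, E) x₀).source)
    (v : TangentSpace 𝓘(ℝ, E) x) :
    mfderiv% (extChartAt 𝓘(ℝ, E) x₀).symm (extChartAt 𝓘(ℝ, E) x₀ x)
      (mfderiv% (extChartAt 𝓘(ℝ, E) x₀) x v) = v := by
  have h := mfderivWithin_extChartAt_symm_comp_mfderiv_extChartAt' (I := 𝓘(ℝ, E)) hx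
  rw [ModelWithCorners.range_eq_univ, mfderivWithin_univ] at h
  exact DFunLike.congr_fun h v

theorem mfderiv_extChartAt_injective (x : N) :
    Function.Injective (mfderiv% (extChartAt 𝓘(ℝ, E) x) x) :=
  Function.LeftInverse.injective (mfderiv_symm_mfderiv_extChartAt (mem_extChartAt_source x))

variable (X) in
theorem mfderiv_symm_vfInChart (hy : y ∈ (extChartAt 𝓘(ℝ, E) x₀).target) :
    mfderiv% (extChartAt 𝓘(ℝ, E) x₀).symm y (vfInChart (E := E) x₀ X y) =
      X ((extChartAt 𝓘(ℝ, E) x₀).symm y) := by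
  have h := isInvertible_mfderivWithin_extChartAt_symm (I := 𝓘(ℝ, E)) hy
  rw [ModelWithCorners.range_eq_univ, mfderivWithin_univ] at h
  exact h.self_apply_inverse _

variable (X) in
theorem vfInChart_eq_mfderiv (hy : y ∈ (extChartAt 𝓘(ℝ, E) x₀).target) :
    vfInChart x₀ X y = mfderiv% (extChartAt 𝓘(ℝ, E) x₀) ((extChartAt 𝓘(ℝ, E) x₀).symm y)
      (X ((extChartAt 𝓘(ℝ, E) x₀).symm y)) := by
  rw [← mfderiv_symm_vfInChart X hy]
  exact (mfderiv_extChartAt_mfderiv_symm hy _).symm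

variable (X) in
theorem vfInChart_extChartAt (x : N) :
    vfInChart x X (extChartAt 𝓘(ℝ, E) x x) = mfderiv% (extChartAt 𝓘(ℝ, E) x) x (X x) := by
  rw [vfInChart_eq_mfderiv X (mem_extChartAt_target x), extChartAt_to_inv]

theorem contMDiffAt_extChartAt_symm (hy : y ∈ (extChartAt 𝓘(ℝ, E) x₀).target) :
    CMDiffAt ∞ (extChartAt 𝓘(ℝ, E) x₀).symm y :=
  (contMDiffOn_extChartAt_symm x₀).contMDiffAt (extChartAt_target_mem_nhds' hy)

theorem contMDiffAt_comp_extChartAt_symm {E' : Type*} [NormedAddCommGroup E'] [NormedSpace ℝ E']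
    {H' : Type*} [TopologicalSpace H'] {I' : ModelWithCorners ℝ E' H'}
    {N' : Type*} [TopologicalSpace N'] [ChartedSpace H' N'] {f : N → N'}
    (hf : ContMDiffAt 𝓘(ℝ, E) I' ∞ f x) : ContMDiffAt 𝓘(ℝ, E) I' ∞
      (fun y => f ((extChartAt 𝓘(ℝ, E) x).symm y)) (extChartAt 𝓘(ℝ, E) x x) :=
  hf.comp_of_eq (contMDiffAt_extChartAt_symm (mem_extChartAt_target x)) (extChartAt_to_inv x)

theorem contDiffAt_vfInChart (hX : CMDiffAt ∞ (T% X) x) :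
    ContDiffAt ℝ ∞ (vfInChart x X) (extChartAt 𝓘(ℝ, E) x x) := by
  have hφ : CMDiffAt ∞ (extChartAt 𝓘(ℝ, E) x)
      ((extChartAt 𝓘(ℝ, E) x).symm (extChartAt 𝓘(ℝ, E) x x)) := by
    rw [extChartAt_to_inv]
    exact contMDiffAt_extChartAt
  refine (contMDiffAt_mvfderiv_along hφ
    (contMDiffAt_comp_extChartAt_symm hX) le_rfl).contDiffAt.congr_of_eventuallyEq ?_
  filter_upwards [extChartAt_target_mem_nhds x] with y hy using vfInChart_eq_mfderiv X hy

/-- The vector field which is constant in the preferred chart at `x₀`, for testing one-forms on.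
Away from the domain of the chart its values are meaningless. -/
def chartVF (x₀ : N) (w : E) (x : N) : TangentSpace 𝓘(ℝ, E) x :=
  mfderiv% (extChartAt 𝓘(ℝ, E) x₀).symm (extChartAt 𝓘(ℝ, E) x₀ x) w

theorem smoothVF_chartVF (x₀ : N) (w : E) :
    SmoothVF (extChartAt 𝓘(ℝ, E) x₀).source (chartVF x₀ w) := by
  rw [smoothVF_iff_contMDiffAt (isOpen_extChartAt_source x₀)]
  intro x hx
  have hφ : CMDiffAt ∞ (extChartAt 𝓘(ℝ, E) x₀) x := contMDiffAt_extChartAt' (by simpa using hx)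
  refine (contMDiffAt_mfderiv_along (v := fun _ => w)
    (contMDiffAt_extChartAt_symm ((extChartAt 𝓘(ℝ, E) x₀).map_source hx))
    (contMDiffAt_vectorSpace_along.2 ⟨hφ, contMDiffAt_const⟩) le_rfl).congr_of_eventuallyEq ?_
  filter_upwards [extChartAt_source_mem_nhds' hx] with y hy
  unfold chartVF
  generalize mfderiv% (extChartAt 𝓘(ℝ, E) x₀).symm (extChartAt 𝓘(ℝ, E) x₀ y) w = v
  change (⟨y, v⟩ : TangentBundle 𝓘(ℝ, E) N) = ⟨(extChartAt 𝓘(ℝ, E) x₀).symm _, v⟩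
  rw [(extChartAt 𝓘(ℝ, E) x₀).left_inv hy]

variable {U : Set N} {ξ : ∀ x : N, TangentSpace 𝓘(ℝ, E) x →L[ℝ] ℝ}

theorem contDiffAt_formInChart [FiniteDimensional ℝ E] (hU : IsOpen U)
    (hξ : SmoothDual E SmoothVF U ξ) (hx : x ∈ U) :
    ContDiffAt ℝ ∞ (formInChart x ξ) (extChartAt 𝓘(ℝ, E) x x) := by
  refine contDiffAt_clm_of_apply fun w => ?_
  have hV : IsOpen (U ∩ (extChartAt 𝓘(ℝ, E) x).source) := hU.inter (isOpen_extChartAt_source x)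
  have hξw : CMDiffAt ∞ (fun x' => ξ x' (chartVF x w x')) x :=
    (hξ _ hV inter_subset_left (chartVF x w)
      ((smoothVF_chartVF x w).mono inter_subset_right)).contMDiffAt
      (hV.mem_nhds ⟨hx, mem_extChartAt_source x⟩)
  refine (contMDiffAt_comp_extChartAt_symm hξw).contDiffAt.congr_of_eventuallyEq ?_
  filter_upwards [extChartAt_target_mem_nhds x] with y hy
  change formInChart x ξ y w = ξ ((extChartAt 𝓘(ℝ, E) x).symm y)
    (mfderiv% (extChartAt 𝓘(ℝ, E) x).symm
      (extChartAt 𝓘(ℝ, E) x ((extChartAt 𝓘(ℝ, E) x).symm y)) w)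
  rw [(extChartAt 𝓘(ℝ, E) x).right_inv hy]
  rfl

variable (ξ) in
theorem formInChart_extChartAt_apply (hx : x ∈ (extChartAt 𝓘(ℝ, E) x₀).source)
    (v : TangentSpace 𝓘(ℝ, E) x) :
    formInChart x₀ ξ (extChartAt 𝓘(ℝ, E) x₀ x) (mfderiv% (extChartAt 𝓘(ℝ, E) x₀) x v) = ξ x v := by
  have base_change : ∀ (x' : N) (u : E), x' = x → ξ x' u = ξ x u := by rintro x' u rfl; rfl
  exact (base_change _ _ ((extChartAt 𝓘(ℝ, E) x₀).left_inv hx)).trans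
    (congrArg (ξ x) (mfderiv_symm_mfderiv_extChartAt hx v))

theorem contMDiffAt_form_along [FiniteDimensional ℝ E] {EP : Type*} [NormedAddCommGroup EP]
    [NormedSpace ℝ EP] {HP : Type*} [TopologicalSpace HP] {IP : ModelWithCorners ℝ EP HP}
    {P : Type*} [TopologicalSpace P] [ChartedSpace HP P] {g : P → N}
    {v : ∀ p, TangentSpace 𝓘(ℝ, E) (g p)} {p₀ : P} (hU : IsOpen U)
    (hξ : SmoothDual E SmoothVF U ξ) (hp₀ : g p₀ ∈ U)
    (hv : CMDiffAt ∞ (fun p => (⟨g p, v p⟩ : TangentBundle 𝓘(ℝ, E) N)) p₀) :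
    CMDiffAt ∞ (fun p => ξ (g p) (v p)) p₀ := by
  have hg : CMDiffAt ∞ g p₀ := (Bundle.contMDiffAt_totalSpace.1 hv).1
  have hφ : CMDiffAt ∞ (extChartAt 𝓘(ℝ, E) (g p₀)) (g p₀) := contMDiffAt_extChartAt
  refine (((contDiffAt_formInChart hU hξ hp₀).contMDiffAt.comp p₀ (hφ.comp p₀ hg)).clm_apply
    (contMDiffAt_mvfderiv_along hφ hv le_rfl)).congr_of_eventuallyEq ?_
  filter_upwards [hg.continuousAt.eventually (extChartAt_source_mem_nhds (I := 𝓘(ℝ, E)) (g p₀))]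
    with p hp
  exact (formInChart_extChartAt_apply ξ hp (v p)).symm

end Charts

/-! ### The Courant bracket of related sections -/

section RelatedVectorSpace

open VectorField

variable {E E' : Type*} [NormedAddCommGroup E] [NormedSpace ℝ E]
  [NormedAddCommGroup E'] [NormedSpace ℝ E'] {G : E → E'} {y : E}
  {X Y : E → E} {X' Y' : E' → E'} {ξ η : E → E →L[ℝ] ℝ} {ξ' η' : E' → E' →L[ℝ] ℝ}

theorem fderiv_fderiv_apply_add_of_related (hG : ContDiffAt ℝ 2 G y) (hX : DifferentiableAt ℝ X y)
    (hX' : DifferentiableAt ℝ X' (G y)) (h : ∀ᶠ z in 𝓝 y, fderiv ℝ G z (X z) = X' (G z)) (w : E) :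
    fderiv ℝ (fderiv ℝ G) y w (X y) + fderiv ℝ G y (fderiv ℝ X y w) =
      fderiv ℝ X' (G y) (fderiv ℝ G y w) := by
  have hG₂ : DifferentiableAt ℝ (fderiv ℝ G) y :=
    (hG.fderiv_right (m := 1) (by norm_num [one_add_one_eq_two])).differentiableAt (by simp)
  have hderiv : fderiv ℝ (fun z => fderiv ℝ G z (X z)) y =
      (fderiv ℝ X' (G y)).comp (fderiv ℝ G y) :=
    (EventuallyEq.fderiv_eq h).trans (fderiv_comp y hX' (hG.differentiableAt (by simp)))
  rw [fderiv_clm_apply hG₂ hX] at hderiv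
  rw [add_comm]
  exact DFunLike.congr_fun hderiv w

theorem fderiv_apply_lieBracket_of_related (hG : ContDiffAt ℝ 2 G y)
    (hX : DifferentiableAt ℝ X y) (hY : DifferentiableAt ℝ Y y)
    (hX' : DifferentiableAt ℝ X' (G y)) (hY' : DifferentiableAt ℝ Y' (G y))
    (h : ∀ᶠ z in 𝓝 y, fderiv ℝ G z (X z) = X' (G z))
    (h' : ∀ᶠ z in 𝓝 y, fderiv ℝ G z (Y z) = Y' (G z)) :
    fderiv ℝ G y (lieBracket ℝ X Y y) = lieBracket ℝ X' Y' (G y) := by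
  rw [lieBracket, lieBracket, map_sub, ← h.self_of_nhds, ← h'.self_of_nhds,
    ← fderiv_fderiv_apply_add_of_related hG hX hX' h (Y y),
    ← fderiv_fderiv_apply_add_of_related hG hY hY' h' (X y),
    hG.isSymmSndFDerivAt (by simp) (Y y) (X y)]
  abel

theorem lieForm_of_related (hG : ContDiffAt ℝ 2 G y) (hX : DifferentiableAt ℝ X y)
    (hX' : DifferentiableAt ℝ X' (G y)) (hη' : DifferentiableAt ℝ η' (G y))
    (h : ∀ᶠ z in 𝓝 y, fderiv ℝ G z (X z) = X' (G z))
    (h' : ∀ᶠ z in 𝓝 y, η z = (η' (G z)).comp (fderiv ℝ G z)) :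
    lieForm X η y = (lieForm X' η' (G y)).comp (fderiv ℝ G y) := by
  have hG₁ : DifferentiableAt ℝ G y := hG.differentiableAt (by simp)
  have hG₂ : DifferentiableAt ℝ (fderiv ℝ G) y :=
    (hG.fderiv_right (m := 1) (by norm_num [one_add_one_eq_two])).differentiableAt (by simp)
  have hη'G : fderiv ℝ (fun z => η' (G z)) y = (fderiv ℝ η' (G y)).comp (fderiv ℝ G y) :=
    fderiv_comp y hη' hG₁
  have hη : fderiv ℝ η y = _ := (EventuallyEq.fderiv_eq h').trans
    (fderiv_clm_comp (hη'.comp y hG₁) hG₂)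
  ext w
  simp only [hη'G] at hη
  simp only [lieForm, hη, h'.self_of_nhds, ← h.self_of_nhds, add_apply,
    ContinuousLinearMap.comp_apply, ContinuousLinearMap.compL_apply,
    ContinuousLinearMap.flip_apply, ← fderiv_fderiv_apply_add_of_related hG hX hX' h w, map_add,
    hG.isSymmSndFDerivAt (by simp) (X y) w]
  ring

theorem courantForm_of_related (hG : ContDiffAt ℝ 2 G y) (hX : DifferentiableAt ℝ X y)
    (hY : DifferentiableAt ℝ Y y) (hX' : DifferentiableAt ℝ X' (G y))
    (hY' : DifferentiableAt ℝ Y' (G y)) (hξ' : DifferentiableAt ℝ ξ' (G y))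
    (hη' : DifferentiableAt ℝ η' (G y)) (hXX' : ∀ᶠ z in 𝓝 y, fderiv ℝ G z (X z) = X' (G z))
    (hYY' : ∀ᶠ z in 𝓝 y, fderiv ℝ G z (Y z) = Y' (G z))
    (hξξ' : ∀ᶠ z in 𝓝 y, ξ z = (ξ' (G z)).comp (fderiv ℝ G z))
    (hηη' : ∀ᶠ z in 𝓝 y, η z = (η' (G z)).comp (fderiv ℝ G z)) :
    courantForm X ξ Y η y = (courantForm X' ξ' Y' η' (G y)).comp (fderiv ℝ G y) := by
  have hpairing : (fun z => ξ z (Y z) - η z (X z)) =ᶠ[𝓝 y]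
      (fun z => ξ' z (Y' z) - η' z (X' z)) ∘ G := by
    filter_upwards [hXX', hYY', hξξ', hηη'] with z hX hY hξ hη
    simp [hξ, hη, hX, hY]
  rw [courantForm, courantForm, lieForm_of_related hG hX hX' hη' hXX' hηη',
    lieForm_of_related hG hY hY' hξ' hYY' hξξ', hpairing.fderiv_eq,
    fderiv_comp (g := fun z => ξ' z (Y' z) - η' z (X' z)) y
      ((hξ'.clm_apply hY').sub (hη'.clm_apply hX')) (hG.differentiableAt (by simp))]
  ext w
  simp

end RelatedVectorSpace

section Related

open VectorField

variable {E E' : Type*} [NormedAddCommGroup E] [NormedSpace ℝ E]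
  [NormedAddCommGroup E'] [NormedSpace ℝ E']
  {N : Type*} [TopologicalSpace N] [ChartedSpace E N]
  {N' : Type*} [TopologicalSpace N'] [ChartedSpace E' N'] {G : N → N'} {x : N}
  {X Y : ∀ x : N, TangentSpace 𝓘(ℝ, E) x} {X' Y' : ∀ x : N', TangentSpace 𝓘(ℝ, E') x}
  {ξ : ∀ x : N, TangentSpace 𝓘(ℝ, E) x →L[ℝ] ℝ} {ξ' : ∀ x : N', TangentSpace 𝓘(ℝ, E') x →L[ℝ] ℝ}

/-- The sections `a` and `a'` of `T ⊕ T^∨` are related by `G` at `x`: the vector field of `a` is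
pushed forward to that of `a'`, and the one-form of `a` is the pullback of that of `a'`. -/
def RelatedAt (G : N → N') (x : N) (a : ∀ x : N, TT E x) (a' : ∀ x : N', TT E' x) : Prop :=
  mfderiv% G x (a x).1 = (a' (G x)).1 ∧ ∀ u, (a x).2 u = (a' (G x)).2 (mfderiv% G x u)

theorem eventually_symm_mem_extChartAt_source (hG : ContinuousAt G x) :
    ∀ᶠ z in 𝓝 (extChartAt 𝓘(ℝ, E) x x),
      G ((extChartAt 𝓘(ℝ, E) x).symm z) ∈ (extChartAt 𝓘(ℝ, E') (G x)).source :=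
  (tendsto_extChartAt_symm x).eventually (hG.eventually (extChartAt_source_mem_nhds (G x)))

theorem contDiffAt_writtenInExtChartAt (hG : CMDiffAt ∞ G x) :
    ContDiffAt ℝ ∞ (writtenInExtChartAt 𝓘(ℝ, E) 𝓘(ℝ, E') x G) (extChartAt 𝓘(ℝ, E) x x) := by
  have h := (contMDiffAt_iff.1 hG).2
  rwa [ModelWithCorners.range_eq_univ, contDiffWithinAt_univ] at h

theorem writtenInExtChartAt_self :
    writtenInExtChartAt 𝓘(ℝ, E) 𝓘(ℝ, E') x G (extChartAt 𝓘(ℝ, E) x x) =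
      extChartAt 𝓘(ℝ, E') (G x) (G x) := by
  simp only [writtenInExtChartAt, Function.comp_apply, extChartAt_to_inv]

theorem formInChart_zero (x : N) :
    formInChart (E := E) x (fun y => (0 : TangentSpace 𝓘(ℝ, E) y →L[ℝ] ℝ)) = 0 := by
  funext y
  ext w
  rfl

theorem courant_zero_left (b : ∀ x : N, TT E x) (x : N) :
    courant (fun x => (0 : TT E x)) b x = 0 := by
  have hform : courantForm (vfInChart x fun y => (0 : TangentSpace 𝓘(ℝ, E) y))
      (formInChart x fun y => (0 : TangentSpace 𝓘(ℝ, E) y →L[ℝ] ℝ)) (vfInChart x fun y => (b y).1)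
      (formInChart x fun y => (b y).2) (extChartAt 𝓘(ℝ, E) x x) = 0 := by
    rw [formInChart_zero, show vfInChart x (fun y => (0 : TangentSpace 𝓘(ℝ, E) y)) = 0 from
      mpullback_zero]
    ext w
    simp [courantForm, lieForm]
  refine Prod.ext (congrFun (mlieBracket_zero_left (I := 𝓘(ℝ, E))) x) ?_
  exact congrArg (ContinuousLinearMap.comp · (mfderiv% (extChartAt 𝓘(ℝ, E) x) x)) hform

theorem courant_zero_right (a : ∀ x : N, TT E x) (x : N) :
    courant a (fun x => (0 : TT E x)) x = 0 := by
  have hform : courantForm (vfInChart x fun y => (a y).1) (formInChart x fun y => (a y).2)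
      (vfInChart x fun y => (0 : TangentSpace 𝓘(ℝ, E) y))
      (formInChart x fun y => (0 : TangentSpace 𝓘(ℝ, E) y →L[ℝ] ℝ))
      (extChartAt 𝓘(ℝ, E) x x) = 0 := by
    rw [formInChart_zero, show vfInChart x (fun y => (0 : TangentSpace 𝓘(ℝ, E) y)) = 0 from
      mpullback_zero]
    ext w
    simp [courantForm, lieForm]
  refine Prod.ext (congrFun (mlieBracket_zero_right (I := 𝓘(ℝ, E))) x) ?_
  exact congrArg (ContinuousLinearMap.comp · (mfderiv% (extChartAt 𝓘(ℝ, E) x) x)) hform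

variable [IsManifold 𝓘(ℝ, E) ∞ N]

theorem mfderiv_extChartAt_mlieBracket (X Y : ∀ x : N, TangentSpace 𝓘(ℝ, E) x) (x : N) :
    mfderiv% (extChartAt 𝓘(ℝ, E) x) x (mlieBracket 𝓘(ℝ, E) X Y x) =
      lieBracket ℝ (vfInChart x X) (vfInChart x Y) (extChartAt 𝓘(ℝ, E) x x) := by
  obtain ⟨e, he⟩ := isInvertible_mfderiv_extChartAt (I := 𝓘(ℝ, E)) (mem_extChartAt_source x)
  rw [mlieBracket, mlieBracketWithin_apply, ← he, ContinuousLinearMap.inverse_equiv]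
  refine (e.apply_symm_apply _).trans ?_
  rw [ModelWithCorners.range_eq_univ, preimage_univ, univ_inter, mpullbackWithin_univ,
    mpullbackWithin_univ]
  exact congrFun (lieBracketWithin_univ (𝕜 := ℝ) (V := vfInChart x X) (W := vfInChart x Y)) _

variable {F : Type*} [NormedAddCommGroup F] [NormedSpace ℝ F]

theorem fderiv_comp_extChartAt_symm_vfInChart {f : N → F} {y : E}
    (hy : y ∈ (extChartAt 𝓘(ℝ, E) x).target) (hf : MDiffAt f ((extChartAt 𝓘(ℝ, E) x).symm y)) :
    fderiv ℝ (fun y => f ((extChartAt 𝓘(ℝ, E) x).symm y)) y (vfInChart x X y) =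
      d% f ((extChartAt 𝓘(ℝ, E) x).symm y) (X ((extChartAt 𝓘(ℝ, E) x).symm y)) := by
  have hsymm : MDiffAt (extChartAt 𝓘(ℝ, E) x).symm y :=
    (contMDiffAt_extChartAt_symm hy).mdifferentiableAt (by simp)
  rw [← mfderiv_symm_vfInChart X hy, ← mfderiv_eq_fderiv]
  exact DFunLike.congr_fun (hf.hasMFDerivAt.comp y hsymm.hasMFDerivAt).mfderiv _

theorem mvfderiv_mlieBracket {f : N → F} (hf : CMDiffAt ∞ f x) (hX : CMDiffAt ∞ (T% X) x)
    (hY : CMDiffAt ∞ (T% Y) x) :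
    d% f x (mlieBracket 𝓘(ℝ, E) X Y x) =
      d% (fun y => d% f y (Y y)) x (X x) - d% (fun y => d% f y (X y)) x (Y x) := by
  set z := extChartAt 𝓘(ℝ, E) x x
  have hz : z ∈ (extChartAt 𝓘(ℝ, E) x).target := mem_extChartAt_target x
  have at_center : ∀ {g : N → F} (_ : MDiffAt g x) (W : ∀ x : N, TangentSpace 𝓘(ℝ, E) x),
      fderiv ℝ (fun y => g ((extChartAt 𝓘(ℝ, E) x).symm y)) z (vfInChart x W z) =
        d% g x (W x) := by
    intro g hg W
    have h := fderiv_comp_extChartAt_symm_vfInChart (X := W) (f := g) hz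
      (by rwa [extChartAt_to_inv])
    rwa [extChartAt_to_inv] at h
  have second : ∀ {W W' : ∀ x : N, TangentSpace 𝓘(ℝ, E) x} (_ : CMDiffAt ∞ (T% W') x),
      fderiv ℝ (fun y => fderiv ℝ (fun y => f ((extChartAt 𝓘(ℝ, E) x).symm y)) y
        (vfInChart x W' y)) z (vfInChart x W z) = d% (fun y => d% f y (W' y)) x (W x) := by
    intro W W' hW'
    have hd : MDiffAt (fun y => d% f y (W' y)) x :=
      (contMDiffAt_mvfderiv_along hf hW' le_rfl).mdifferentiableAt (by simp)
    rw [← at_center hd W]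
    refine DFunLike.congr_fun (EventuallyEq.fderiv_eq ?_) _
    filter_upwards [extChartAt_target_mem_nhds x, (tendsto_extChartAt_symm x).eventually
      (eventually_mdifferentiableAt (hf.of_le (by simp)))] with y hy hfy
      using fderiv_comp_extChartAt_symm_vfInChart hy hfy
  have hdiff : ∀ {W : ∀ x : N, TangentSpace 𝓘(ℝ, E) x} (_ : CMDiffAt ∞ (T% W) x),
      DifferentiableAt ℝ (vfInChart x W) z := fun hW =>
    (contDiffAt_vfInChart hW).differentiableAt (by simp)
  have hfz : ContDiffAt ℝ 2 (fun y => f ((extChartAt 𝓘(ℝ, E) x).symm y)) z :=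
    (contMDiffAt_comp_extChartAt_symm hf).contDiffAt.of_le ENat.LEInfty.out
  rw [← second hX, ← second hY, ← at_center (hf.mdifferentiableAt (by simp)), vfInChart_extChartAt,
    mfderiv_extChartAt_mlieBracket]
  exact VectorField.fderiv_apply_lieBracket_of_isSymmSndFDerivAt hfz
    (hfz.isSymmSndFDerivAt (by simp)) (hdiff hY) (hdiff hX)

variable [IsManifold 𝓘(ℝ, E') ∞ N']

theorem eventually_fderiv_writtenInExtChartAt (hG : CMDiffAt ∞ G x) :
    ∀ᶠ z in 𝓝 (extChartAt 𝓘(ℝ, E) x x), ∀ w : E,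
      fderiv ℝ (writtenInExtChartAt 𝓘(ℝ, E) 𝓘(ℝ, E') x G) z w =
        mfderiv% (extChartAt 𝓘(ℝ, E') (G x)) (G ((extChartAt 𝓘(ℝ, E) x).symm z))
          (mfderiv% G ((extChartAt 𝓘(ℝ, E) x).symm z)
            (mfderiv% (extChartAt 𝓘(ℝ, E) x).symm z w)) := by
  filter_upwards [(tendsto_extChartAt_symm x).eventually
      (eventually_mdifferentiableAt (hG.of_le (by simp))),
    eventually_symm_mem_extChartAt_source (E := E) (E' := E') hG.continuousAt,
    extChartAt_target_mem_nhds x]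
    with z hGz hmem hz w
  have hsymm : MDiffAt (extChartAt 𝓘(ℝ, E) x).symm z :=
    (contMDiffAt_extChartAt_symm hz).mdifferentiableAt (by simp)
  have hchart : MDiffAt (extChartAt 𝓘(ℝ, E') (G x)) (G ((extChartAt 𝓘(ℝ, E) x).symm z)) :=
    mdifferentiableAt_extChartAt (by simpa using hmem)
  rw [← mfderiv_eq_fderiv]
  exact DFunLike.congr_fun
    (hchart.hasMFDerivAt.comp z (hGz.hasMFDerivAt.comp z hsymm.hasMFDerivAt)).mfderiv w

theorem fderiv_writtenInExtChartAt_self (hG : CMDiffAt ∞ G x) (u : TangentSpace 𝓘(ℝ, E) x) :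
    fderiv ℝ (writtenInExtChartAt 𝓘(ℝ, E) 𝓘(ℝ, E') x G) (extChartAt 𝓘(ℝ, E) x x)
        (mfderiv% (extChartAt 𝓘(ℝ, E) x) x u) =
      mfderiv% (extChartAt 𝓘(ℝ, E') (G x)) (G x) (mfderiv% G x u) := by
  have h := (eventually_fderiv_writtenInExtChartAt hG).self_of_nhds
    (mfderiv% (extChartAt 𝓘(ℝ, E) x) x u)
  rwa [mfderiv_symm_mfderiv_extChartAt (mem_extChartAt_source x) u, extChartAt_to_inv] at h

theorem eventually_fderiv_writtenInExtChartAt_vfInChart (hG : CMDiffAt ∞ G x)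
    (h : ∀ᶠ y in 𝓝 x, mfderiv% G y (X y) = X' (G y)) :
    ∀ᶠ z in 𝓝 (extChartAt 𝓘(ℝ, E) x x),
      fderiv ℝ (writtenInExtChartAt 𝓘(ℝ, E) 𝓘(ℝ, E') x G) z (vfInChart x X z) =
        vfInChart (G x) X' (writtenInExtChartAt 𝓘(ℝ, E) 𝓘(ℝ, E') x G z) := by
  filter_upwards [eventually_fderiv_writtenInExtChartAt hG,
    (tendsto_extChartAt_symm x).eventually h,
    eventually_symm_mem_extChartAt_source (E := E) (E' := E') hG.continuousAt,
    extChartAt_target_mem_nhds x]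
    with z hderiv hXz hmem hz
  have hX' := vfInChart_eq_mfderiv X' ((extChartAt 𝓘(ℝ, E') (G x)).map_source hmem)
  rw [(extChartAt 𝓘(ℝ, E') (G x)).left_inv hmem, ← hXz, ← mfderiv_symm_vfInChart X hz] at hX'
  exact (hderiv _).trans hX'.symm

theorem eventually_formInChart_eq_comp (hG : CMDiffAt ∞ G x)
    (h : ∀ᶠ y in 𝓝 x, ∀ u, ξ y u = ξ' (G y) (mfderiv% G y u)) :
    ∀ᶠ z in 𝓝 (extChartAt 𝓘(ℝ, E) x x), formInChart x ξ z =
      (formInChart (G x) ξ' (writtenInExtChartAt 𝓘(ℝ, E) 𝓘(ℝ, E') x G z)).comp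
        (fderiv ℝ (writtenInExtChartAt 𝓘(ℝ, E) 𝓘(ℝ, E') x G) z) := by
  filter_upwards [eventually_fderiv_writtenInExtChartAt hG,
    (tendsto_extChartAt_symm x).eventually h,
    eventually_symm_mem_extChartAt_source (E := E) (E' := E') hG.continuousAt]
    with z hderiv hξz hmem
  ext w
  rw [ContinuousLinearMap.comp_apply, hderiv]
  exact (hξz _).trans (formInChart_extChartAt_apply ξ' hmem _).symm

omit [IsManifold 𝓘(ℝ, E) ∞ N] in
theorem differentiableAt_vfInChart_writtenInExtChartAt (hX' : CMDiffAt ∞ (T% X') (G x)) :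
    DifferentiableAt ℝ (vfInChart (G x) X')
      (writtenInExtChartAt 𝓘(ℝ, E) 𝓘(ℝ, E') x G (extChartAt 𝓘(ℝ, E) x x)) := by
  rw [writtenInExtChartAt_self]
  exact (contDiffAt_vfInChart hX').differentiableAt (by simp)

theorem mfderiv_mlieBracket_of_related (hG : CMDiffAt ∞ G x)
    (hX : CMDiffAt ∞ (T% X) x) (hY : CMDiffAt ∞ (T% Y) x)
    (hX' : CMDiffAt ∞ (T% X') (G x)) (hY' : CMDiffAt ∞ (T% Y') (G x))
    (h : ∀ᶠ y in 𝓝 x, mfderiv% G y (X y) = X' (G y))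
    (h' : ∀ᶠ y in 𝓝 x, mfderiv% G y (Y y) = Y' (G y)) :
    mfderiv% G x (mlieBracket 𝓘(ℝ, E) X Y x) = mlieBracket 𝓘(ℝ, E') X' Y' (G x) := by
  apply mfderiv_extChartAt_injective
  rw [mfderiv_extChartAt_mlieBracket, ← fderiv_writtenInExtChartAt_self hG,
    mfderiv_extChartAt_mlieBracket, ← writtenInExtChartAt_self (E := E) (E' := E') (G := G)]
  exact fderiv_apply_lieBracket_of_related (E := E) (E' := E')
    ((contDiffAt_writtenInExtChartAt hG).of_le ENat.LEInfty.out)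
    ((contDiffAt_vfInChart hX).differentiableAt (by simp))
    ((contDiffAt_vfInChart hY).differentiableAt (by simp))
    (differentiableAt_vfInChart_writtenInExtChartAt hX')
    (differentiableAt_vfInChart_writtenInExtChartAt hY')
    (eventually_fderiv_writtenInExtChartAt_vfInChart hG h)
    (eventually_fderiv_writtenInExtChartAt_vfInChart hG h')

theorem RelatedAt.courant [FiniteDimensional ℝ E'] (hG : CMDiffAt ∞ G x)
    {a b : ∀ x : N, TT E x} {a' b' : ∀ x : N', TT E' x}
    {U : Set N} (hU : IsOpen U) (hx : x ∈ U) {U' : Set N'} (hU' : IsOpen U') (hx' : G x ∈ U')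
    (ha : SmoothTT U a) (hb : SmoothTT U b) (ha' : SmoothTT U' a') (hb' : SmoothTT U' b')
    (h : ∀ᶠ y in 𝓝 x, RelatedAt G y a a') (h' : ∀ᶠ y in 𝓝 x, RelatedAt G y b b') :
    RelatedAt G x (courant a b) (courant a' b') := by
  have hvf : ∀ {a : ∀ x : N, TT E x} (_ : SmoothTT U a), CMDiffAt ∞ (T% fun y => (a y).1) x :=
    fun ha => (smoothVF_iff_contMDiffAt hU).1 ha.1 x hx
  have hvf' : ∀ {a : ∀ x : N', TT E' x} (_ : SmoothTT U' a),
      CMDiffAt ∞ (T% fun y => (a y).1) (G x) :=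
    fun ha => (smoothVF_iff_contMDiffAt hU').1 ha.1 _ hx'
  refine ⟨mfderiv_mlieBracket_of_related hG (hvf ha) (hvf hb) (hvf' ha') (hvf' hb')
    (h.mono fun y hy => hy.1) (h'.mono fun y hy => hy.1), fun u => ?_⟩
  have hform := courantForm_of_related
    ((contDiffAt_writtenInExtChartAt hG).of_le ENat.LEInfty.out)
    ((contDiffAt_vfInChart (hvf ha)).differentiableAt (by simp))
    ((contDiffAt_vfInChart (hvf hb)).differentiableAt (by simp))
    (differentiableAt_vfInChart_writtenInExtChartAt (hvf' ha'))
    (differentiableAt_vfInChart_writtenInExtChartAt (hvf' hb'))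
    (by
      rw [writtenInExtChartAt_self]
      exact (contDiffAt_formInChart hU' ha'.2 hx').differentiableAt (by simp))
    (by
      rw [writtenInExtChartAt_self]
      exact (contDiffAt_formInChart hU' hb'.2 hx').differentiableAt (by simp))
    (eventually_fderiv_writtenInExtChartAt_vfInChart hG (h.mono fun y hy => hy.1))
    (eventually_fderiv_writtenInExtChartAt_vfInChart hG (h'.mono fun y hy => hy.1))
    (eventually_formInChart_eq_comp hG (h.mono fun y hy => hy.2))
    (eventually_formInChart_eq_comp hG (h'.mono fun y hy => hy.2))
  rw [writtenInExtChartAt_self] at hform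
  exact (DFunLike.congr_fun hform (mfderiv% (extChartAt 𝓘(ℝ, E) x) x u)).trans
    (congrArg (DFunLike.coe (courantForm (E := E') _ _ _ _ _))
      (fderiv_writtenInExtChartAt_self hG u))

end Related

/-! ### Local trivializations -/

/-- The continuous linear endomorphism of `ℝ^n` given by an integral matrix, `intAct` with its
linear structure. -/
def intActL {n : ℕ} (A : Matrix (Fin n) (Fin n) ℤ) : Rn n →L[ℝ] Rn n :=
  LinearMap.toContinuousLinearMap (Matrix.toLin' (A.map (Int.cast : ℤ → ℝ)))

namespace TorusBundle

variable {n : ℕ} {M : Type*} [TopologicalSpace M] [ChartedSpace (EuclideanSpace ℝ (Fin n)) M]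
  {EZ : Type*} [NormedAddCommGroup EZ] [NormedSpace ℝ EZ]
  {Z : Type*} [TopologicalSpace Z] [ChartedSpace EZ Z]
  (T : TorusBundle n M EZ Z)

theorem dφ_eq_of_transition {c c' m : M} (hm : m ∈ T.U c) (hm' : m ∈ T.U c')
    {A : Matrix (Fin n) (Fin n) ℤ}
    (hA : ∀ᶠ m' in 𝓝 m, ∀ η, T.φ c' (m', η) = T.φ c (m', intActL A η)) {ξ ξ' : Rn n}
    {k : Fin n → ℤ} (hk : ∀ i, ξ i = intActL A ξ' i + k i)
    (w : EuclideanSpace ℝ (Fin n) × Rn n) :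
    T.dφ c' m ξ' w = T.dφ c m ξ (w.1, intActL A w.2) := by
  let g : M × Rn n → M × Rn n := fun q => (q.1, intActL A q.2 + fun i => (k i : ℝ))
  have hg₀ : g (m, ξ') = (m, ξ) := Prod.ext rfl (funext fun i => (hk i).symm)
  have hg : HasMFDerivAt ((𝓡 n).prod 𝓘(ℝ, Rn n)) ((𝓡 n).prod 𝓘(ℝ, Rn n)) g (m, ξ')
      ((ContinuousLinearMap.fst ℝ (EuclideanSpace ℝ (Fin n)) (Rn n)).prod
        ((intActL A).comp (ContinuousLinearMap.snd ℝ (EuclideanSpace ℝ (Fin n)) (Rn n)))) := by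
    have hfst := hasMFDerivAt_fst (I := 𝓡 n) (I' := 𝓘(ℝ, Rn n)) (x := ((m, ξ') : M × Rn n))
    have hsnd := hasMFDerivAt_snd (I := 𝓡 n) (I' := 𝓘(ℝ, Rn n)) (x := ((m, ξ') : M × Rn n))
    have haff : HasMFDerivAt 𝓘(ℝ, Rn n) 𝓘(ℝ, Rn n)
        (fun η : Rn n => intActL A η + fun i => (k i : ℝ)) ξ' (intActL A) :=
      ((intActL A).hasFDerivAt.add_const _).hasMFDerivAt
    exact hfst.prodMk (haff.comp (m, ξ') hsnd)
  have hφ : HasMFDerivAt ((𝓡 n).prod 𝓘(ℝ, Rn n)) 𝓘(ℝ, EZ) (T.φ c) (g (m, ξ')) (T.dφ c m ξ) := by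
    rw [hg₀]
    exact (T.mdifferentiableAt_φ c m hm ξ).hasMFDerivAt
  have hφg : T.φ c' =ᶠ[𝓝 (m, ξ')] T.φ c ∘ g := by
    have hfst : ContinuousAt (Prod.fst : M × Rn n → M) (m, ξ') := continuousAt_fst
    filter_upwards [hfst.eventually hA, hfst.eventually ((T.isOpen_U c).mem_nhds hm)]
      with q hq hqU
    exact (hq q.2).trans ((T.period c q.1 hqU _ _).2 ⟨k, fun _ => rfl⟩)
  exact DFunLike.congr_fun (hasMFDerivAt_unique (T.mdifferentiableAt_φ c' m hm' ξ').hasMFDerivAt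
    ((hφ.comp (m, ξ') hg).congr_of_eventuallyEq hφg)) w

theorem exists_coord_eq_dφ_eq {c c' m : M} (hm : m ∈ T.U c) (hm' : m ∈ T.U c') {ξ ξ' : Rn n}
    (h : T.φ c (m, ξ) = T.φ c' (m, ξ')) :
    ∃ A : Matrix (Fin n) (Fin n) ℤ, (∀ v, T.coord c m v = intActL A (T.coord c' m v)) ∧
      ∀ u η, T.dφ c' m ξ' (u, η) = T.dφ c m ξ (u, intActL A η) := by
  obtain ⟨A, hA⟩ := T.trans c c' m ⟨hm, hm'⟩
  obtain ⟨k, hk⟩ := (T.period c m hm _ _).1 (h.trans (hA.self_of_nhds ξ')).symm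
  exact ⟨A.1, T.coord_change hm hm' A.1 hA.self_of_nhds,
    fun u η => T.dφ_eq_of_transition hm hm' hA hk (u, η)⟩

theorem exists_eventually_coord_eq {c c' m : M} (hm : m ∈ T.U c) (hm' : m ∈ T.U c') :
    ∃ A : Matrix (Fin n) (Fin n) ℤ, ∀ᶠ m' in 𝓝 m, ∀ v,
      T.coord c m' v = intActL A (T.coord c' m' v) := by
  obtain ⟨A, hA⟩ := T.trans c c' m ⟨hm, hm'⟩
  refine ⟨A.1, ?_⟩
  filter_upwards [hA, (T.isOpen_U c).mem_nhds hm, (T.isOpen_U c').mem_nhds hm'] with m' h hc hc'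
  exact T.coord_change hc hc' A.1 h

theorem coord_coordEquiv_symm {c m : M} (hm : m ∈ T.U c) (η : Rn n) :
    T.coord c m ((T.coordEquiv c m hm).symm η) = η :=
  (T.coordEquiv c m hm).apply_symm_apply η

theorem coord_injective {c m : M} (hm : m ∈ T.U c) : Function.Injective (T.coord c m) :=
  (T.coordEquiv c m hm).injective

theorem coord_inverse {c m : M} (hm : m ∈ T.U c) :
    (T.coord c m).inverse = (T.coordEquiv c m hm).symm :=
  ContinuousLinearMap.inverse_equiv (T.coordEquiv c m hm)

theorem coe_eq_dφ_coord {c m : M} (hm : m ∈ T.U c) (v : T.V m) :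
    (v : TangentSpace 𝓘(ℝ, EZ) (T.zero m)) = T.dφ c m 0 (0, T.coord c m v) :=
  congrArg Subtype.val ((T.coordEquiv c m hm).symm_apply_apply v).symm

theorem contMDiffAt_φ {c m : M} (hm : m ∈ T.U c) (ξ : Rn n) :
    ContMDiffAt ((𝓡 n).prod 𝓘(ℝ, Rn n)) 𝓘(ℝ, EZ) ∞ (T.φ c) (m, ξ) :=
  IsLocalDiffeomorphAt.contMDiffAt (T.localDiffeo c ⟨(m, ξ), hm, mem_univ _⟩)

theorem contMDiffAt_φ_const {c m : M} (hm : m ∈ T.U c) (ξ : Rn n) :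
    ContMDiffAt (𝓡 n) 𝓘(ℝ, EZ) ∞ (fun m => T.φ c (m, ξ)) m :=
  ContMDiffAt.comp (f := fun m => ((m, ξ) : M × Rn n)) m (T.contMDiffAt_φ hm ξ)
    (contMDiffAt_id.prodMk contMDiffAt_const)

theorem mfderiv_φ_const {c m : M} (hm : m ∈ T.U c) (ξ : Rn n) (u : TangentSpace (𝓡 n) m) :
    mfderiv (𝓡 n) 𝓘(ℝ, EZ) (fun m => T.φ c (m, ξ)) m u = T.dφ c m ξ (u, 0) := by
  have hpair := (hasMFDerivAt_id (I := 𝓡 n) m).prodMk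
    (hasMFDerivAt_const (I := 𝓡 n) (I' := 𝓘(ℝ, Rn n)) ξ m)
  have hcomp : HasMFDerivAt (𝓡 n) 𝓘(ℝ, EZ) (fun m => T.φ c (m, ξ)) m _ :=
    HasMFDerivAt.comp m (T.mdifferentiableAt_φ c m hm ξ).hasMFDerivAt hpair
  rw [hcomp.mfderiv]
  rfl

theorem eventually_fst_localInverse_eq_proj {c m : M} (hm : m ∈ T.U c) (ξ : Rn n) :
    let inv := (T.localDiffeo c ⟨(m, ξ), hm, mem_univ _⟩).localInverse
    ∀ᶠ z in 𝓝 (T.φ c (m, ξ)), (inv z).1 = T.proj z ∧ T.proj z ∈ T.U c ∧ T.φ c (inv z) = z := by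
  intro inv
  have h := T.localDiffeo c ⟨(m, ξ), hm, mem_univ _⟩
  have hinv : inv (T.φ c (m, ξ)) = (m, ξ) := h.localInverse_left_inv h.localInverse_mem_target
  have hU : ∀ᶠ z in 𝓝 (T.φ c (m, ξ)), (inv z).1 ∈ T.U c := by
    refine (contMDiffAt_fst.comp _ h.localInverse_contMDiffAt).continuousAt.eventually
      ((T.isOpen_U c).mem_nhds ?_)
    change (inv (T.φ c (m, ξ))).1 ∈ T.U c
    rwa [hinv]
  filter_upwards [hU, h.localInverse_eventuallyEq_right] with z hzU hz
  have hproj : T.proj z = (inv z).1 :=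
    (congrArg T.proj (show T.φ c (inv z) = z from hz).symm).trans (T.proj_φ c _ hzU _)
  exact ⟨hproj.symm, hproj ▸ hzU, hz⟩

theorem contMDiff_proj : ContMDiff 𝓘(ℝ, EZ) (𝓡 n) ∞ T.proj := by
  intro z
  have hz : ContMDiffAt 𝓘(ℝ, EZ) (𝓡 n) ∞ T.proj (T.φ (T.proj z) (T.proj z, T.fib z)) :=
    (contMDiffAt_fst.comp _ (T.localDiffeo (T.proj z)
      ⟨(T.proj z, T.fib z), T.mem_U _, mem_univ _⟩).localInverse_contMDiffAt).congr_of_eventuallyEq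
      ((T.eventually_fst_localInverse_eq_proj (T.mem_U _) (T.fib z)).mono fun _ h => h.1.symm)
  rwa [T.φ_fib] at hz

/-- `τ` is a smooth fibre coordinate of the local trivialization `φ c` near `φ c (m, ξ)`: together
with the projection it inverts `φ c` there, on the branch through `(m, ξ)`. -/
structure IsFibreCoordAt (c m : M) (ξ : Rn n) (τ : Z → Rn n) : Prop where
  contMDiffAt : ContMDiffAt 𝓘(ℝ, EZ) 𝓘(ℝ, Rn n) ∞ τ (T.φ c (m, ξ))
  eventually_apply_φ : ∀ᶠ q in 𝓝 ((m, ξ) : M × Rn n), τ (T.φ c q) = q.2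
  eventually_φ_apply : ∀ᶠ z in 𝓝 (T.φ c (m, ξ)), T.proj z ∈ T.U c ∧ T.φ c (T.proj z, τ z) = z

theorem exists_isFibreCoordAt {c m : M} (hm : m ∈ T.U c) (ξ : Rn n) :
    ∃ τ, T.IsFibreCoordAt c m ξ τ := by
  have h := T.localDiffeo c ⟨(m, ξ), hm, mem_univ _⟩
  refine ⟨fun z => (h.localInverse z).2, contMDiffAt_snd.comp _ h.localInverse_contMDiffAt,
    h.localInverse_eventuallyEq_left.mono fun q hq => congrArg Prod.snd hq,
    (T.eventually_fst_localInverse_eq_proj hm ξ).mono fun z hz => ⟨hz.2.1, ?_⟩⟩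
  rw [← hz.1]
  exact hz.2.2

theorem IsFibreCoordAt.eventually_mvfderiv_dφ [IsManifold 𝓘(ℝ, EZ) ∞ Z] {T : TorusBundle n M EZ Z}
    {c m : M} (hm : m ∈ T.U c) {ξ : Rn n} {τ : Z → Rn n} (hτ : T.IsFibreCoordAt c m ξ τ) :
    ∀ᶠ q in 𝓝 ((m, ξ) : M × Rn n), ∀ w,
      mvfderiv 𝓘(ℝ, EZ) τ (T.φ c q) (T.dφ c q.1 q.2 w) = w.2 := by
  have hdiff := (T.contMDiffAt_φ hm ξ).continuousAt.eventually
    (eventually_mdifferentiableAt (hτ.contMDiffAt.of_le (by simp)))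
  have hfst : ContinuousAt (Prod.fst : M × Rn n → M) (m, ξ) := continuousAt_fst
  filter_upwards [hdiff, eventually_eventually_nhds.2 hτ.eventually_apply_φ,
    hfst.eventually ((T.isOpen_U c).mem_nhds hm)] with q hq hqτ hqU w
  have hcomp := hq.hasMFDerivAt.comp q (T.mdifferentiableAt_φ c q.1 hqU q.2).hasMFDerivAt
  have hsnd := hasMFDerivAt_snd (I := 𝓡 n) (I' := 𝓘(ℝ, Rn n)) (x := q)
  exact DFunLike.congr_fun (hasMFDerivAt_unique hcomp (hsnd.congr_of_eventuallyEq hqτ)) w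

/-! ### The splitting of the tangent sequence -/

theorem horLift_eq_dφ {c : M} {z : Z} (hz : T.proj z ∈ T.U c) {ξ : Rn n}
    (h : T.φ c (T.proj z, ξ) = z) (u : TangentSpace (𝓡 n) (T.proj z)) :
    T.horLift z u = T.dφ c (T.proj z) ξ (u, 0) := by
  obtain ⟨A, -, hA⟩ := T.exists_coord_eq_dφ_eq hz (T.mem_U _) (h.trans (T.φ_fib z).symm)
  refine (hA u 0).trans ?_
  rw [map_zero]

theorem j_eq_dφ {c : M} {z : Z} (hz : T.proj z ∈ T.U c) {ξ : Rn n}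
    (h : T.φ c (T.proj z, ξ) = z) (v : T.V (T.proj z)) :
    T.j z v = T.dφ c (T.proj z) ξ (0, T.coord c (T.proj z) v) := by
  obtain ⟨A, hcoord, hA⟩ := T.exists_coord_eq_dφ_eq hz (T.mem_U _) (h.trans (T.φ_fib z).symm)
  refine (hA 0 (T.coord (T.proj z) (T.proj z) v)).trans ?_
  rw [← hcoord]

theorem dproj_dTriv (z : Z) (w : EuclideanSpace ℝ (Fin n) × Rn n) :
    T.dproj z (T.dTriv z w) = w.1 := by
  have h := T.dproj_dφ (T.proj z) (T.proj z) (T.mem_U _) (T.fib z) w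
  rwa [T.φ_fib z] at h

theorem coord_D_dTriv (z : Z) (w : EuclideanSpace ℝ (Fin n) × Rn n) :
    T.coord (T.proj z) (T.proj z) (T.D z (T.dTriv z w)) = w.2 := by
  obtain ⟨e, he⟩ : ∃ e : (EuclideanSpace ℝ (Fin n) × Rn n) ≃L[ℝ] EZ, T.dTriv z = e :=
    T.dφ_equiv _ _ (T.mem_U _) _
  refine (T.coord_coordEquiv_symm (T.mem_U _) _).trans ?_
  change ((T.dTriv z).inverse (T.dTriv z w)).2 = w.2
  rw [he, ContinuousLinearMap.inverse_equiv]
  exact congrArg Prod.snd (e.symm_apply_apply w)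

theorem dproj_horLift (z : Z) (u : TangentSpace (𝓡 n) (T.proj z)) :
    T.dproj z (T.horLift z u) = u :=
  T.dproj_dTriv z (u, 0)

theorem dproj_j (z : Z) (v : T.V (T.proj z)) : T.dproj z (T.j z v) = 0 :=
  T.dproj_dTriv z (0, _)

theorem D_horLift (z : Z) (u : TangentSpace (𝓡 n) (T.proj z)) : T.D z (T.horLift z u) = 0 :=
  T.coord_injective (T.mem_U _) ((T.coord_D_dTriv z (u, 0)).trans (map_zero _).symm)

theorem D_j (z : Z) (v : T.V (T.proj z)) : T.D z (T.j z v) = v :=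
  T.coord_injective (T.mem_U _) (T.coord_D_dTriv z (0, _))

theorem F_Finv (z : Z) (a : Dbl (T.VT (T.proj z))) : T.F z (T.Finv z a) = a := by
  refine Prod.ext (Prod.ext ?_ ?_) ?_
  · change T.D z (T.j z a.1.1 + T.horLift z a.1.2) = a.1.1
    rw [map_add, T.D_j, T.D_horLift, add_zero]
  · change T.dproj z (T.j z a.1.1 + T.horLift z a.1.2) = a.1.2
    rw [map_add, T.dproj_j, T.dproj_horLift, zero_add]
  · ext b
    · change a.2 (T.D z (T.j z b + T.horLift z 0), T.dproj z (T.j z b + T.horLift z 0)) = a.2 (b, 0)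
      rw [map_zero, add_zero, T.D_j, T.dproj_j]
    · change a.2 (T.D z (T.j z 0 + T.horLift z b), T.dproj z (T.j z 0 + T.horLift z b)) = a.2 (0, b)
      rw [map_zero, zero_add, T.D_horLift, T.dproj_horLift]

theorem coord_D_dφ {c : M} {z : Z} (hz : T.proj z ∈ T.U c) {ξ : Rn n}
    (h : T.φ c (T.proj z, ξ) = z) (w : EuclideanSpace ℝ (Fin n) × Rn n) :
    T.coord c (T.proj z) (T.D z (T.dφ c (T.proj z) ξ w)) = w.2 := by
  let u : TangentSpace (𝓡 n) (T.proj z) := w.1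
  let v := (T.coordEquiv c (T.proj z) hz).symm w.2
  have hsplit : T.dφ c (T.proj z) ξ w = T.j z v + T.horLift z u := by
    rw [T.horLift_eq_dφ hz h, T.j_eq_dφ hz h, T.coord_coordEquiv_symm]
    refine Eq.trans ?_ (map_add (T.dφ c (T.proj z) ξ) (0, w.2) (w.1, 0))
    simp
  rw [hsplit, map_add, T.D_j, T.D_horLift, add_zero, T.coord_coordEquiv_symm]

end TorusBundle

/-! ### Smooth sections in local coordinates -/

theorem tangentBundle_mk_congr {E : Type*} [NormedAddCommGroup E] [NormedSpace ℝ E] {N : Type*}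
    [TopologicalSpace N] [ChartedSpace E N] {x y : N} (h : x = y) (u : E) :
    (⟨x, u⟩ : TangentBundle 𝓘(ℝ, E) N) = ⟨y, u⟩ := by
  subst h
  rfl

theorem smoothVF_zero {E : Type*} [NormedAddCommGroup E] [NormedSpace ℝ E] {N : Type*}
    [TopologicalSpace N] [ChartedSpace E N] [IsManifold 𝓘(ℝ, E) ∞ N] (U : Set N) :
    SmoothVF U (fun x => (0 : TangentSpace 𝓘(ℝ, E) x)) :=
  (Bundle.contMDiff_zeroSection ℝ (TangentSpace 𝓘(ℝ, E) (M := N))).contMDiffOn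

theorem smoothDual_zero {E : Type*} [NormedAddCommGroup E] [NormedSpace ℝ E] {N : Type*}
    [TopologicalSpace N] [ChartedSpace E N] {W : N → Type*} [∀ x, AddCommGroup (W x)]
    [∀ x, Module ℝ (W x)] [∀ x, TopologicalSpace (W x)] (S : Set N → (∀ x, W x) → Prop)
    (U : Set N) : SmoothDual E S U (fun x => (0 : W x →L[ℝ] ℝ)) :=
  fun _ _ _ _ _ => contMDiffOn_const

namespace TorusBundle

variable {n : ℕ} {M : Type*} [TopologicalSpace M] [ChartedSpace (EuclideanSpace ℝ (Fin n)) M]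
  {EZ : Type*} [NormedAddCommGroup EZ] [NormedSpace ℝ EZ]
  {Z : Type*} [TopologicalSpace Z] [ChartedSpace EZ Z]
  (T : TorusBundle n M EZ Z)

/-- The `k`-th vector of the local frame of `V` given by the local trivialization `φ c`. -/
def frame (c : M) (k : Fin n) (m : M) : T.V m := (T.coord c m).inverse (Pi.single k 1)

theorem frame_eq_symm {c m : M} (hm : m ∈ T.U c) (k : Fin n) :
    T.frame c k m = (T.coordEquiv c m hm).symm (Pi.single k 1) := by
  rw [frame, T.coord_inverse hm]
  rfl

theorem coord_frame {c m : M} (hm : m ∈ T.U c) (k : Fin n) :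
    T.coord c m (T.frame c k m) = Pi.single k 1 := by
  rw [T.frame_eq_symm hm, T.coord_coordEquiv_symm]

theorem exists_basis_eq_frame {c m : M} (hm : m ∈ T.U c) :
    ∃ b : Module.Basis (Fin n) ℝ (T.V m), ∀ k, b k = T.frame c k m :=
  ⟨(Pi.basisFun ℝ (Fin n)).map (T.coordEquiv c m hm).symm.toLinearEquiv, fun k => by
    simp [T.frame_eq_symm hm]⟩

theorem coordDual_apply (c m : M) (α : T.V m →L[ℝ] ℝ) (k : Fin n) :
    T.coordDual c m α k = α (T.frame c k m) := rfl

theorem apply_eq_dotProduct {c m : M} (hm : m ∈ T.U c) (α : T.V m →L[ℝ] ℝ) (v : T.V m) :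
    α v = T.coordDual c m α ⬝ᵥ T.coord c m v := by
  have hv : v = ∑ k, T.coord c m v k • T.frame c k m := by
    apply T.coord_injective hm
    simp only [map_sum, map_smul, T.coord_frame hm]
    exact pi_eq_sum_univ' _
  conv_lhs => rw [hv]
  simp only [map_sum, map_smul, smul_eq_mul, dotProduct, coordDual_apply]
  exact Finset.sum_congr rfl fun k _ => mul_comm _ _

/-- Smoothness at `m` of a section of `V`, in the coordinates given by the local trivialization
around `m`. -/
def SmoothVAt (σ : ∀ m, T.V m) (m : M) : Prop :=
  ContMDiffAt (𝓡 n) 𝓘(ℝ, Rn n) ∞ (fun m' => T.coord m m' (σ m')) m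

/-- Smoothness at `m` of a section of `V^∨`, in the coordinates given by the local trivialization
around `m`. -/
def SmoothVDualAt (α : ∀ m, T.V m →L[ℝ] ℝ) (m : M) : Prop :=
  ContMDiffAt (𝓡 n) 𝓘(ℝ, Rn n) ∞ (fun m' => T.coordDual m m' (α m')) m

variable {T} in
theorem smoothVAt_iff {c m : M} (hm : m ∈ T.U c) {σ : ∀ m, T.V m} :
    T.SmoothVAt σ m ↔ ContMDiffAt (𝓡 n) 𝓘(ℝ, Rn n) ∞ (fun m' => T.coord c m' (σ m')) m := by
  have change_coord : ∀ {c c' : M}, m ∈ T.U c → m ∈ T.U c' →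
      ContMDiffAt (𝓡 n) 𝓘(ℝ, Rn n) ∞ (fun m' => T.coord c' m' (σ m')) m →
      ContMDiffAt (𝓡 n) 𝓘(ℝ, Rn n) ∞ (fun m' => T.coord c m' (σ m')) m := by
    intro c c' hc hc' h
    obtain ⟨A, hA⟩ := T.exists_eventually_coord_eq hc hc'
    exact ((intActL A).contMDiff.contMDiffAt.comp m h).congr_of_eventuallyEq
      (hA.mono fun m' h => h (σ m'))
  exact ⟨change_coord hm (T.mem_U m), change_coord (T.mem_U m) hm⟩

theorem smoothVAt_frame {c m : M} (hm : m ∈ T.U c) (k : Fin n) : T.SmoothVAt (T.frame c k) m := by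
  refine (smoothVAt_iff hm).2
    ((contMDiffAt_const (c := (Pi.single k 1 : Rn n))).congr_of_eventuallyEq ?_)
  filter_upwards [(T.isOpen_U c).mem_nhds hm] with m' h using T.coord_frame h k

theorem smoothVAt_zero (m : M) : T.SmoothVAt 0 m :=
  contMDiffAt_const.congr_of_eventuallyEq (.of_forall fun _ => map_zero _)

theorem smoothVDualAt_zero (m : M) : T.SmoothVDualAt 0 m :=
  (contMDiffAt_const (c := (0 : Rn n))).congr_of_eventuallyEq (.of_forall fun _ => rfl)

variable {T} in
theorem SmoothVAt.neg {σ : ∀ m, T.V m} {m : M} (h : T.SmoothVAt σ m) :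
    T.SmoothVAt (fun m => -σ m) m :=
  (ContMDiffAt.neg h).congr_of_eventuallyEq (.of_forall fun _ => map_neg _ _)

variable {T} in
theorem SmoothVDualAt.neg {α : ∀ m, T.V m →L[ℝ] ℝ} {m : M} (h : T.SmoothVDualAt α m) :
    T.SmoothVDualAt (fun m => -α m) m :=
  (ContMDiffAt.neg h).congr_of_eventuallyEq (.of_forall fun _ => rfl)

variable {T} in
theorem SmoothVAt.apply {α : ∀ m, T.V m →L[ℝ] ℝ} {σ : ∀ m, T.V m} {m : M} (hσ : T.SmoothVAt σ m)
    (hα : T.SmoothVDualAt α m) : ContMDiffAt (𝓡 n) 𝓘(ℝ, ℝ) ∞ (fun m => α m (σ m)) m := by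
  have hdot : ContMDiffAt (𝓡 n) 𝓘(ℝ, ℝ) ∞
      (fun m' => T.coordDual m m' (α m') ⬝ᵥ T.coord m m' (σ m')) m :=
    contMDiffAt_finsetSum fun k _ =>
      (contMDiffAt_pi_space.1 hα k).mul (contMDiffAt_pi_space.1 hσ k)
  refine hdot.congr_of_eventuallyEq ?_
  filter_upwards [(T.isOpen_U m).mem_nhds (T.mem_U m)] with m' hm'
    using T.apply_eq_dotProduct hm' _ _

variable [IsManifold (𝓡 n) ∞ M] [IsManifold 𝓘(ℝ, EZ) ∞ Z]

theorem contMDiffAt_dφ {EP HP P : Type*} [NormedAddCommGroup EP] [NormedSpace ℝ EP]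
    [TopologicalSpace HP] {IP : ModelWithCorners ℝ EP HP} [TopologicalSpace P] [ChartedSpace HP P]
    {c : M} {g : P → M} {q : P → Rn n} {X : ∀ p, TangentSpace (𝓡 n) (g p)} {η : P → Rn n} {p₀ : P}
    (hc : g p₀ ∈ T.U c)
    (hX : ContMDiffAt IP (𝓡 n).tangent ∞ (fun p => (⟨g p, X p⟩ : TangentBundle (𝓡 n) M)) p₀)
    (hq : ContMDiffAt IP 𝓘(ℝ, Rn n) ∞ q p₀) (hη : ContMDiffAt IP 𝓘(ℝ, Rn n) ∞ η p₀) :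
    ContMDiffAt IP 𝓘(ℝ, EZ).tangent ∞
      (fun p => (⟨T.φ c (g p, q p), T.dφ c (g p) (q p) (X p, η p)⟩ : TangentBundle 𝓘(ℝ, EZ) Z))
      p₀ := by
  have hqη : ContMDiffAt IP 𝓘(ℝ, Rn n).tangent ∞
      (fun p => (⟨q p, η p⟩ : TangentBundle 𝓘(ℝ, Rn n) (Rn n))) p₀ :=
    contMDiffAt_vectorSpace_along.2 ⟨hq, hη⟩
  have hpair : ContMDiffAt IP ((𝓡 n).prod 𝓘(ℝ, Rn n)).tangent ∞
      (fun p => (⟨(g p, q p), (X p, η p)⟩ : TangentBundle ((𝓡 n).prod 𝓘(ℝ, Rn n)) (M × Rn n)))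
      p₀ :=
    (contMDiff_equivTangentBundleProd_symm (I := 𝓡 n) (I' := 𝓘(ℝ, Rn n)) (M := M) (M' := Rn n)
      (n := ∞)).contMDiffAt.comp p₀ (hX.prodMk hqη)
  exact contMDiffAt_mfderiv_along (T.contMDiffAt_φ hc _) hpair le_rfl

theorem contMDiffAt_coe_iff {σ : ∀ m, T.V m} {m : M} :
    ContMDiffAt (𝓡 n) 𝓘(ℝ, EZ).tangent ∞ (fun m => (⟨T.zero m, (σ m : TangentSpace 𝓘(ℝ, EZ) _)⟩ :
      TangentBundle 𝓘(ℝ, EZ) Z)) m ↔ T.SmoothVAt σ m := by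
  have hU : ∀ᶠ m' in 𝓝 m, m' ∈ T.U m := (T.isOpen_U m).mem_nhds (T.mem_U m)
  constructor
  · intro h
    obtain ⟨τ, hτ⟩ := T.exists_isFibreCoordAt (T.mem_U m) 0
    have hτ₀ := hτ.contMDiffAt
    rw [T.φ_zero m m (T.mem_U m)] at hτ₀
    refine (contMDiffAt_mvfderiv_along hτ₀ h le_rfl).congr_of_eventuallyEq ?_
    have hpair : ContinuousAt (fun m' : M => ((m', 0) : M × Rn n)) m := by fun_prop
    filter_upwards [hpair.eventually (hτ.eventually_mvfderiv_dφ (T.mem_U m)), hU] with m' hm' hm'U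
    have hcoord := hm' (0, T.coord m m' (σ m'))
    rw [← T.coe_eq_dφ_coord hm'U (σ m'), T.φ_zero m m' hm'U] at hcoord
    exact hcoord.symm
  · intro h
    have hzero : ContMDiffAt (𝓡 n) (𝓡 n).tangent ∞ (fun m => (⟨m, 0⟩ : TangentBundle (𝓡 n) M)) m :=
      (Bundle.contMDiff_zeroSection ℝ (TangentSpace (𝓡 n) (M := M))).contMDiffAt
    refine (T.contMDiffAt_dφ (T.mem_U m) hzero (q := fun _ => 0) contMDiffAt_const
      h).congr_of_eventuallyEq ?_
    filter_upwards [hU] with m' hm'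
    rw [T.coe_eq_dφ_coord hm' (σ m')]
    exact tangentBundle_mk_congr (T.φ_zero m m' hm').symm _

theorem smoothVT_iff {U : Set M} (hU : IsOpen U) {σ : ∀ m, T.VT m} :
    T.SmoothVT U σ ↔
      (∀ m ∈ U, T.SmoothVAt (fun m => (σ m).1) m) ∧ SmoothVF U (fun m => (σ m).2) :=
  and_congr_left fun _ =>
    ⟨fun h m hm => T.contMDiffAt_coe_iff.1 ((h m hm).contMDiffAt (hU.mem_nhds hm)),
      fun h m hm => (T.contMDiffAt_coe_iff.2 (h m hm)).contMDiffWithinAt⟩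

theorem smoothVT_inr {U : Set M} (hU : IsOpen U) {X : ∀ m : M, TangentSpace (𝓡 n) m}
    (hX : SmoothVF U X) : T.SmoothVT U (fun m => (0, X m)) :=
  (T.smoothVT_iff hU).2 ⟨fun m _ => T.smoothVAt_zero m, hX⟩

theorem smoothDbl_inclSnd {U : Set M} (hU : IsOpen U)
    {a : ∀ m : M, TT (EuclideanSpace ℝ (Fin n)) m} (ha : SmoothTT U a) :
    SmoothDbl (EuclideanSpace ℝ (Fin n)) T.SmoothVT U (fun m => inclSnd _ _ (a m)) :=
  ⟨T.smoothVT_inr hU ha.1, fun U' hU' hUU _ hw => ha.2 U' hU' hUU _ hw.2⟩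

theorem smoothDbl_iff {U : Set M} (hU : IsOpen U) {a : ∀ m, Dbl (T.VT m)} :
    SmoothDbl (EuclideanSpace ℝ (Fin n)) T.SmoothVT U a ↔
      (∀ m ∈ U, T.SmoothVAt (fun m => (projFst _ _ (a m)).1) m ∧
        T.SmoothVDualAt (fun m => (projFst _ _ (a m)).2) m) ∧
      SmoothTT U (fun m => projSnd _ _ (a m)) := by
  constructor
  · rintro ⟨hvec, hform⟩
    refine ⟨fun m hm => ⟨((T.smoothVT_iff hU).1 hvec).1 m hm, contMDiffAt_pi_space.2 fun k => ?_⟩,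
      hvec.2, fun U' hU' hUU w hw => hform U' hU' hUU _ (T.smoothVT_inr hU' hw)⟩
    have hUm : IsOpen (U ∩ T.U m) := hU.inter (T.isOpen_U m)
    exact (hform _ hUm inter_subset_left (fun m' => (T.frame m k m', 0)) ((T.smoothVT_iff hUm).2
      ⟨fun m' hm' => T.smoothVAt_frame hm'.2 k, smoothVF_zero _⟩)).contMDiffAt
        (hUm.mem_nhds ⟨hm, T.mem_U m⟩)
  · rintro ⟨hV, hvec, hform⟩
    refine ⟨(T.smoothVT_iff hU).2 ⟨fun m hm => (hV m hm).1, hvec⟩, fun U' hU' hUU w hw m hm => ?_⟩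
    have hw' := (T.smoothVT_iff hU').1 hw
    have hadd := ((hw'.1 m hm).apply (hV m (hUU hm)).2).add
      ((hform U' hU' hUU _ hw'.2).contMDiffAt (hU'.mem_nhds hm))
    refine (hadd.congr_of_eventuallyEq (.of_forall fun m' => ?_)).contMDiffWithinAt
    change (a m').2 (w m') = (a m').2 ((w m').1, 0) + (a m').2 (0, (w m').2)
    rw [← map_add]
    simp

theorem smoothDbl_inclFst {U : Set M} (hU : IsOpen U) {x : ∀ m, Dbl (T.V m)}
    (hx : ∀ m ∈ U, T.SmoothVAt (fun m => (x m).1) m ∧ T.SmoothVDualAt (fun m => (x m).2) m) :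
    SmoothDbl (EuclideanSpace ℝ (Fin n)) T.SmoothVT U
      (fun m => inclFst _ (TangentSpace (𝓡 n) m) (x m)) := by
  refine (T.smoothDbl_iff hU).2 ⟨hx, smoothVF_zero _, ?_⟩
  have hform : (fun m => (projSnd (T.V m) _ (inclFst _ (TangentSpace (𝓡 n) m) (x m))).2) =
      fun m => 0 := by
    funext m
    ext
    exact map_zero (x m).2
  rw [hform]
  exact smoothDual_zero _ _

/-! ### The connection on `V` -/

omit [IsManifold (𝓡 n) ∞ M] [IsManifold 𝓘(ℝ, EZ) ∞ Z]

variable {T} {σ σ' : ∀ m, T.V m} {m : M}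

theorem coord_nabla_self (σ : ∀ m, T.V m) (m : M) (u : TangentSpace (𝓡 n) m) :
    T.coord m m (T.nabla σ m u) = mvfderiv (𝓡 n) (fun m' => T.coord m m' (σ m')) m u :=
  T.coord_coordEquiv_symm (T.mem_U m) _

theorem coord_nabla {c : M} (hm : m ∈ T.U c)
    (hσ : MDifferentiableAt (𝓡 n) 𝓘(ℝ, Rn n) (fun m' => T.coord c m' (σ m')) m)
    (u : TangentSpace (𝓡 n) m) :
    T.coord c m (T.nabla σ m u) = mvfderiv (𝓡 n) (fun m' => T.coord c m' (σ m')) m u := by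
  obtain ⟨A, hA⟩ := T.exists_eventually_coord_eq (T.mem_U m) hm
  let η := mvfderiv (𝓡 n) (fun m' => T.coord c m' (σ m')) m u
  have hderiv : mvfderiv (𝓡 n) (fun m' => T.coord m m' (σ m')) m u = intActL A η :=
    DFunLike.congr_fun ((((intActL A).hasMFDerivAt.comp m hσ.hasMFDerivAt).congr_of_eventuallyEq
      (hA.mono fun m' h => h (σ m'))).mfderiv) u
  have hη : T.coord m m ((T.coordEquiv c m hm).symm η) = intActL A η := by
    rw [hA.self_of_nhds, T.coord_coordEquiv_symm]
  rw [T.coord_injective (T.mem_U m) ((coord_nabla_self σ m u).trans (hderiv.trans hη.symm)),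
    T.coord_coordEquiv_symm]

theorem nabla_congr (h : ∀ᶠ m' in 𝓝 m, σ m' = σ' m') (u : TangentSpace (𝓡 n) m) :
    T.nabla σ m u = T.nabla σ' m u := by
  have hcoord : (fun m' => T.coord m m' (σ m')) =ᶠ[𝓝 m] fun m' => T.coord m m' (σ' m') :=
    h.mono fun m' h => congrArg (T.coord m m') h
  apply T.coord_injective (T.mem_U m)
  rw [coord_nabla_self, coord_nabla_self, mvfderiv, mvfderiv, hcoord.mfderiv_eq]
  rfl

theorem nabla_smul_add_smul (σ : ∀ m, T.V m) (m : M) (s t : ℝ) (u v : TangentSpace (𝓡 n) m) :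
    T.nabla σ m (s • u + t • v) = s • T.nabla σ m u + t • T.nabla σ m v := by
  apply T.coord_injective (T.mem_U m)
  simp only [map_add, map_smul, coord_nabla_self]

theorem SmoothVAt.mdifferentiableAt (hσ : T.SmoothVAt σ m) :
    MDifferentiableAt (𝓡 n) 𝓘(ℝ, Rn n) (fun m' => T.coord m m' (σ m')) m :=
  ContMDiffAt.mdifferentiableAt hσ (by simp)

theorem nabla_add (hσ : T.SmoothVAt σ m) (hσ' : T.SmoothVAt σ' m) (u : TangentSpace (𝓡 n) m) :
    T.nabla (fun m => σ m + σ' m) m u = T.nabla σ m u + T.nabla σ' m u := by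
  apply T.coord_injective (T.mem_U m)
  simp only [map_add, coord_nabla_self]
  exact DFunLike.congr_fun (mvfderiv_fun_add hσ.mdifferentiableAt hσ'.mdifferentiableAt) u

theorem nabla_smul {f : M → ℝ} (hf : MDifferentiableAt (𝓡 n) 𝓘(ℝ, ℝ) f m) (hσ : T.SmoothVAt σ m)
    (u : TangentSpace (𝓡 n) m) :
    T.nabla (fun m => f m • σ m) m u = mvfderiv (𝓡 n) f m u • σ m + f m • T.nabla σ m u := by
  apply T.coord_injective (T.mem_U m)
  simp only [map_add, map_smul, coord_nabla_self]
  rw [mvfderiv_fun_smul hf hσ.mdifferentiableAt, add_comm]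
  rfl

variable [IsManifold (𝓡 n) ∞ M] {X Y : ∀ m : M, TangentSpace (𝓡 n) m}

theorem SmoothVAt.eventually_coord_nabla (hσ : T.SmoothVAt σ m) :
    ∀ᶠ m' in 𝓝 m, ∀ u, T.coord m m' (T.nabla σ m' u) =
      mvfderiv (𝓡 n) (fun m' => T.coord m m' (σ m')) m' u := by
  filter_upwards [(T.isOpen_U m).mem_nhds (T.mem_U m),
    eventually_mdifferentiableAt (ContMDiffAt.of_le hσ (by simp))] with m' hm' hdiff u
    using coord_nabla hm' hdiff u

theorem SmoothVAt.nabla (hσ : T.SmoothVAt σ m) (hX : ContMDiffAt (𝓡 n) (𝓡 n).tangent ∞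
    (fun m => (⟨m, X m⟩ : TangentBundle (𝓡 n) M)) m) :
    T.SmoothVAt (fun m => T.nabla σ m (X m)) m :=
  (contMDiffAt_mvfderiv_along (g := fun m : M => m) hσ hX le_rfl).congr_of_eventuallyEq
    (hσ.eventually_coord_nabla.mono fun m' h => h (X m'))

theorem nabla_nabla_sub_nabla_nabla (hσ : T.SmoothVAt σ m)
    (hX : ContMDiffAt (𝓡 n) (𝓡 n).tangent ∞ (fun m => (⟨m, X m⟩ : TangentBundle (𝓡 n) M)) m)
    (hY : ContMDiffAt (𝓡 n) (𝓡 n).tangent ∞ (fun m => (⟨m, Y m⟩ : TangentBundle (𝓡 n) M)) m) :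
    T.nabla (fun m => T.nabla σ m (Y m)) m (X m) - T.nabla (fun m => T.nabla σ m (X m)) m (Y m) =
      T.nabla σ m (VectorField.mlieBracket (𝓡 n) X Y m) := by
  have second : ∀ (W : ∀ m : M, TangentSpace (𝓡 n) m) (u : TangentSpace (𝓡 n) m),
      T.coord m m (T.nabla (fun m => T.nabla σ m (W m)) m u) =
        mvfderiv (𝓡 n)
          (fun m' => mvfderiv (𝓡 n) (fun m' => T.coord m m' (σ m')) m' (W m')) m u := by
    intro W u
    have hcoord : (fun m' => T.coord m m' (T.nabla σ m' (W m'))) =ᶠ[𝓝 m]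
        fun m' => mvfderiv (𝓡 n) (fun m' => T.coord m m' (σ m')) m' (W m') :=
      hσ.eventually_coord_nabla.mono fun m' h => h (W m')
    rw [coord_nabla_self, mvfderiv, hcoord.mfderiv_eq]
    rfl
  apply T.coord_injective (T.mem_U m)
  rw [map_sub, second, second, coord_nabla_self]
  exact (mvfderiv_mlieBracket hσ hX hY).symm

end TorusBundle

/-! ### The isometry `V ⊕ V^∨ ≅ T_M ⊕ T_M^∨` -/

section Dbl

variable {A B : Type*} [AddCommGroup A] [Module ℝ A] [TopologicalSpace A]
  [AddCommGroup B] [Module ℝ B] [TopologicalSpace B]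

theorem projFst_inclFst (a : Dbl A) : projFst A B (inclFst A B a) = a :=
  Prod.ext rfl (by ext; rfl)

theorem projSnd_inclSnd (b : Dbl B) : projSnd A B (inclSnd A B b) = b :=
  Prod.ext rfl (by ext; rfl)

theorem inclSnd_injective : Function.Injective (inclSnd A B) :=
  Function.LeftInverse.injective projSnd_inclSnd

theorem pairing_inclFst (a b : Dbl A) : pairing (inclFst A B a) (inclFst A B b) = pairing a b :=
  rfl

theorem pairing_inclSnd (a b : Dbl B) : pairing (inclSnd A B a) (inclSnd A B b) = pairing a b :=
  rfl

end Dbl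

namespace TorusBundle

variable {n : ℕ} {M : Type*} [TopologicalSpace M] [ChartedSpace (EuclideanSpace ℝ (Fin n)) M]
  {EZ : Type*} [NormedAddCommGroup EZ] [NormedSpace ℝ EZ]
  {Z : Type*} [TopologicalSpace Z] [ChartedSpace EZ Z]
  (T : TorusBundle n M EZ Z) (Jb : ∀ m, Dbl (T.VT m) →ₗ[ℝ] Dbl (T.VT m))

/-- The map `V ⊕ V^∨ → T_M ⊕ T_M^∨` given by `J̲`. -/
def toTM (m : M) : Dbl (T.V m) →ₗ[ℝ] TT (EuclideanSpace ℝ (Fin n)) m :=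
  projSnd (T.V m) (TangentSpace (𝓡 n) m) ∘ₗ Jb m ∘ₗ inclFst _ _

/-- The map `T_M ⊕ T_M^∨ → V ⊕ V^∨` given by `-J̲`. -/
def ofTM (m : M) : TT (EuclideanSpace ℝ (Fin n)) m →ₗ[ℝ] Dbl (T.V m) :=
  projFst (T.V m) (TangentSpace (𝓡 n) m) ∘ₗ (-Jb m) ∘ₗ inclSnd _ _

/-- The map `J̲ : V → Δ`, with values in `T_M ⊕ T_M^∨`. -/
def toDelta (m : M) : T.V m →ₗ[ℝ] TT (EuclideanSpace ℝ (Fin n)) m :=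
  T.toTM Jb m ∘ₗ LinearMap.inl ℝ (T.V m) (T.V m →L[ℝ] ℝ)

/-- The inverse `-J̲ : Δ → V` of `toDelta`, extended to `T_M ⊕ T_M^∨` by zero on `Δ^`. -/
def ofDelta (m : M) : TT (EuclideanSpace ℝ (Fin n)) m →ₗ[ℝ] T.V m :=
  LinearMap.fst ℝ (T.V m) (T.V m →L[ℝ] ℝ) ∘ₗ T.ofTM Jb m

theorem connDelta_eq (a : ∀ m : M, TT (EuclideanSpace ℝ (Fin n)) m) (m : M)
    (u : TangentSpace (𝓡 n) m) : T.connDelta Jb a m u =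
      T.toDelta Jb m (T.nabla (fun m' => T.ofDelta Jb m' (a m')) m u) := rfl

namespace IsSemiFlat

variable [IsManifold (𝓡 n) ∞ M] [IsManifold 𝓘(ℝ, EZ) ∞ Z] {T Jb}
  {J : ∀ z : Z, TT EZ z →ₗ[ℝ] TT EZ z} (hJ : T.IsSemiFlat J Jb)

include hJ

theorem map_inclFst (m : M) (x : Dbl (T.V m)) :
    Jb m (inclFst _ _ x) = inclSnd _ _ (T.toTM Jb m x) := by
  have hmem : Jb m (inclFst _ _ x) ∈
      LinearMap.range (inclSnd (T.V m) (TangentSpace (𝓡 n) m)) := by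
    rw [← hJ.adapted m]
    exact ⟨_, ⟨x, rfl⟩, rfl⟩
  obtain ⟨b, hb⟩ := hmem
  have hx : T.toTM Jb m x = projSnd _ _ (Jb m (inclFst _ _ x)) := rfl
  rw [hx, ← hb, projSnd_inclSnd]

theorem map_inclSnd (m : M) (a : TT (EuclideanSpace ℝ (Fin n)) m) :
    Jb m (inclSnd _ _ a) = -inclFst _ _ (T.ofTM Jb m a) := by
  have hmem : inclSnd _ _ a ∈ (LinearMap.range (inclFst (T.V m) (TangentSpace (𝓡 n) m))).map
      (Jb m) := by
    rw [hJ.adapted m]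
    exact ⟨a, rfl⟩
  obtain ⟨_, ⟨x, rfl⟩, hx⟩ := hmem
  have ha : Jb m (inclSnd _ _ a) = -inclFst _ _ x := by
    rw [← hx, hJ.genAlmostComplex.sq]
  have hofTM : T.ofTM Jb m a = projFst _ _ (-Jb m (inclSnd _ _ a)) := rfl
  rw [hofTM, ha, neg_neg, projFst_inclFst]

theorem ofTM_toTM (m : M) (x : Dbl (T.V m)) : T.ofTM Jb m (T.toTM Jb m x) = x := by
  change projFst _ _ (-(Jb m (inclSnd _ _ (T.toTM Jb m x)))) = x
  rw [← hJ.map_inclFst, hJ.genAlmostComplex.sq, neg_neg, projFst_inclFst]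

theorem toTM_ofTM (m : M) (a : TT (EuclideanSpace ℝ (Fin n)) m) :
    T.toTM Jb m (T.ofTM Jb m a) = a := by
  apply inclSnd_injective (A := T.V m)
  rw [← hJ.map_inclFst, ← neg_inj, ← map_neg, ← hJ.map_inclSnd, hJ.genAlmostComplex.sq]

theorem pairing_toTM (m : M) (x y : Dbl (T.V m)) :
    pairing (T.toTM Jb m x) (T.toTM Jb m y) = pairing x y := by
  rw [← pairing_inclSnd (A := T.V m), ← hJ.map_inclFst, ← hJ.map_inclFst,
    hJ.genAlmostComplex.orth, pairing_inclFst]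

theorem pairing_ofTM (m : M) (a b : TT (EuclideanSpace ℝ (Fin n)) m) :
    pairing (T.ofTM Jb m a) (T.ofTM Jb m b) = pairing a b := by
  rw [← hJ.pairing_toTM, hJ.toTM_ofTM, hJ.toTM_ofTM]

theorem map_inclFst_eq_inclSnd_iff {m : M} {x : Dbl (T.V m)}
    {a : TT (EuclideanSpace ℝ (Fin n)) m} :
    Jb m (inclFst _ _ x) = inclSnd _ _ a ↔ T.ofTM Jb m a = x := by
  rw [hJ.map_inclFst, inclSnd_injective.eq_iff]
  constructor
  · rintro rfl
    exact hJ.ofTM_toTM m x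
  · rintro rfl
    exact hJ.toTM_ofTM m a

theorem mem_Delta_iff {m : M} {a : TT (EuclideanSpace ℝ (Fin n)) m} :
    a ∈ T.Delta Jb m ↔ (T.ofTM Jb m a).2 = 0 := by
  constructor
  · rintro ⟨_, ⟨v, rfl⟩, hv⟩
    rw [hJ.map_inclFst_eq_inclSnd_iff.1 hv]
    rfl
  · exact fun h => ⟨_, ⟨(T.ofTM Jb m a).1, rfl⟩,
      hJ.map_inclFst_eq_inclSnd_iff.2 (Prod.ext rfl h)⟩

theorem mem_DeltaHat_iff {m : M} {a : TT (EuclideanSpace ℝ (Fin n)) m} :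
    a ∈ T.DeltaHat Jb m ↔ (T.ofTM Jb m a).1 = 0 := by
  constructor
  · rintro ⟨_, ⟨α, rfl⟩, hα⟩
    rw [hJ.map_inclFst_eq_inclSnd_iff.1 hα]
    rfl
  · exact fun h => ⟨_, ⟨(T.ofTM Jb m a).2, rfl⟩,
      hJ.map_inclFst_eq_inclSnd_iff.2 (Prod.ext h rfl)⟩

theorem toDelta_mem_Delta (m : M) (v : T.V m) : T.toDelta Jb m v ∈ T.Delta Jb m := by
  rw [hJ.mem_Delta_iff, toDelta, LinearMap.comp_apply, hJ.ofTM_toTM]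
  rfl

theorem ofDelta_toDelta (m : M) (v : T.V m) : T.ofDelta Jb m (T.toDelta Jb m v) = v :=
  congrArg Prod.fst (hJ.ofTM_toTM m (v, 0))

theorem toDelta_ofDelta {m : M} {a : TT (EuclideanSpace ℝ (Fin n)) m}
    (ha : a ∈ T.Delta Jb m) : T.toDelta Jb m (T.ofDelta Jb m a) = a := by
  have hofTM : LinearMap.inl ℝ _ _ (T.ofDelta Jb m a) = T.ofTM Jb m a :=
    Prod.ext rfl (hJ.mem_Delta_iff.1 ha).symm
  rw [toDelta, LinearMap.comp_apply, hofTM, hJ.toTM_ofTM]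

theorem range_toDelta (m : M) : LinearMap.range (T.toDelta Jb m) = T.Delta Jb m :=
  le_antisymm (LinearMap.range_le_iff_comap.2 (Submodule.eq_top_iff'.2 (hJ.toDelta_mem_Delta m)))
    fun _ ha => ⟨_, hJ.toDelta_ofDelta ha⟩

theorem smoothTT_toDelta {U : Set M} (hU : IsOpen U) {σ : ∀ m, T.V m}
    (hσ : ∀ m ∈ U, T.SmoothVAt σ m) : SmoothTT U (fun m => T.toDelta Jb m (σ m)) :=
  ((T.smoothDbl_iff hU).1 (hJ.genAlmostComplex.smooth U hU _
    (T.smoothDbl_inclFst hU fun m hm => ⟨hσ m hm, T.smoothVDualAt_zero m⟩))).2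

theorem smoothAt_ofTM {U : Set M} (hU : IsOpen U)
    {a : ∀ m : M, TT (EuclideanSpace ℝ (Fin n)) m} (ha : SmoothTT U a) {m : M} (hm : m ∈ U) :
    T.SmoothVAt (fun m => (T.ofTM Jb m (a m)).1) m ∧
      T.SmoothVDualAt (fun m => (T.ofTM Jb m (a m)).2) m := by
  obtain ⟨hvec, hform⟩ := ((T.smoothDbl_iff hU).1
    (hJ.genAlmostComplex.smooth U hU _ (T.smoothDbl_inclSnd hU ha))).1 m hm
  simp only [hJ.map_inclSnd, map_neg, projFst_inclFst] at hvec hform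
  have hneg := And.intro hvec.neg hform.neg
  simpa only [Prod.fst_neg, Prod.snd_neg, neg_neg] using hneg

theorem smoothVAt_ofDelta {U : Set M} (hU : IsOpen U)
    {a : ∀ m : M, TT (EuclideanSpace ℝ (Fin n)) m} (ha : SmoothTT U a) {m : M} (hm : m ∈ U) :
    T.SmoothVAt (fun m => T.ofDelta Jb m (a m)) m :=
  (hJ.smoothAt_ofTM hU ha hm).1

/-! ### `Δ` is an almost Dirac structure with a flat connection -/

theorem linearIndependent_toDelta_frame {c m : M} (hm : m ∈ T.U c) :
    LinearIndependent ℝ (fun k => T.toDelta Jb m (T.frame c k m)) := by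
  obtain ⟨b, hb⟩ := T.exists_basis_eq_frame hm
  simp only [← hb]
  exact b.linearIndependent.map' _ (LinearMap.ker_eq_bot.2
    (Function.LeftInverse.injective (hJ.ofDelta_toDelta m)))

theorem span_toDelta_frame {c m : M} (hm : m ∈ T.U c) :
    Submodule.span ℝ (range fun k => T.toDelta Jb m (T.frame c k m)) = T.Delta Jb m := by
  obtain ⟨b, hb⟩ := T.exists_basis_eq_frame hm
  simp only [← hb]
  rw [← hJ.range_toDelta, range_comp' (T.toDelta Jb m) b, ← Submodule.map_span, b.span_eq,
    Submodule.map_top]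

theorem isAlmostDirac_Delta : IsAlmostDirac (T.Delta Jb) where
  isotropic m a ha b hb := by
    rw [← hJ.pairing_ofTM, pairing, hJ.mem_Delta_iff.1 ha, hJ.mem_Delta_iff.1 hb]
    simp
  maximal m K hK hle := by
    refine le_antisymm (fun a ha => hJ.mem_Delta_iff.2 ?_) hle
    ext v
    have hpair := hK a ha _ (hle (hJ.toDelta_mem_Delta m v))
    rw [← hJ.pairing_ofTM, toDelta, LinearMap.comp_apply, hJ.ofTM_toTM] at hpair
    simpa [pairing] using hpair
  subbundle c :=
    ⟨T.U c, T.isOpen_U c, T.mem_U c, n, fun k m => T.toDelta Jb m (T.frame c k m),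
      fun k => hJ.smoothTT_toDelta (T.isOpen_U c) fun _ hm => T.smoothVAt_frame hm k,
      fun _ hm => ⟨hJ.linearIndependent_toDelta_frame hm, hJ.span_toDelta_frame hm⟩⟩

theorem isFlatConnection_Delta : IsFlatConnection (T.Delta Jb) (T.connDelta Jb) where
  congr U hU a b _ _ hab m hm u := by
    rw [connDelta_eq, connDelta_eq, nabla_congr _ u]
    filter_upwards [hU.mem_nhds hm] with m' hm'
    rw [hab m' hm']
  isSection U hU a X ha hX :=
    ⟨hJ.smoothTT_toDelta hU fun m hm =>
      (hJ.smoothVAt_ofDelta hU ha.1 hm).nabla ((smoothVF_iff_contMDiffAt hU).1 hX m hm),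
      fun m _ => hJ.toDelta_mem_Delta m _⟩
  linear _ _ a _ m _ s t u v := by
    simp only [connDelta_eq, nabla_smul_add_smul, map_add, map_smul]
  add U hU a b ha hb m hm u := by
    simp only [connDelta_eq, map_add]
    rw [nabla_add (hJ.smoothVAt_ofDelta hU ha.1 hm) (hJ.smoothVAt_ofDelta hU hb.1 hm), map_add]
  leibniz U hU f a hf ha m hm u := by
    have hfm : MDifferentiableAt (𝓡 n) 𝓘(ℝ, ℝ) f m :=
      (hf.contMDiffAt (hU.mem_nhds hm)).mdifferentiableAt (by simp)
    simp only [connDelta_eq, map_smul]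
    rw [nabla_smul hfm (hJ.smoothVAt_ofDelta hU ha.1 hm), map_add, map_smul, map_smul,
      hJ.toDelta_ofDelta (ha.2 m hm)]
    rfl
  flat U hU a X Y ha hX hY m hm := by
    simp only [connDelta_eq, hJ.ofDelta_toDelta]
    rw [← map_sub, nabla_nabla_sub_nabla_nabla (hJ.smoothVAt_ofDelta hU ha.1 hm)
      ((smoothVF_iff_contMDiffAt hU).1 hX m hm) ((smoothVF_iff_contMDiffAt hU).1 hY m hm), sub_self]

end IsSemiFlat

end TorusBundle

/-! ### Torus bundles in duality -/

namespace TorusBundle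

theorem intAct_inv_transpose_dotProduct {n : ℕ} (A : Matrix.GeneralLinearGroup (Fin n) ℤ)
    (ξ η : Rn n) : intAct (A⁻¹).1.transpose ξ ⬝ᵥ intAct A.1 η = ξ ⬝ᵥ η := by
  have hinv : (A⁻¹).1.map (Int.cast : ℤ → ℝ) * A.1.map (Int.cast : ℤ → ℝ) = 1 := by
    have hmap : ((A⁻¹).1 * A.1).map (Int.castRingHom ℝ) = 1 := by
      rw [Units.inv_mul]
      exact Matrix.map_one _ (map_zero _) (map_one _)
    rwa [Matrix.map_mul] at hmap
  rw [intAct, intAct, Matrix.transpose_map, Matrix.mulVec_transpose, Matrix.dotProduct_mulVec,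
    Matrix.vecMul_vecMul, hinv, Matrix.vecMul_one]

section Duality

variable {n : ℕ} {M : Type*} [TopologicalSpace M] [ChartedSpace (EuclideanSpace ℝ (Fin n)) M]
  {EZ : Type*} [NormedAddCommGroup EZ] [NormedSpace ℝ EZ]
  {Z : Type*} [TopologicalSpace Z] [ChartedSpace EZ Z]
  {EZ' : Type*} [NormedAddCommGroup EZ'] [NormedSpace ℝ EZ']
  {Z' : Type*} [TopologicalSpace Z'] [ChartedSpace EZ' Z']
  (T : TorusBundle n M EZ Z) (T' : TorusBundle n M EZ' Z')

/-- The coordinates given by the local trivializations of the two bundles pair to a bilinear form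
that does not depend on the local trivialization, so that it identifies the bundle `V` of `T'` with
the dual of the bundle `V` of `T`. -/
def InDuality : Prop :=
  ∀ c c' m, m ∈ T.U c → m ∈ T'.U c → m ∈ T.U c' → m ∈ T'.U c' → ∀ v w,
    T.coord c m v ⬝ᵥ T'.coord c m w = T.coord c' m v ⬝ᵥ T'.coord c' m w

/-- The exchange of `V` and `V^∨` in `V ⊕ T_M ⊕ V^∨ ⊕ T_M^∨`, for the duality between the two
bundles that is given by the coordinates around `m`. -/
abbrev shuffleAt (m : M) : Dbl (T.VT m) →ₗ[ℝ] Dbl (T'.VT m) :=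
  shuffle (T.coordEquiv m m (T.mem_U m)) (T'.coordEquiv m m (T'.mem_U m))

/-- The restriction of `shuffleAt` to `V ⊕ V^∨`. -/
def swapAt (m : M) : Dbl (T.V m) →ₗ[ℝ] Dbl (T'.V m) :=
  projFst _ (TangentSpace (𝓡 n) m) ∘ₗ shuffleAt T T' m ∘ₗ inclFst _ _

variable {T T'}

theorem InDuality.symm (h : InDuality T T') : InDuality T' T := by
  intro c c' m hc' hc hd' hd v w
  rw [dotProduct_comm, h c c' m hc hc' hd hd', dotProduct_comm]

theorem coordDual_eq_of_forall {c m : M} (hm : m ∈ T.U c) {α : T.V m →L[ℝ] ℝ} {η : Rn n}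
    (h : ∀ v, α v = η ⬝ᵥ T.coord c m v) : T.coordDual c m α = η := by
  funext k
  rw [coordDual_apply, h, T.coord_frame hm, dotProduct_single_one]

theorem coordDual_injective {c m : M} (hm : m ∈ T.U c) :
    Function.Injective (T.coordDual c m) := by
  intro α β h
  ext v
  rw [T.apply_eq_dotProduct hm, h, ← T.apply_eq_dotProduct hm]

theorem dbl_apply {m : M} (a : Dbl (T.VT m)) (v : T.V m) (u : TangentSpace (𝓡 n) m) :
    a.2 (v, u) = (projFst _ _ a).2 v + (projSnd _ _ a).2 u := by
  change a.2 (v, u) = a.2 (v, 0) + a.2 (0, u)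
  rw [← map_add, Prod.mk_add_mk, add_zero, zero_add]

theorem dbl_ext {m : M} {a b : Dbl (T.VT m)} (hV : projFst _ _ a = projFst _ _ b)
    (hTM : projSnd _ _ a = projSnd _ _ b) : a = b := by
  have hVfst : (projFst _ _ a).1 = (projFst _ _ b).1 := by rw [hV]
  have hTMfst : (projSnd _ _ a).1 = (projSnd _ _ b).1 := by rw [hTM]
  refine Prod.ext (Prod.ext hVfst hTMfst) ?_
  ext v
  · exact DFunLike.congr_fun (show (projFst _ _ a).2 = (projFst _ _ b).2 by rw [hV]) v
  · exact DFunLike.congr_fun (show (projSnd _ _ a).2 = (projSnd _ _ b).2 by rw [hTM]) v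

theorem projSnd_shuffleAt (m : M) (a : Dbl (T.VT m)) :
    projSnd _ _ (shuffleAt T T' m a) = projSnd _ _ a := by
  refine Prod.ext rfl ?_
  ext w
  change dotL (T.coord m m a.1.1) (T'.coord m m 0) + a.2 (0, w) = a.2 (0, w)
  rw [map_zero, map_zero, zero_add]

theorem coord_shuffleAt_self (m : M) (a : Dbl (T.VT m)) :
    T'.coord m m (projFst _ _ (shuffleAt T T' m a)).1 = T.coordDual m m (projFst _ _ a).2 := by
  refine (T'.coord_coordEquiv_symm (T'.mem_U m) _).trans ?_
  funext k
  rw [coordDual_apply, T.frame_eq_symm (T.mem_U m)]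
  rfl

theorem shuffleAt_snd_apply (m : M) (a : Dbl (T.VT m)) (w : T'.V m) :
    (projFst _ _ (shuffleAt T T' m a)).2 w = T.coord m m (projFst _ _ a).1 ⬝ᵥ T'.coord m m w := by
  change dotL (T.coord m m a.1.1) (T'.coord m m w) + a.2 0 = _
  rw [dotL_apply, map_zero, add_zero]
  rfl

namespace InDuality

variable (h : InDuality T T')

include h

theorem coord_shuffleAt {c m : M} (hm : m ∈ T.U c) (hm' : m ∈ T'.U c) (a : Dbl (T.VT m)) :
    T'.coord c m (projFst _ _ (shuffleAt T T' m a)).1 = T.coordDual c m (projFst _ _ a).2 := by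
  refine (coordDual_eq_of_forall hm fun v => ?_).symm
  rw [dotProduct_comm, h c m m hm hm' (T.mem_U m) (T'.mem_U m), coord_shuffleAt_self,
    T.apply_eq_dotProduct (T.mem_U m), dotProduct_comm]

theorem coordDual_shuffleAt {c m : M} (hm : m ∈ T.U c) (hm' : m ∈ T'.U c) (a : Dbl (T.VT m)) :
    T'.coordDual c m (projFst _ _ (shuffleAt T T' m a)).2 = T.coord c m (projFst _ _ a).1 :=
  coordDual_eq_of_forall hm' fun w => by
    rw [shuffleAt_snd_apply, h m c m (T.mem_U m) (T'.mem_U m) hm hm']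

theorem shuffleAt_shuffleAt (m : M) (a : Dbl (T.VT m)) :
    shuffleAt T' T m (shuffleAt T T' m a) = a := by
  have hc := T.mem_U m
  have hc' := T'.mem_U m
  refine dbl_ext (Prod.ext (T.coord_injective hc ?_) (coordDual_injective hc ?_)) ?_
  · rw [h.symm.coord_shuffleAt hc' hc, h.coordDual_shuffleAt hc hc']
  · rw [h.symm.coordDual_shuffleAt hc' hc, h.coord_shuffleAt hc hc']
  · rw [projSnd_shuffleAt, projSnd_shuffleAt]

theorem pairing_shuffleAt (m : M) (a b : Dbl (T.VT m)) :
    pairing (shuffleAt T T' m a) (shuffleAt T T' m b) = pairing a b := by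
  have shuffle_apply : ∀ a b : Dbl (T.VT m), (shuffleAt T T' m a).2 (shuffleAt T T' m b).1 =
      (projFst _ _ b).2 (projFst _ _ a).1 + (projSnd _ _ a).2 (projSnd _ _ b).1 := by
    intro a b
    refine (dbl_apply _ _ _).trans ?_
    rw [projSnd_shuffleAt, T'.apply_eq_dotProduct (T'.mem_U m),
      h.coordDual_shuffleAt (T.mem_U m) (T'.mem_U m), T.apply_eq_dotProduct (T.mem_U m),
      dotProduct_comm, ← h.coord_shuffleAt (T.mem_U m) (T'.mem_U m) b]
    rfl
  have hab : a.2 b.1 = (projFst _ _ a).2 (projFst _ _ b).1 + (projSnd _ _ a).2 (projSnd _ _ b).1 :=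
    dbl_apply a _ _
  have hba : b.2 a.1 = (projFst _ _ b).2 (projFst _ _ a).1 + (projSnd _ _ b).2 (projSnd _ _ a).1 :=
    dbl_apply b _ _
  rw [pairing, pairing, shuffle_apply, shuffle_apply, hab, hba]
  ring

end InDuality

theorem shuffleAt_inclSnd (m : M) (b : TT (EuclideanSpace ℝ (Fin n)) m) :
    shuffleAt T T' m (inclSnd _ _ b) = inclSnd _ _ b := by
  refine dbl_ext (Prod.ext ?_ ?_) (by rw [projSnd_shuffleAt, projSnd_inclSnd, projSnd_inclSnd])
  · apply T'.coord_injective (T'.mem_U m)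
    rw [coord_shuffleAt_self]
    refine Eq.trans ?_ (map_zero _).symm
    funext
    exact map_zero b.2
  · ext w
    rw [shuffleAt_snd_apply]
    refine Eq.trans ?_ (map_zero b.2).symm
    refine (congrArg (· ⬝ᵥ T'.coord m m w) (map_zero _)).trans (zero_dotProduct _)

theorem shuffleAt_inclFst (m : M) (x : Dbl (T.V m)) :
    shuffleAt T T' m (inclFst _ _ x) = inclFst _ _ (swapAt T T' m x) := by
  refine dbl_ext (by rw [projFst_inclFst]; rfl) ?_
  rw [projSnd_shuffleAt]
  refine Prod.ext rfl ?_
  ext w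
  exact (map_zero x.2).trans (map_zero (swapAt T T' m x).2).symm

theorem coordDual_nablaDual (α : ∀ m, T.V m →L[ℝ] ℝ) (m : M) (u : TangentSpace (𝓡 n) m) :
    T.coordDual m m (T.nablaDual α m u) = mvfderiv (𝓡 n) (fun m' => T.coordDual m m' (α m')) m u :=
  coordDual_eq_of_forall (T.mem_U m) fun _ => dotL_apply _ _

namespace InDuality

variable (h : InDuality T T')

include h

theorem coord_swapAt {c m : M} (hm : m ∈ T.U c) (hm' : m ∈ T'.U c) (x : Dbl (T.V m)) :
    T'.coord c m (swapAt T T' m x).1 = T.coordDual c m x.2 := by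
  refine (h.coord_shuffleAt hm hm' _).trans ?_
  rw [projFst_inclFst]

theorem coordDual_swapAt {c m : M} (hm : m ∈ T.U c) (hm' : m ∈ T'.U c) (x : Dbl (T.V m)) :
    T'.coordDual c m (swapAt T T' m x).2 = T.coord c m x.1 := by
  refine (h.coordDual_shuffleAt hm hm' _).trans ?_
  rw [projFst_inclFst]

theorem swapAt_fst_eq_zero {m : M} {x : Dbl (T.V m)} : (swapAt T T' m x).1 = 0 ↔ x.2 = 0 := by
  rw [← (T'.coord_injective (T'.mem_U m)).eq_iff, h.coord_swapAt (T.mem_U m) (T'.mem_U m),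
    map_zero, ← (coordDual_injective (T.mem_U m)).eq_iff]
  rfl

theorem swapAt_snd_eq_zero {m : M} {x : Dbl (T.V m)} : (swapAt T T' m x).2 = 0 ↔ x.1 = 0 := by
  rw [← (T.coord_injective (T.mem_U m)).eq_iff, map_zero,
    ← h.coordDual_swapAt (T.mem_U m) (T'.mem_U m),
    ← (coordDual_injective (T'.mem_U m)).eq_iff]
  rfl

theorem swapAt_nabla_swapAt (x : ∀ m, Dbl (T.V m)) (m : M) (u : TangentSpace (𝓡 n) m) :
    swapAt T' T m (T'.nabla (fun m' => (swapAt T T' m' (x m')).1) m u, 0) =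
      (0, T.nablaDual (fun m' => (x m').2) m u) := by
  have hcoord : (fun m' => T'.coord m m' (swapAt T T' m' (x m')).1) =ᶠ[𝓝 m]
      fun m' => T.coordDual m m' (x m').2 := by
    filter_upwards [((T.isOpen_U m).inter (T'.isOpen_U m)).mem_nhds ⟨T.mem_U m, T'.mem_U m⟩]
      with m' hm' using h.coord_swapAt hm'.1 hm'.2 _
  refine Prod.ext (h.symm.swapAt_fst_eq_zero.2 rfl) (coordDual_injective (T.mem_U m) ?_)
  rw [h.symm.coordDual_swapAt (T'.mem_U m) (T.mem_U m), coord_nabla_self, coordDual_nablaDual,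
    mvfderiv, mvfderiv, hcoord.mfderiv_eq]
  rfl

theorem swapAt_nablaDual_swapAt (x : ∀ m, Dbl (T.V m)) (m : M) (u : TangentSpace (𝓡 n) m) :
    swapAt T' T m (0, T'.nablaDual (fun m' => (swapAt T T' m' (x m')).2) m u) =
      (T.nabla (fun m' => (x m').1) m u, 0) := by
  have hcoord : (fun m' => T'.coordDual m m' (swapAt T T' m' (x m')).2) =ᶠ[𝓝 m]
      fun m' => T.coord m m' (x m').1 := by
    filter_upwards [((T.isOpen_U m).inter (T'.isOpen_U m)).mem_nhds ⟨T.mem_U m, T'.mem_U m⟩]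
      with m' hm' using h.coordDual_swapAt hm'.1 hm'.2 _
  refine Prod.ext (T.coord_injective (T.mem_U m) ?_) (h.symm.swapAt_snd_eq_zero.2 rfl)
  rw [h.symm.coord_swapAt (T'.mem_U m) (T.mem_U m), coord_nabla_self, coordDual_nablaDual,
    mvfderiv, mvfderiv, hcoord.mfderiv_eq]
  rfl

theorem smoothDbl_shuffleAt [IsManifold (𝓡 n) ∞ M] [IsManifold 𝓘(ℝ, EZ) ∞ Z]
    [IsManifold 𝓘(ℝ, EZ') ∞ Z'] {U : Set M} (hU : IsOpen U) {a : ∀ m, Dbl (T.VT m)}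
    (ha : SmoothDbl (EuclideanSpace ℝ (Fin n)) T.SmoothVT U a) :
    SmoothDbl (EuclideanSpace ℝ (Fin n)) T'.SmoothVT U (fun m => shuffleAt T T' m (a m)) := by
  obtain ⟨hV, hTM⟩ := (T.smoothDbl_iff hU).1 ha
  refine (T'.smoothDbl_iff hU).2 ⟨fun m hm => ?_, by simpa only [projSnd_shuffleAt] using hTM⟩
  have hnhds := ((T.isOpen_U m).inter (T'.isOpen_U m)).mem_nhds ⟨T.mem_U m, T'.mem_U m⟩
  constructor
  · refine ContMDiffAt.congr_of_eventuallyEq (hV m hm).2 ?_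
    filter_upwards [hnhds] with m' hm' using h.coord_shuffleAt hm'.1 hm'.2 _
  · refine ContMDiffAt.congr_of_eventuallyEq (hV m hm).1 ?_
    filter_upwards [hnhds] with m' hm' using h.coordDual_shuffleAt hm'.1 hm'.2 _

end InDuality

end Duality

/-! ### The mirror structure -/

section Mirror

variable {n : ℕ} {M : Type*} [TopologicalSpace M] [ChartedSpace (EuclideanSpace ℝ (Fin n)) M]
  [IsManifold (𝓡 n) ∞ M]
  {EZ : Type*} [NormedAddCommGroup EZ] [NormedSpace ℝ EZ]
  {Z : Type*} [TopologicalSpace Z] [ChartedSpace EZ Z]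

theorem inDuality_dual (T : TorusBundle n M EZ Z) : InDuality T T.dual := by
  intro c c' m hc _ hc' _ v w
  obtain ⟨A, hA⟩ := T.trans c c' m ⟨hc, hc'⟩
  have hcoord : ∀ v, T.coord c m v = intAct A.1 (T.coord c' m v) :=
    T.coord_change hc hc' A.1 hA.self_of_nhds
  have hdual : ∀ ξ, T.dual.φ c' (m, ξ) = T.dual.φ c (m, intAct (A⁻¹).1.transpose ξ) := by
    intro ξ
    have hform : (dotL ξ).comp (T.coord c' m) =
        (dotL (intAct (A⁻¹).1.transpose ξ)).comp (T.coord c m) := by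
      ext v
      simp only [ContinuousLinearMap.comp_apply, dotL_apply, hcoord,
        intAct_inv_transpose_dotProduct]
    exact congrArg (T.dualMk m) hform
  rw [hcoord, T.dual.coord_change hc hc' _ hdual w, dotProduct_comm,
    intAct_inv_transpose_dotProduct, dotProduct_comm]

variable {T : TorusBundle n M EZ Z} {Jb : ∀ m, Dbl (T.VT m) →ₗ[ℝ] Dbl (T.VT m)}

theorem mirrorBase_apply (m : M) (a : Dbl (T.dual.VT m)) :
    T.mirrorBase Jb m a = shuffleAt T T.dual m (Jb m (shuffleAt T.dual T m a)) := rfl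

namespace IsSemiFlat

variable [IsManifold 𝓘(ℝ, EZ) ∞ Z] {J : ∀ z : Z, TT EZ z →ₗ[ℝ] TT EZ z} (hJ : T.IsSemiFlat J Jb)

include hJ

theorem mirrorBase_inclFst (m : M) (x : Dbl (T.dual.V m)) :
    T.mirrorBase Jb m (inclFst _ _ x) = inclSnd _ _ (T.toTM Jb m (swapAt T.dual T m x)) := by
  rw [mirrorBase_apply, shuffleAt_inclFst, hJ.map_inclFst, shuffleAt_inclSnd]

theorem mirrorBase_inclSnd (m : M) (a : TT (EuclideanSpace ℝ (Fin n)) m) :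
    T.mirrorBase Jb m (inclSnd _ _ a) = -inclFst _ _ (swapAt T T.dual m (T.ofTM Jb m a)) := by
  rw [mirrorBase_apply, shuffleAt_inclSnd, hJ.map_inclSnd, map_neg, shuffleAt_inclFst]

theorem mirror : T.dual.IsSemiFlat (T.mirror Jb) (T.mirrorBase Jb) where
  genAlmostComplex :=
    { sq := fun m a => by
        rw [mirrorBase_apply, mirrorBase_apply, T.inDuality_dual.shuffleAt_shuffleAt,
          hJ.genAlmostComplex.sq, map_neg, T.inDuality_dual.symm.shuffleAt_shuffleAt]
      orth := fun m a b => by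
        rw [mirrorBase_apply, mirrorBase_apply, T.inDuality_dual.pairing_shuffleAt,
          hJ.genAlmostComplex.orth, T.inDuality_dual.symm.pairing_shuffleAt]
      smooth := fun U hU a ha => T.inDuality_dual.smoothDbl_shuffleAt hU
        (hJ.genAlmostComplex.smooth U hU _ (T.inDuality_dual.symm.smoothDbl_shuffleAt hU ha)) }
  adapted m := by
    refine le_antisymm ?_ ?_
    · rintro _ ⟨_, ⟨x, rfl⟩, rfl⟩
      exact ⟨_, (hJ.mirrorBase_inclFst m x).symm⟩
    · rintro _ ⟨b, rfl⟩
      refine ⟨_, ⟨swapAt T T.dual m (T.ofTM Jb m b), rfl⟩, ?_⟩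
      rw [← shuffleAt_inclFst, mirrorBase_apply, T.inDuality_dual.shuffleAt_shuffleAt,
        hJ.map_inclFst, hJ.toTM_ofTM, shuffleAt_inclSnd]
  eq_lift _ := rfl

theorem toTM_mirror (m : M) (x : Dbl (T.dual.V m)) :
    T.dual.toTM (T.mirrorBase Jb) m x = T.toTM Jb m (swapAt T.dual T m x) := by
  change projSnd _ _ (T.mirrorBase Jb m (inclFst _ _ x)) = _
  rw [hJ.mirrorBase_inclFst, projSnd_inclSnd]

theorem ofTM_mirror (m : M) (a : TT (EuclideanSpace ℝ (Fin n)) m) :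
    T.dual.ofTM (T.mirrorBase Jb) m a = swapAt T T.dual m (T.ofTM Jb m a) := by
  change projFst _ _ (-(T.mirrorBase Jb m (inclSnd _ _ a))) = _
  rw [hJ.mirrorBase_inclSnd, neg_neg, projFst_inclFst]

theorem Delta_mirror : T.dual.Delta (T.mirrorBase Jb) = T.DeltaHat Jb := by
  funext m
  ext a
  rw [hJ.mirror.mem_Delta_iff, hJ.mem_DeltaHat_iff, hJ.ofTM_mirror,
    T.inDuality_dual.swapAt_snd_eq_zero]

theorem DeltaHat_mirror : T.dual.DeltaHat (T.mirrorBase Jb) = T.Delta Jb := by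
  funext m
  ext a
  rw [hJ.mirror.mem_DeltaHat_iff, hJ.mem_Delta_iff, hJ.ofTM_mirror,
    T.inDuality_dual.swapAt_fst_eq_zero]

theorem connDelta_mirror : T.dual.connDelta (T.mirrorBase Jb) = T.connDeltaHat Jb := by
  funext a m u
  change T.dual.toTM (T.mirrorBase Jb) m
      (T.dual.nabla (fun m' => (T.dual.ofTM (T.mirrorBase Jb) m' (a m')).1) m u, 0) =
    T.toTM Jb m (0, T.nablaDual (fun m' => (T.ofTM Jb m' (a m')).2) m u)
  simp only [hJ.toTM_mirror, hJ.ofTM_mirror, T.inDuality_dual.swapAt_nabla_swapAt]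

theorem connDeltaHat_mirror : T.dual.connDeltaHat (T.mirrorBase Jb) = T.connDelta Jb := by
  funext a m u
  change T.dual.toTM (T.mirrorBase Jb) m
      (0, T.dual.nablaDual (fun m' => (T.dual.ofTM (T.mirrorBase Jb) m' (a m')).2) m u) =
    T.toTM Jb m (T.nabla (fun m' => (T.ofTM Jb m' (a m')).1) m u, 0)
  simp only [hJ.toTM_mirror, hJ.ofTM_mirror, T.inDuality_dual.swapAt_nablaDual_swapAt]

end IsSemiFlat

end Mirror

end TorusBundle

/-! ### Lifting sections to the total space -/

section Related

variable {E : Type*} [NormedAddCommGroup E] [NormedSpace ℝ E]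
  {N : Type*} [TopologicalSpace N] [ChartedSpace E N]
  {E' : Type*} [NormedAddCommGroup E'] [NormedSpace ℝ E']
  {N' : Type*} [TopologicalSpace N'] [ChartedSpace E' N']

theorem smoothTT_zero [IsManifold 𝓘(ℝ, E) ∞ N] (U : Set N) : SmoothTT U (fun x => (0 : TT E x)) :=
  ⟨smoothVF_zero U, smoothDual_zero _ U⟩

variable {G : N → N'} {x : N} {a b : ∀ x : N, TT E x} {a' b' : ∀ x : N', TT E' x}

theorem RelatedAt.add (h : RelatedAt G x a a') (h' : RelatedAt G x b b') :
    RelatedAt G x (fun x => a x + b x) (fun x => a' x + b' x) := by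
  refine ⟨?_, fun u => congrArg₂ (· + ·) (h.2 u) (h'.2 u)⟩
  exact (map_add _ _ _).trans (congrArg₂ (· + ·) h.1 h'.1)

theorem RelatedAt.sub (h : RelatedAt G x a a') (h' : RelatedAt G x b b') :
    RelatedAt G x (fun x => a x - b x) (fun x => a' x - b' x) := by
  refine ⟨?_, fun u => congrArg₂ (· - ·) (h.2 u) (h'.2 u)⟩
  exact (map_sub _ _ _).trans (congrArg₂ (· - ·) h.1 h'.1)

theorem RelatedAt.of_apply_eq (h : RelatedAt G x a a') {y : N'} (hy : G x = y) :
    (mfderiv 𝓘(ℝ, E) 𝓘(ℝ, E') G x (a x).1 : E') = (a' y).1 ∧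
      ∀ u : E, (a x).2 u = (a' y).2 (mfderiv 𝓘(ℝ, E) 𝓘(ℝ, E') G x u : E') := by
  subst hy
  exact h

end Related

namespace TorusBundle

variable {n : ℕ} {M : Type*} [TopologicalSpace M] [ChartedSpace (EuclideanSpace ℝ (Fin n)) M]
  {EZ : Type*} [NormedAddCommGroup EZ] [NormedSpace ℝ EZ]
  {Z : Type*} [TopologicalSpace Z] [ChartedSpace EZ Z]
  (T : TorusBundle n M EZ Z)

/-- The section of `T_Z ⊕ T_Z^∨` corresponding to the pullback of a section of
`V ⊕ T_M ⊕ V^∨ ⊕ T_M^∨`. -/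
def liftSec (a : ∀ m, Dbl (T.VT m)) (z : Z) : TT EZ z := T.Finv z (a (T.proj z))

/-- The lift to `Z` of a section of `T_M ⊕ T_M^∨`. -/
abbrev liftTM (a : ∀ m : M, TT (EuclideanSpace ℝ (Fin n)) m) : ∀ z : Z, TT EZ z :=
  T.liftSec fun m => inclSnd _ _ (a m)

/-- The lift to `Z` of a section of `V ⊕ V^∨`. -/
abbrev liftV (x : ∀ m : M, Dbl (T.V m)) : ∀ z : Z, TT EZ z :=
  T.liftSec fun m => inclFst _ (TangentSpace (𝓡 n) m) (x m)

theorem F_liftSec (a : ∀ m, Dbl (T.VT m)) (z : Z) : T.F z (T.liftSec a z) = a (T.proj z) :=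
  T.F_Finv z _

theorem liftSec_fst_eq_dφ (a : ∀ m, Dbl (T.VT m)) {c : M} {z : Z} (hz : T.proj z ∈ T.U c)
    {ξ : Rn n} (h : T.φ c (T.proj z, ξ) = z) :
    (T.liftSec a z).1 = T.dφ c (T.proj z) ξ
      ((a (T.proj z)).1.2, T.coord c (T.proj z) (a (T.proj z)).1.1) := by
  change T.j z (a (T.proj z)).1.1 + T.horLift z (a (T.proj z)).1.2 = _
  rw [T.horLift_eq_dφ hz h, T.j_eq_dφ hz h]
  refine (map_add (T.dφ c (T.proj z) ξ) _ _).symm.trans (congrArg _ ?_)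
  exact Prod.ext (zero_add _) (add_zero _)

section Smooth

variable [IsManifold 𝓘(ℝ, EZ) ∞ Z]

theorem IsFibreCoordAt.eventually_coord_D {T : TorusBundle n M EZ Z} {c m : M} (hm : m ∈ T.U c)
    {ξ : Rn n} {τ : Z → Rn n} (hτ : T.IsFibreCoordAt c m ξ τ) :
    ∀ᶠ z in 𝓝 (T.φ c (m, ξ)), ∀ w,
      T.coord c (T.proj z) (T.D z w) = mvfderiv 𝓘(ℝ, EZ) τ z w := by
  have hcont : Tendsto (fun z => (T.proj z, τ z)) (𝓝 (T.φ c (m, ξ))) (𝓝 (m, ξ)) := by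
    have hpair : ContinuousAt (fun z => (T.proj z, τ z)) (T.φ c (m, ξ)) :=
      T.contMDiff_proj.continuous.continuousAt.prodMk hτ.contMDiffAt.continuousAt
    rwa [ContinuousAt, T.proj_φ c m hm, hτ.eventually_apply_φ.self_of_nhds] at hpair
  filter_upwards [hτ.eventually_φ_apply, hcont.eventually (hτ.eventually_mvfderiv_dφ hm)]
    with z ⟨hz, hφ⟩ hderiv w
  obtain ⟨e, he⟩ := T.dφ_equiv c (T.proj z) hz (τ z)
  have hw : T.dφ c (T.proj z) (τ z) (e.symm w) = w := by
    rw [he]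
    exact e.apply_symm_apply w
  have hderivw := hderiv (e.symm w)
  have hcoord := T.coord_D_dφ hz hφ (e.symm w)
  rw [hw, hφ] at hderivw
  rw [hw] at hcoord
  exact hcoord.trans hderivw.symm

variable [IsManifold (𝓡 n) ∞ M] {U : Set M} {a : ∀ m, Dbl (T.VT m)}

theorem smoothVF_liftSec_fst (hU : IsOpen U)
    (ha : SmoothDbl (EuclideanSpace ℝ (Fin n)) T.SmoothVT U a) :
    SmoothVF (T.proj ⁻¹' U) (fun z => (T.liftSec a z).1) := by
  intro z hz
  obtain ⟨hV, hTM⟩ := (T.smoothDbl_iff hU).1 ha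
  obtain ⟨τ, hτ⟩ := T.exists_isFibreCoordAt (T.mem_U (T.proj z)) (T.fib z)
  have hτz := hτ.contMDiffAt
  have hφ := hτ.eventually_φ_apply
  rw [T.φ_fib] at hτz hφ
  have hproj : ContMDiffAt 𝓘(ℝ, EZ) (𝓡 n) ∞ T.proj z := T.contMDiff_proj z
  have hX := ((smoothVF_iff_contMDiffAt hU).1 hTM.1 _ hz).comp z hproj
  refine ((T.contMDiffAt_dφ (T.mem_U (T.proj z)) hX hτz
    ((hV _ hz).1.comp z hproj)).congr_of_eventuallyEq ?_).contMDiffWithinAt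
  filter_upwards [hφ] with z' ⟨hz', hφz'⟩
  rw [T.liftSec_fst_eq_dφ a hz' hφz']
  exact tangentBundle_mk_congr hφz'.symm _

theorem smoothDual_liftSec_snd (hU : IsOpen U)
    (ha : SmoothDbl (EuclideanSpace ℝ (Fin n)) T.SmoothVT U a) :
    SmoothDual EZ SmoothVF (T.proj ⁻¹' U) (fun z => (T.liftSec a z).2) := by
  intro U' hU' hUU w hw z hz
  obtain ⟨hV, hTM⟩ := (T.smoothDbl_iff hU).1 ha
  have hw' := (smoothVF_iff_contMDiffAt hU').1 hw z hz
  obtain ⟨τ, hτ⟩ := T.exists_isFibreCoordAt (T.mem_U (T.proj z)) (T.fib z)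
  have hτz := hτ.contMDiffAt
  have hφ := hτ.eventually_φ_apply
  have hcoord := hτ.eventually_coord_D (T.mem_U (T.proj z))
  rw [T.φ_fib] at hτz hφ hcoord
  have hproj : ContMDiffAt 𝓘(ℝ, EZ) (𝓡 n) ∞ T.proj z := T.contMDiff_proj z
  have hα := (hV _ (hUU hz)).2.comp z hproj
  have hη : ContMDiffAt 𝓘(ℝ, EZ) 𝓘(ℝ, Rn n) ∞ (fun z => mvfderiv 𝓘(ℝ, EZ) τ z (w z)) z :=
    contMDiffAt_mvfderiv_along (g := fun z : Z => z) hτz hw' le_rfl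
  have hform := contMDiffAt_form_along (g := T.proj) hU hTM.2 (hUU hz)
    (contMDiffAt_mfderiv_along (g := fun z : Z => z) hproj hw' le_rfl)
  have hdot := contMDiffAt_finsetSum (t := Finset.univ) fun k _ =>
    (contMDiffAt_pi_space.1 hα k).mul (contMDiffAt_pi_space.1 hη k)
  refine ((hdot.add hform).congr_of_eventuallyEq ?_).contMDiffWithinAt
  filter_upwards [hφ, hcoord] with z' ⟨hz', _⟩ hcoord'
  refine (dbl_apply (a (T.proj z')) (T.D z' (w z')) (T.dproj z' (w z'))).trans ?_
  rw [T.apply_eq_dotProduct hz', hcoord']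
  rfl

theorem smoothTT_liftSec (hU : IsOpen U)
    (ha : SmoothDbl (EuclideanSpace ℝ (Fin n)) T.SmoothVT U a) :
    SmoothTT (T.proj ⁻¹' U) (T.liftSec a) :=
  ⟨T.smoothVF_liftSec_fst hU ha, T.smoothDual_liftSec_snd hU ha⟩

end Smooth

theorem relatedAt_proj_liftTM (a : ∀ m : M, TT (EuclideanSpace ℝ (Fin n)) m) (z : Z) :
    RelatedAt T.proj z (T.liftTM a) a := by
  refine ⟨?_, fun u => rfl⟩
  change T.dproj z (T.j z 0 + T.horLift z (a (T.proj z)).1) = _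
  rw [map_add, T.dproj_j, T.dproj_horLift, zero_add]

theorem relatedAt_proj_liftV {x : ∀ m : M, Dbl (T.V m)} {z : Z} (hx : (x (T.proj z)).2 = 0) :
    RelatedAt T.proj z (T.liftV x) (fun m => (0 : TT (EuclideanSpace ℝ (Fin n)) m)) := by
  constructor
  · change T.dproj z (T.j z (x (T.proj z)).1 + T.horLift z 0) = 0
    rw [map_add, T.dproj_j, T.dproj_horLift, zero_add]
  · intro u
    change (x (T.proj z)).2 (T.D z u) = 0
    rw [hx]
    rfl

theorem relatedAt_section_liftTM (a : ∀ m : M, TT (EuclideanSpace ℝ (Fin n)) m) {c m : M}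
    (hm : m ∈ T.U c) (ξ : Rn n) : RelatedAt (fun m => T.φ c (m, ξ)) m a (T.liftTM a) := by
  have hp := T.proj_φ c m hm ξ
  have hz : T.proj (T.φ c (m, ξ)) ∈ T.U c := by rwa [hp]
  have h : T.φ c (T.proj (T.φ c (m, ξ)), ξ) = T.φ c (m, ξ) := by rw [hp]
  constructor
  · rw [T.mfderiv_φ_const hm]
    change _ = T.j (T.φ c (m, ξ)) 0 + T.horLift (T.φ c (m, ξ)) (a (T.proj (T.φ c (m, ξ)))).1
    rw [T.horLift_eq_dφ hz h, map_zero]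
    refine Eq.trans ?_ (zero_add _).symm
    exact (congrArg (fun m' : M => (T.dφ c m' ξ ((a m').1, 0) : EZ)) hp).symm
  · intro u
    rw [T.mfderiv_φ_const hm]
    change (a m).2 u = (a (T.proj (T.φ c (m, ξ)))).2
      (T.dproj (T.φ c (m, ξ)) (T.dφ c m ξ (u, 0)))
    rw [T.dproj_dφ c m hm]
    exact (congrArg (fun m' : M => (a m').2 u) hp).symm

theorem D_dφ_eq_zero {c m : M} (hm : m ∈ T.U c) (ξ : Rn n) (u : EuclideanSpace ℝ (Fin n)) :
    T.D (T.φ c (m, ξ)) (T.dφ c m ξ (u, 0)) = 0 := by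
  have hp := T.proj_φ c m hm ξ
  have hz : T.proj (T.φ c (m, ξ)) ∈ T.U c := by rwa [hp]
  have h : T.φ c (T.proj (T.φ c (m, ξ)), ξ) = T.φ c (m, ξ) := by rw [hp]
  have hdφ : T.dφ c (T.proj (T.φ c (m, ξ))) ξ (u, 0) = T.dφ c m ξ (u, 0) :=
    congrArg (fun m' : M => (T.dφ c m' ξ (u, 0) : EZ)) hp
  apply T.coord_injective hz
  rw [map_zero, ← hdφ]
  exact T.coord_D_dφ hz h (u, 0)

theorem relatedAt_section_liftV {x : ∀ m : M, Dbl (T.V m)} {c m : M}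
    (hm : m ∈ T.U c) (ξ : Rn n) (hx : (x m).1 = 0) :
    RelatedAt (fun m => T.φ c (m, ξ)) m (fun m => (0 : TT (EuclideanSpace ℝ (Fin n)) m))
      (T.liftV x) := by
  have hx' : (x (T.proj (T.φ c (m, ξ)))).1 = 0 := by rwa [T.proj_φ c m hm ξ]
  constructor
  · refine (map_zero _).trans ?_
    change 0 = T.j _ (x (T.proj (T.φ c (m, ξ)))).1 + T.horLift _ 0
    rw [hx', map_zero, map_zero]
    exact (zero_add _).symm
  · intro u
    rw [T.mfderiv_φ_const hm]
    change 0 = (x (T.proj (T.φ c (m, ξ)))).2 (T.D (T.φ c (m, ξ)) (T.dφ c m ξ (u, 0)))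
    exact ((congrArg _ (T.D_dφ_eq_zero hm ξ u)).trans (map_zero _)).symm

variable {T} {a : ∀ m : M, TT (EuclideanSpace ℝ (Fin n)) m} {A : ∀ z : Z, TT EZ z} {z : Z}

theorem projSnd_F_of_relatedAt_proj (h : RelatedAt T.proj z A a) :
    projSnd _ _ (T.F z (A z)) = a (T.proj z) := by
  refine Prod.ext h.1 ?_
  ext u
  change (A z).2 (T.j z 0 + T.horLift z u) = _
  rw [map_zero, zero_add, h.2]
  exact congrArg (a (T.proj z)).2 (T.dproj_horLift z u)

theorem projSnd_F_of_relatedAt_section {c : M} (hz : T.proj z ∈ T.U c) {ξ : Rn n}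
    (hφ : T.φ c (T.proj z, ξ) = z) (h : RelatedAt (fun m => T.φ c (m, ξ)) (T.proj z) a A) :
    projSnd _ _ (T.F z (A z)) = a (T.proj z) := by
  obtain ⟨hvec, hform⟩ := h.of_apply_eq hφ
  refine Prod.ext ?_ ?_
  · change T.dproj z (A z).1 = _
    rw [← hvec, T.mfderiv_φ_const hz, ← T.horLift_eq_dφ hz hφ]
    exact T.dproj_horLift z _
  · ext u
    change (A z).2 (T.j z 0 + T.horLift z u) = _
    rw [map_zero, zero_add, T.horLift_eq_dφ hz hφ, ← T.mfderiv_φ_const hz]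
    exact (hform u).symm

/-! ### Integrability -/

variable (T)

/-- The real part of the Courant bracket of the `+i`-eigensections of `J` whose real parts are the
lifts of the sections `a` and `b` of `T_M ⊕ T_M^∨`. -/
def eigenCourantRe (Jb : ∀ m, Dbl (T.VT m) →ₗ[ℝ] Dbl (T.VT m))
    (a b : ∀ m : M, TT (EuclideanSpace ℝ (Fin n)) m) (z : Z) : TT EZ z :=
  courant (T.liftTM a) (T.liftTM b) z -
    courant (T.liftV fun m => T.ofTM Jb m (a m)) (T.liftV fun m => T.ofTM Jb m (b m)) z

/-- The imaginary part of the Courant bracket in `eigenCourantRe`. -/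
def eigenCourantIm (Jb : ∀ m, Dbl (T.VT m) →ₗ[ℝ] Dbl (T.VT m))
    (a b : ∀ m : M, TT (EuclideanSpace ℝ (Fin n)) m) (z : Z) : TT EZ z :=
  courant (T.liftTM a) (T.liftV fun m => T.ofTM Jb m (b m)) z +
    courant (T.liftV fun m => T.ofTM Jb m (a m)) (T.liftTM b) z

namespace IsSemiFlat

variable [IsManifold (𝓡 n) ∞ M] [IsManifold 𝓘(ℝ, EZ) ∞ Z] {T}
  {J : ∀ z : Z, TT EZ z →ₗ[ℝ] TT EZ z}
  {Jb : ∀ m, Dbl (T.VT m) →ₗ[ℝ] Dbl (T.VT m)} (hJ : T.IsSemiFlat J Jb)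
  {U : Set M} (hU : IsOpen U) {a b : ∀ m : M, TT (EuclideanSpace ℝ (Fin n)) m}

include hJ hU

theorem isEigenSection_lift (ha : SmoothTT U a) :
    IsEigenSection J (T.proj ⁻¹' U) (T.liftTM a) (T.liftV fun m => T.ofTM Jb m (a m)) := by
  refine ⟨T.smoothTT_liftSec hU (T.smoothDbl_inclSnd hU ha), T.smoothTT_liftSec hU
    (T.smoothDbl_inclFst hU fun m hm => hJ.smoothAt_ofTM hU ha hm), fun z _ => ⟨?_, ?_⟩⟩
  · rw [hJ.eq_lift]
    change T.Finv z (Jb _ (T.F z (T.liftTM a z))) = -T.Finv z (inclFst _ _ (T.ofTM Jb _ (a _)))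
    rw [T.F_liftSec, hJ.map_inclSnd, map_neg]
  · rw [hJ.eq_lift]
    change T.Finv z (Jb _ (T.F z (T.liftV _ z))) = T.Finv z (inclSnd _ _ (a _))
    rw [T.F_liftSec, hJ.map_inclFst, hJ.toTM_ofTM]

theorem ofTM_projSnd_F_eigenCourantRe (hi : Integrable J) (ha : SmoothTT U a) (hb : SmoothTT U b)
    {z : Z} (hz : T.proj z ∈ U) (hIm : projSnd _ _ (T.F z (T.eigenCourantIm Jb a b z)) = 0) :
    T.ofTM Jb (T.proj z) (projSnd _ _ (T.F z (T.eigenCourantRe Jb a b z))) =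
      projFst _ _ (T.F z (T.eigenCourantIm Jb a b z)) := by
  have hJIm : J z (T.eigenCourantIm Jb a b z) = T.eigenCourantRe Jb a b z :=
    (hi _ (hU.preimage T.contMDiff_proj.continuous) _ _ _ _ (hJ.isEigenSection_lift hU ha)
      (hJ.isEigenSection_lift hU hb) z hz).2
  have hFIm : T.F z (T.eigenCourantIm Jb a b z) =
      inclFst _ _ (projFst _ _ (T.F z (T.eigenCourantIm Jb a b z))) := by
    refine dbl_ext (projFst_inclFst _).symm (hIm.trans (Prod.ext rfl ?_))
    ext
    exact (map_zero (projFst _ _ (T.F z (T.eigenCourantIm Jb a b z))).2).symm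
  have hFRe : T.F z (T.eigenCourantRe Jb a b z) =
      Jb _ (T.F z (T.eigenCourantIm Jb a b z)) := by
    rw [← hJIm, hJ.eq_lift]
    exact T.F_Finv z _
  rw [hFRe, hFIm, hJ.map_inclFst, projSnd_inclSnd, hJ.ofTM_toTM, projFst_inclFst]

theorem relatedAt_proj_eigenCourant (ha : IsSection (T.Delta Jb) U a)
    (hb : IsSection (T.Delta Jb) U b) {z : Z} (hz : T.proj z ∈ U) :
    RelatedAt T.proj z (T.eigenCourantRe Jb a b) (courant a b) ∧
      RelatedAt T.proj z (T.eigenCourantIm Jb a b)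
        (fun m => (0 : TT (EuclideanSpace ℝ (Fin n)) m)) := by
  have hproj : ContMDiffAt 𝓘(ℝ, EZ) (𝓡 n) ∞ T.proj z := T.contMDiff_proj z
  have hU' := hU.preimage T.contMDiff_proj.continuous
  have hzero := smoothTT_zero (E := EuclideanSpace ℝ (Fin n)) U
  obtain ⟨hRe_a, hIm_a, -⟩ := hJ.isEigenSection_lift hU ha.1
  obtain ⟨hRe_b, hIm_b, -⟩ := hJ.isEigenSection_lift hU hb.1
  have hTM (c : ∀ m : M, TT (EuclideanSpace ℝ (Fin n)) m) :
      ∀ᶠ z' in 𝓝 z, RelatedAt T.proj z' (T.liftTM c) c :=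
    .of_forall fun z' => T.relatedAt_proj_liftTM c z'
  have hV {c : ∀ m : M, TT (EuclideanSpace ℝ (Fin n)) m} (hc : IsSection (T.Delta Jb) U c) :
      ∀ᶠ z' in 𝓝 z, RelatedAt T.proj z' (T.liftV fun m => T.ofTM Jb m (c m))
        (fun m => (0 : TT (EuclideanSpace ℝ (Fin n)) m)) := by
    filter_upwards [hU'.mem_nhds hz] with z' hz'
    exact T.relatedAt_proj_liftV (hJ.mem_Delta_iff.1 (hc.2 _ hz'))
  have hRe := (RelatedAt.courant hproj hU' hz hU hz hRe_a hRe_b ha.1 hb.1 (hTM a) (hTM b)).sub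
    (RelatedAt.courant hproj hU' hz hU hz hIm_a hIm_b hzero hzero (hV ha) (hV hb))
  have hIm := (RelatedAt.courant hproj hU' hz hU hz hRe_a hIm_b ha.1 hzero (hTM a) (hV hb)).add
    (RelatedAt.courant hproj hU' hz hU hz hIm_a hRe_b hzero hb.1 (hV ha) (hTM b))
  simp only [courant_zero_left, courant_zero_right, sub_zero, add_zero] at hRe hIm
  exact ⟨hRe, hIm⟩

theorem relatedAt_section_eigenCourant [FiniteDimensional ℝ EZ]
    (ha : IsSection (T.DeltaHat Jb) U a) (hb : IsSection (T.DeltaHat Jb) U b) {c m : M}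
    (hm : m ∈ U) (hc : m ∈ T.U c) (ξ : Rn n) :
    RelatedAt (fun m => T.φ c (m, ξ)) m (courant a b) (T.eigenCourantRe Jb a b) ∧
      RelatedAt (fun m => T.φ c (m, ξ)) m (fun m => (0 : TT (EuclideanSpace ℝ (Fin n)) m))
        (T.eigenCourantIm Jb a b) := by
  have hφ := T.contMDiffAt_φ_const hc ξ
  have hU' := hU.preimage T.contMDiff_proj.continuous
  have hφm : T.φ c (m, ξ) ∈ T.proj ⁻¹' U := by rwa [mem_preimage, T.proj_φ c m hc]
  have hzero := smoothTT_zero (E := EuclideanSpace ℝ (Fin n)) U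
  obtain ⟨hRe_a, hIm_a, -⟩ := hJ.isEigenSection_lift hU ha.1
  obtain ⟨hRe_b, hIm_b, -⟩ := hJ.isEigenSection_lift hU hb.1
  have hmem := (hU.inter (T.isOpen_U c)).mem_nhds ⟨hm, hc⟩
  have hTM (s : ∀ m : M, TT (EuclideanSpace ℝ (Fin n)) m) :
      ∀ᶠ m' in 𝓝 m, RelatedAt (fun m => T.φ c (m, ξ)) m' s (T.liftTM s) := by
    filter_upwards [hmem] with m' hm' using T.relatedAt_section_liftTM s hm'.2 ξ
  have hV {s : ∀ m : M, TT (EuclideanSpace ℝ (Fin n)) m} (hs : IsSection (T.DeltaHat Jb) U s) :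
      ∀ᶠ m' in 𝓝 m, RelatedAt (fun m => T.φ c (m, ξ)) m'
        (fun m => (0 : TT (EuclideanSpace ℝ (Fin n)) m)) (T.liftV fun m => T.ofTM Jb m (s m)) := by
    filter_upwards [hmem] with m' hm'
    exact T.relatedAt_section_liftV hm'.2 ξ (hJ.mem_DeltaHat_iff.1 (hs.2 _ hm'.1))
  have hRe := (RelatedAt.courant hφ hU hm hU' hφm ha.1 hb.1 hRe_a hRe_b (hTM a) (hTM b)).sub
    (RelatedAt.courant hφ hU hm hU' hφm hzero hzero hIm_a hIm_b (hV ha) (hV hb))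
  have hIm := (RelatedAt.courant hφ hU hm hU' hφm ha.1 hzero hRe_a hIm_b (hTM a) (hV hb)).add
    (RelatedAt.courant hφ hU hm hU' hφm hzero hb.1 hIm_a hRe_b (hV ha) (hTM b))
  simp only [courant_zero_left, courant_zero_right, sub_zero, add_zero] at hRe hIm
  exact ⟨hRe, hIm⟩

omit hU

theorem diracIntegrable_Delta (hi : Integrable J) : DiracIntegrable (T.Delta Jb) := by
  intro U hU a b ha hb m hm
  obtain ⟨z, rfl⟩ : ∃ z, T.proj z = m := ⟨T.φ m (m, 0), T.proj_φ m m (T.mem_U m) 0⟩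
  obtain ⟨hRe, hIm⟩ := hJ.relatedAt_proj_eigenCourant hU ha hb hm
  have hofTM := hJ.ofTM_projSnd_F_eigenCourantRe hU hi ha.1 hb.1 hm
    (projSnd_F_of_relatedAt_proj hIm)
  rw [projSnd_F_of_relatedAt_proj hRe] at hofTM
  rw [hJ.mem_Delta_iff, hofTM]
  ext v
  exact hIm.2 _

theorem diracIntegrable_DeltaHat [FiniteDimensional ℝ EZ] (hi : Integrable J) :
    DiracIntegrable (T.DeltaHat Jb) := by
  intro U hU a b ha hb m hm
  obtain ⟨z, rfl⟩ : ∃ z, T.proj z = m := ⟨T.φ m (m, 0), T.proj_φ m m (T.mem_U m) 0⟩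
  have hc := T.mem_U (T.proj z)
  obtain ⟨hRe, hIm⟩ := hJ.relatedAt_section_eigenCourant hU ha hb hm hc (T.fib z)
  have hofTM := hJ.ofTM_projSnd_F_eigenCourantRe hU hi ha.1 hb.1 hm
    (projSnd_F_of_relatedAt_section hc (T.φ_fib z) hIm)
  rw [projSnd_F_of_relatedAt_section hc (T.φ_fib z) hRe] at hofTM
  rw [hJ.mem_DeltaHat_iff, hofTM]
  have hvec : (T.eigenCourantIm Jb a b z).1 = 0 :=
    (hIm.of_apply_eq (T.φ_fib z)).1.symm.trans (map_zero _)
  exact (congrArg (T.D z) hvec).trans (map_zero _)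

end IsSemiFlat

end TorusBundle

end TorusMirror

end

open TorusMirror in
theorem mainTheorem7 {n : ℕ} {M : Type*} [TopologicalSpace M]
    [ChartedSpace (EuclideanSpace ℝ (Fin n)) M] [IsManifold (𝓡 n) ∞ M]
    {EZ : Type*} [NormedAddCommGroup EZ] [NormedSpace ℝ EZ] [FiniteDimensional ℝ EZ]
    {Z : Type*} [TopologicalSpace Z] [ChartedSpace EZ Z] [IsManifold 𝓘(ℝ, EZ) ∞ Z]
    (T : TorusBundle n M EZ Z)
    (J : ∀ z : Z, TT EZ z →ₗ[ℝ] TT EZ z)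
    (Jb : ∀ m : M, Dbl (T.VT m) →ₗ[ℝ] Dbl (T.VT m))
    (hJ : T.IsSemiFlat J Jb) :
    -- a pair of almost Dirac structures
    (IsAlmostDirac (T.Delta Jb) ∧ IsAlmostDirac (T.DeltaHat Jb)) ∧
    -- each carries its own flat connection
    (IsFlatConnection (T.Delta Jb) (T.connDelta Jb) ∧
      IsFlatConnection (T.DeltaHat Jb) (T.connDeltaHat Jb)) ∧
    -- they are exchanged, with their connections, under mirror symmetry
    (T.dual.IsSemiFlat (T.mirror Jb) (T.mirrorBase Jb) ∧
      T.dual.Delta (T.mirrorBase Jb) = T.DeltaHat Jb ∧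
      T.dual.DeltaHat (T.mirrorBase Jb) = T.Delta Jb ∧
      (∀ U : Set M, IsOpen U → ∀ a, IsSection (T.DeltaHat Jb) U a → ∀ m ∈ U, ∀ u,
        T.dual.connDelta (T.mirrorBase Jb) a m u = T.connDeltaHat Jb a m u) ∧
      (∀ U : Set M, IsOpen U → ∀ a, IsSection (T.Delta Jb) U a → ∀ m ∈ U, ∀ u,
        T.dual.connDeltaHat (T.mirrorBase Jb) a m u = T.connDelta Jb a m u)) ∧
    -- integrability
    (Integrable J → DiracIntegrable (T.Delta Jb) ∧ DiracIntegrable (T.DeltaHat Jb)) := by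
  refine ⟨⟨hJ.isAlmostDirac_Delta, ?_⟩, ⟨hJ.isFlatConnection_Delta, ?_⟩,
    ⟨hJ.mirror, hJ.Delta_mirror, hJ.DeltaHat_mirror, fun _ _ a _ m _ u => ?_,
      fun _ _ a _ m _ u => ?_⟩,
    fun hi => ⟨hJ.diracIntegrable_Delta hi, hJ.diracIntegrable_DeltaHat hi⟩⟩
  · rw [← hJ.Delta_mirror]
    exact hJ.mirror.isAlmostDirac_Delta
  · rw [← hJ.Delta_mirror, ← hJ.connDelta_mirror]
    exact hJ.mirror.isFlatConnection_Delta
  · rw [hJ.connDelta_mirror]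
  · rw [hJ.connDeltaHat_mirror]
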